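/- **Setting.** Let $f:\mathbb R^n\times\mathbb R^d\to\mathbb R^n$ and $\Lambda:\mathbb R\to\mathbb R^d$ be $C^1$ with $\Lambda(\tau)\to\lambda^+$ as $\tau\to+\infty$. For $r>0$ let $x^{[r]}(\tau)$ be the maximal solution of $x'=f(x,\Lambda(\tau))/r$ which either satisfies $x^{[r]}(\tau_0)=x_0$ for a fixed $(x_0,\tau_0)$, or (if also $\Lambda(\tau)\to\lambda^-$ as $\tau\to-\infty$) tends, as $\tau\to-\infty$, to a fixed hyperbolic sink $e^-$ of $\dot x=f(x,\lambda^-)$. "$x^{[r]}$ converges to a compact set $K$" means that it exists for all large $\tau$ and that its distance to $K$ tends to $0$ as $\tau\to+\infty$. The future limit system is $\dot x=f(x,\lambda^+)$. An attractor is a nonempty compact invariant set which is the $\omega$-limit set $\omega(D)=\bigcap_{T>0}\overline{\{\psi(\tau,D):\tau>T\}}$ of a neighbourhood $D$ of itself and has no nonempty proper subset with this property. Let $\eta^+$ be an equilibrium regular edge state of the future limit system: a hyperbolic equilibrium contained in a codimension-one embedded orientable forward-invariant $C^1$ manifold $\theta$ that is normally hyperbolic and repelling (along solutions in $\theta$,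 normal components of solutions of the variational equation grow at least like $e^{at}$ with $a>0$ and tangent vectors at most like $e^{bt}$ with $b<a$, uniformly), such that $\eta^+$ is an attractor for the flow restricted to $\theta$ and $\theta\subseteq W^s(\eta^+)$. Let $r_c>0$ be a critical rate: $x^{[r_c]}$ converges to $\eta^+$, and for some $\delta>0$ no $x^{[r]}$ with $0<|r-r_c|<\delta$ does. Let $\Theta^{[r_c]}(\tau)\subset\mathbb R^n$ (for $\tau>\tau_0$) be a regular R-tipping threshold anchored at infinity by $\eta^+$, for the system with $r=r_c$: codimension-one embedded orientable manifolds that are forward invariant as a nonautonomous set, consist of initial states whose solutions converge to $\eta^+$, and coincide for late times near $\eta^+$ with the local stable manifold of $\eta^+$; precisely, for every small $\varepsilon>0$ there are $\kappa>0$ and $T$ such that, for $\tau>T$ and $|y-\eta^+|<\kappa$, one has $y\in\Theta^{[r_c]}(\tau)$ if and only if the solution with $r=r_c$ from $(y,\tau)$ stays within distance $\varepsilon$ of $\eta^+$ for all future times. The upper and lower edge tails of $\eta^+$ are $$x^{[r_c^+]}=\bigcap_{T>0,\,\delta>0}\overline{\{x^{[r]}(\tau):\tau>T,\ r\in(r_c,r_c+\delta)\}},\qquad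 x^{[r_c^-]}=\bigcap_{T>0,\,\delta>0}\overline{\{x^{[r]}(\tau):\tau>T,\ r\in(r_c-\delta,r_c)\}}.$$ An edge tail $C$ is a connection from $\eta^+$ to an attractor $A\not\ni\eta^+$ of the future limit system if there is an entire solution $\varphi$ of that system, tending to $\eta^+$ in backward time and to $A$ in forward time, with $\varphi(\mathbb R)\subseteq C\subseteq\{\eta^+\}\cup\varphi(\mathbb R)\cup A$. Two connections are different if their orbits $\varphi(\mathbb R)$ are different. We say that $x^{[r]}$ lies on different sides of $\Theta^{[r_c]}$ for $r$ just below and just above $r_c$ if the following holds as the solutions depart from $\eta^+$. For every sufficiently small ball $B$ around $\eta^+$ there are $T$ and $\delta>0$ such that $\{(\tau,y):\tau>T,\ y\in B,\ y\notin\Theta^{[r_c]}(\tau)\}$ has exactly two connected components (the two sides) and, after time $T$, every $x^{[r]}$ with $r\in(r_c-\delta,r_c)$ leaves $B$ and does so, each time it leaves, from one of the sides, while every $x^{[r]}$ with $r\in(r_c,r_c+\delta)$ leaves $B$ and does so, each time, from the other side. **Proposition.** (a) If $x^{[r]}$ lies on different sides of $\Theta^{[r_c]}$ for $r$ just below and just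 above $r_c$, then $x^{[r_c^+]}\neq x^{[r_c^-]}$. (b) If each edge tail is a connection from $\eta^+$ to an attractor, then there is a $\delta>0$ such that $x^{[r]}$ converges to an attractor of the future limit system whenever $0<|r-r_c|<\delta$. (c) If the upper and lower edge tails are different connections from $\eta^+$ to attractors $A_{\rm up}$ and $A_{\rm low}$ (possibly equal), then $x^{[r]}$ lies on different sides of $\Theta^{[r_c]}$ for $r$ just below and just above $r_c$, and there is a $\delta>0$ such that $x^{[r]}$ converges to $A_{\rm low}$ for $r\in(r_c-\delta,r_c)$ and to $A_{\rm up}$ for $r\in(r_c,r_c+\delta)$. -/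

import Mathlib

open Set Filter Topology

/-- `u` solves the (nonautonomous) differential equation `u' = G(t, u)` on the set `J` of times
(with one-sided derivatives at endpoints that belong to `J`). -/
def IsSol {E : Type*} [NormedAddCommGroup E] [NormedSpace ℝ E]
    (G : ℝ → E → E) (J : Set ℝ) (u : ℝ → E) : Prop :=
  ∀ t ∈ J, HasDerivWithinAt u (G t (u t)) J t

/-- `u` on the open interval `J` is a maximal (non-extendable) solution of `u' = G(t, u)`. -/
structure IsMaximalSol {E : Type*} [NormedAddCommGroup E] [NormedSpace ℝ E]
    (G : ℝ → E → E) (J : Set ℝ) (u : ℝ → E) : Prop where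
  isOpen : IsOpen J
  ordConnected : J.OrdConnected
  nonempty : J.Nonempty
  isSol : IsSol G J u
  maximal : ∀ (J' : Set ℝ) (u' : ℝ → E), IsOpen J' → J'.OrdConnected → J ⊆ J' →
    IsSol G J' u' → EqOn u u' J → J' ⊆ J

/-- The solution `u`, defined on `J`, exists for all large times and its distance to the set `K`
tends to zero as time tends to `+∞`. -/
def ConvergesTo {E : Type*} [NormedAddCommGroup E] (J : Set ℝ) (u : ℝ → E) (K : Set E) : Prop :=
  (∃ T : ℝ, Ioi T ⊆ J) ∧ Tendsto (fun t => Metric.infDist (u t) K) atTop (𝓝 0)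

section Autonomous

/-! ### Notions for an autonomous system `x' = F x` on `ℝⁿ` -/

/-- The `ω`-limit set of a set `D` of initial states: the intersection over `T > 0` of the closures
of the set of all states reached from `D` at times later than `T`. -/
def omegaLimitSet {n : ℕ} (F : EuclideanSpace ℝ (Fin n) → EuclideanSpace ℝ (Fin n))
    (D : Set (EuclideanSpace ℝ (Fin n))) : Set (EuclideanSpace ℝ (Fin n)) :=
  ⋂ T > (0 : ℝ), closure {y | ∃ τ > T, ∃ u : ℝ → EuclideanSpace ℝ (Fin n),
    IsSol (fun _ => F) (Icc 0 τ) u ∧ u 0 ∈ D ∧ u τ = y}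

/-- `A` is invariant: through each of its points there is an entire solution inside `A`. -/
def IsInvariantSet {n : ℕ} (F : EuclideanSpace ℝ (Fin n) → EuclideanSpace ℝ (Fin n))
    (A : Set (EuclideanSpace ℝ (Fin n))) : Prop :=
  ∀ a ∈ A, ∃ u : ℝ → EuclideanSpace ℝ (Fin n),
    IsSol (fun _ => F) univ u ∧ u 0 = a ∧ ∀ t, u t ∈ A

/-- `A` is the `ω`-limit set of a neighbourhood of itself relative to `M`. -/
def IsOmegaLimitOfNhd {n : ℕ} (F : EuclideanSpace ℝ (Fin n) → EuclideanSpace ℝ (Fin n))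
    (M A : Set (EuclideanSpace ℝ (Fin n))) : Prop :=
  ∃ U ∈ 𝓝ˢ A, omegaLimitSet F (U ∩ M) = A

/-- `A` is an attractor for the flow restricted to the forward-invariant set `M`: a nonempty compact
invariant subset of `M` that is the `ω`-limit set of a neighbourhood of itself in `M`, and such that
no nonempty proper subset of `A` has this last property. -/
structure IsAttractorIn {n : ℕ} (F : EuclideanSpace ℝ (Fin n) → EuclideanSpace ℝ (Fin n))
    (M A : Set (EuclideanSpace ℝ (Fin n))) : Prop where
  subset : A ⊆ M
  nonempty : A.Nonempty
  isCompact : IsCompact A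
  invariant : IsInvariantSet F A
  attracts : IsOmegaLimitOfNhd F M A
  minimal : ∀ B, B ⊂ A → B.Nonempty → ¬ IsOmegaLimitOfNhd F M B

/-- `A` is an attractor of `x' = F x`. -/
def IsAttractor {n : ℕ} (F : EuclideanSpace ℝ (Fin n) → EuclideanSpace ℝ (Fin n))
    (A : Set (EuclideanSpace ℝ (Fin n))) : Prop :=
  IsAttractorIn F univ A

/-- `e` is an equilibrium and all eigenvalues of the linearisation have negative real part. -/
def IsHyperbolicSink {n : ℕ} (F : EuclideanSpace ℝ (Fin n) → EuclideanSpace ℝ (Fin n))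
    (e : EuclideanSpace ℝ (Fin n)) : Prop :=
  F e = 0 ∧ ∀ μ : ℂ,
    Polynomial.aeval μ (LinearMap.charpoly (fderiv ℝ F e).toLinearMap) = 0 → μ.re < 0

/-- `e` is an equilibrium and no eigenvalue of the linearisation is purely imaginary. -/
def IsHyperbolicEquilibrium {n : ℕ} (F : EuclideanSpace ℝ (Fin n) → EuclideanSpace ℝ (Fin n))
    (e : EuclideanSpace ℝ (Fin n)) : Prop :=
  F e = 0 ∧ ∀ μ : ℂ,
    Polynomial.aeval μ (LinearMap.charpoly (fderiv ℝ F e).toLinearMap) = 0 → μ.re ≠ 0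

/-- `S` is a codimension-one embedded orientable `C¹` submanifold of `ℝⁿ` (without boundary), with
continuous unit normal field `ν`: near each of its points, `S` is the zero set of a `C¹` function
whose gradient on `S` is a nonzero multiple of `ν`. -/
structure IsOrientedHypersurface {n : ℕ} (S : Set (EuclideanSpace ℝ (Fin n)))
    (ν : EuclideanSpace ℝ (Fin n) → EuclideanSpace ℝ (Fin n)) : Prop where
  continuousOn_normal : ContinuousOn ν S
  norm_normal : ∀ p ∈ S, ‖ν p‖ = 1
  local_eq : ∀ p ∈ S, ∃ W : Set (EuclideanSpace ℝ (Fin n)), IsOpen W ∧ p ∈ W ∧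
    ∃ g : EuclideanSpace ℝ (Fin n) → ℝ, ContDiffOn ℝ 1 g W ∧ (∀ x ∈ W, x ∈ S ↔ g x = 0) ∧
      ∀ x ∈ W ∩ S, ∃ c : ℝ, c ≠ 0 ∧ fderiv ℝ g x = c • innerSL ℝ (ν x)

/-- `θ` is a regular threshold of `x' = F x`: a codimension-one embedded orientable forward-invariant
manifold that is normally hyperbolic and repelling. The last two properties say that, along the
solutions in `θ`, the normal component of solutions `v` of the variational equation grows at least
like `exp (a t)` with `a > 0`, while tangent vectors grow at most like `exp (b t)` with `b < a`. -/
structure IsRegularThreshold {n : ℕ} (F : EuclideanSpace ℝ (Fin n) → EuclideanSpace ℝ (Fin n))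
    (θ : Set (EuclideanSpace ℝ (Fin n))) : Prop where
  forward_invariant : ∀ x ∈ θ, ∀ t ≥ (0 : ℝ), ∀ u : ℝ → EuclideanSpace ℝ (Fin n),
    IsSol (fun _ => F) (Icc 0 t) u → u 0 = x → u t ∈ θ
  normally_repelling : ∃ ν : EuclideanSpace ℝ (Fin n) → EuclideanSpace ℝ (Fin n),
    IsOrientedHypersurface θ ν ∧ ∃ C a b : ℝ, 0 < C ∧ 0 < a ∧ b < a ∧
      ∀ t ≥ (0 : ℝ), ∀ u v : ℝ → EuclideanSpace ℝ (Fin n),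
        IsSol (fun _ => F) (Icc 0 t) u → u 0 ∈ θ →
        IsSol (fun s w => fderiv ℝ F (u s) w) (Icc 0 t) v →
          (inner ℝ (v 0) (ν (u 0)) = 0 → ‖v t‖ ≤ C * Real.exp (b * t) * ‖v 0‖) ∧
          C⁻¹ * Real.exp (a * t) * |inner ℝ (v 0) (ν (u 0))| ≤ |inner ℝ (v t) (ν (u t))|

/-- The stable set `Wˢ(η)` of the equilibrium `η`. -/
def stableSet {n : ℕ} (F : EuclideanSpace ℝ (Fin n) → EuclideanSpace ℝ (Fin n))
    (η : EuclideanSpace ℝ (Fin n)) : Set (EuclideanSpace ℝ (Fin n)) :=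
  {x | ∃ u : ℝ → EuclideanSpace ℝ (Fin n),
    IsSol (fun _ => F) (Ici 0) u ∧ u 0 = x ∧ Tendsto u atTop (𝓝 η)}

/-- `η` is an equilibrium regular edge state: a hyperbolic equilibrium lying in a regular threshold
`θ`, such that `η` is an attractor for the flow restricted to `θ` and `θ ⊆ Wˢ(η)`. -/
def IsEquilibriumRegularEdgeState {n : ℕ}
    (F : EuclideanSpace ℝ (Fin n) → EuclideanSpace ℝ (Fin n))
    (η : EuclideanSpace ℝ (Fin n)) : Prop :=
  IsHyperbolicEquilibrium F η ∧ ∃ θ : Set (EuclideanSpace ℝ (Fin n)),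
    IsRegularThreshold F θ ∧ IsAttractorIn F θ {η} ∧ θ ⊆ stableSet F η

/-- The set `C` is a connection from the equilibrium `η` to the set `A` along the entire solution
`φ`: `A` does not contain `η`, `φ` tends to `η` in backward time and to `A` in forward time, and `C`
consists of the orbit of `φ` together with limit points in `{η} ∪ A`. -/
structure IsConnection {n : ℕ} (F : EuclideanSpace ℝ (Fin n) → EuclideanSpace ℝ (Fin n))
    (η : EuclideanSpace ℝ (Fin n)) (A : Set (EuclideanSpace ℝ (Fin n)))
    (φ : ℝ → EuclideanSpace ℝ (Fin n)) (C : Set (EuclideanSpace ℝ (Fin n))) : Prop where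
  notMem : η ∉ A
  isSol : IsSol (fun _ => F) univ φ
  backward : Tendsto φ atBot (𝓝 η)
  forward : ConvergesTo univ φ A
  orbit_subset : range φ ⊆ C
  subset : C ⊆ {η} ∪ range φ ∪ A

end Autonomous

section RateDependent

/-! ### The nonautonomous system `x' = f (x, Λ τ) / r` with rate parameter `r > 0` -/

/-- The right-hand side `f (y, Λ τ) / r`. -/
noncomputable def rateField {n d : ℕ}
    (f : EuclideanSpace ℝ (Fin n) → EuclideanSpace ℝ (Fin d) → EuclideanSpace ℝ (Fin n))
    (Λ : ℝ → EuclideanSpace ℝ (Fin d)) (r : ℝ) :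
    ℝ → EuclideanSpace ℝ (Fin n) → EuclideanSpace ℝ (Fin n) :=
  fun τ y => r⁻¹ • f y (Λ τ)

/-- `x r`, on the interval `J r`, is for each rate `r > 0` the maximal solution that either starts
from a state `x₀` at time `τ₀`, both independent of `r`, or tends as `τ → -∞` to a hyperbolic sink
`e` (independent of `r`) of the past limit system, `Λ` then also having a past limit. -/
def IsSolutionFamily {n d : ℕ}
    (f : EuclideanSpace ℝ (Fin n) → EuclideanSpace ℝ (Fin d) → EuclideanSpace ℝ (Fin n))
    (Λ : ℝ → EuclideanSpace ℝ (Fin d)) (J : ℝ → Set ℝ)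
    (x : ℝ → ℝ → EuclideanSpace ℝ (Fin n)) : Prop :=
  (∀ r > 0, IsMaximalSol (rateField f Λ r) (J r) (x r)) ∧
  ((∃ (x₀ : EuclideanSpace ℝ (Fin n)) (τ₀ : ℝ), ∀ r > 0, τ₀ ∈ J r ∧ x r τ₀ = x₀) ∨
   (∃ (lamMinus : EuclideanSpace ℝ (Fin d)) (e : EuclideanSpace ℝ (Fin n)),
      Tendsto Λ atBot (𝓝 lamMinus) ∧ IsHyperbolicSink (fun y => f y lamMinus) e ∧
      ∀ r > 0, (∀ᶠ τ in atBot, τ ∈ J r) ∧ Tendsto (x r) atBot (𝓝 e)))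

/-- `rc > 0` is a critical rate for R-tipping to `η`: the solution with rate `rc` converges to `η`,
those with rates `r ≠ rc` sufficiently close to `rc` do not. -/
def IsCriticalRate {n : ℕ} (J : ℝ → Set ℝ) (x : ℝ → ℝ → EuclideanSpace ℝ (Fin n))
    (η : EuclideanSpace ℝ (Fin n)) (rc : ℝ) : Prop :=
  0 < rc ∧ ConvergesTo (J rc) (x rc) {η} ∧
    ∃ δ > 0, ∀ r, 0 < |r - rc| → |r - rc| < δ → ¬ ConvergesTo (J r) (x r) {η}

/-- The upper edge tail. -/
def upperEdgeTail {n : ℕ} (J : ℝ → Set ℝ) (x : ℝ → ℝ → EuclideanSpace ℝ (Fin n)) (rc : ℝ) :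
    Set (EuclideanSpace ℝ (Fin n)) :=
  ⋂ T > (0 : ℝ), ⋂ δ > (0 : ℝ),
    closure {y | ∃ r ∈ Ioo rc (rc + δ), ∃ τ ∈ J r, T < τ ∧ x r τ = y}

/-- The lower edge tail. -/
def lowerEdgeTail {n : ℕ} (J : ℝ → Set ℝ) (x : ℝ → ℝ → EuclideanSpace ℝ (Fin n)) (rc : ℝ) :
    Set (EuclideanSpace ℝ (Fin n)) :=
  ⋂ T > (0 : ℝ), ⋂ δ > (0 : ℝ),
    closure {y | ∃ r ∈ Ioo (rc - δ) rc, ∃ τ ∈ J r, T < τ ∧ x r τ = y}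

/-- The sets `Θ τ`, for `τ > τ₀`, form a regular R-tipping threshold, for the nonautonomous system
`x' = G(τ, x)`, that is anchored at infinity by the equilibrium `η` of the future limit system: each
`Θ τ` is a codimension-one embedded orientable manifold, the family is forward invariant as a
nonautonomous set and contained in the stable set of `η`. Anchored at infinity by `η` means that,
for late times and close to `η`, the threshold consists of all states whose solutions stay close to
`η` in the future, i.e. `Θ τ` is there the local stable manifold of `η`. -/
structure IsRegularRTippingThreshold {n : ℕ}
    (G : ℝ → EuclideanSpace ℝ (Fin n) → EuclideanSpace ℝ (Fin n))
    (η : EuclideanSpace ℝ (Fin n)) (τ₀ : ℝ) (Θ : ℝ → Set (EuclideanSpace ℝ (Fin n))) : Prop where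
  hypersurface : ∀ τ > τ₀, ∃ ν : EuclideanSpace ℝ (Fin n) → EuclideanSpace ℝ (Fin n),
    IsOrientedHypersurface (Θ τ) ν
  forward_invariant : ∀ s > τ₀, ∀ x ∈ Θ s, ∀ t ≥ s, ∀ u : ℝ → EuclideanSpace ℝ (Fin n),
    IsSol G (Icc s t) u → u s = x → u t ∈ Θ t
  stable : ∀ s > τ₀, ∀ x ∈ Θ s, ∃ u : ℝ → EuclideanSpace ℝ (Fin n),
    IsSol G (Ici s) u ∧ u s = x ∧ Tendsto u atTop (𝓝 η)
  anchored : ∃ ε₀ > 0, ∀ ε ∈ Ioo (0 : ℝ) ε₀, ∃ κ > 0, ∃ T ≥ τ₀, ∀ τ > T, ∀ x ∈ Metric.ball η κ,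
    x ∈ Θ τ ↔ ∃ u : ℝ → EuclideanSpace ℝ (Fin n),
      IsSol G (Ici τ) u ∧ u τ = x ∧ ∀ t ≥ τ, u t ∈ Metric.ball η ε

/-- `S₁` and `S₂` are the two sides of the threshold `Θ` near `η` at times `τ > T`: the threshold
divides the region `{(τ, y) : τ > T, ‖y - η‖ < ρ}` into exactly two connected components, which are
`S₁` and `S₂`. -/
structure AreSides {n : ℕ} (Θ : ℝ → Set (EuclideanSpace ℝ (Fin n)))
    (η : EuclideanSpace ℝ (Fin n)) (ρ T : ℝ)
    (S₁ S₂ : Set (ℝ × EuclideanSpace ℝ (Fin n))) : Prop where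
  isOpen_left : IsOpen S₁
  isOpen_right : IsOpen S₂
  isConnected_left : IsConnected S₁
  isConnected_right : IsConnected S₂
  disjoint : Disjoint S₁ S₂
  union_eq : S₁ ∪ S₂ = (Ioi T ×ˢ Metric.ball η ρ) \ {p | p.2 ∈ Θ p.1}

/-- At the time `t > T` the solution `u`, defined on `J`, leaves the open set `B`. -/
def IsExitTime {n : ℕ} (J : Set ℝ) (u : ℝ → EuclideanSpace ℝ (Fin n))
    (B : Set (EuclideanSpace ℝ (Fin n))) (T t : ℝ) : Prop :=
  t ∈ J ∧ T < t ∧ u t ∉ B ∧ ∀ᶠ σ in 𝓝[<] t, u σ ∈ B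

/-- After time `T`, the solution `u` leaves `B`, and whenever it does so it lies in `S`
(a subset of time × space) just before. -/
def LeavesOnSide {n : ℕ} (J : Set ℝ) (u : ℝ → EuclideanSpace ℝ (Fin n))
    (B : Set (EuclideanSpace ℝ (Fin n))) (T : ℝ)
    (S : Set (ℝ × EuclideanSpace ℝ (Fin n))) : Prop :=
  (∃ t, IsExitTime J u B T t) ∧
    ∀ t, IsExitTime J u B T t → ∀ᶠ σ in 𝓝[<] t, (σ, u σ) ∈ S

/-- The solutions `x r` with `r` just below `rc` and those with `r` just above `rc` lie on different
sides of the threshold `Θ` as they depart from it: for each sufficiently small ball around `η`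
there are a time `T` after which `Θ` has two sides in this ball, and a `δ > 0`, such that all
solutions with `r ∈ (rc - δ, rc)` leave the ball on one of the sides, and all those with
`r ∈ (rc, rc + δ)` leave it on the other side. -/
def LieOnDifferentSides {n : ℕ} (J : ℝ → Set ℝ) (x : ℝ → ℝ → EuclideanSpace ℝ (Fin n))
    (Θ : ℝ → Set (EuclideanSpace ℝ (Fin n))) (η : EuclideanSpace ℝ (Fin n)) (rc : ℝ) : Prop :=
  ∃ ρ₀ > 0, ∀ ρ ∈ Ioo (0 : ℝ) ρ₀, ∃ (T : ℝ) (S₁ S₂ : Set (ℝ × EuclideanSpace ℝ (Fin n))),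
    AreSides Θ η ρ T S₁ S₂ ∧ ∃ δ > 0,
      (∀ r ∈ Ioo (rc - δ) rc, LeavesOnSide (J r) (x r) (Metric.ball η ρ) T S₁) ∧
      (∀ r ∈ Ioo rc (rc + δ), LeavesOnSide (J r) (x r) (Metric.ball η ρ) T S₂)

end RateDependent

/-! Everything rests on one quadratic form near `η`. Hyperbolicity gives a symmetric form `B` with
`B v (A v) ≥ c‖v‖²` for the linearisation `A` (`exists_lyapunov`). By strict differentiability, `B Δ
Δ` then grows along the difference `Δ` of two solutions near `η`, at a rate bounded below by a
multiple of `‖Δ‖²`, for all parameters near the future limit (`exists_isLocallyExpanding`). Hence `B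
Δ Δ ≤ 0` for two solutions that both stay near `η` in the future, and `B Δ Δ > 0` for two distinct
ones that both stayed there in the past.

The edge state has a single unstable direction. The normal `ν` of its threshold at `η` is a left
eigenvector of `A` with eigenvalue at least zero, and `B ≤ 0` on the hyperplane orthogonal to `ν`,
because the flow on the threshold is attracted by `η`. Adding a multiple of `⟨v, ν⟩²` to `B` keeps
both properties and widens the cone `B > 0` (`exists_cone`). The hyperplane cuts this cone into two
convex halves, each forward invariant for differences of solutions. In particular, `η` has at most
one unstable branch in each half (`range_eq`).

For `r = rc`, a state near `η` either has a solution that stays near `η`, and then lies on the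
threshold by anchoring, or its difference from `x rc` enters one of the half cones before the
solution leaves a larger ball. The two sets of departing states are open, disjoint and connected, so
they are the sides of the threshold, and each contains a half cone around `x rc`
(`exists_areConeSides`).

As `r → rc`, the exit times of `x r` from a small ball tend to infinity, and the exit points
accumulate at end points of backward solutions of the limit system inside the closed ball
(`exists_backward_tail`). Such an end point `p` has `p - η` in the cone. (a) If the tails coincide,
`p` belongs to both. Solutions with rates below and above `rc` that pass near `p` then leave within
one half cone around `x rc` (`inter_nonempty`), hence on one and the same side. (b) In a ball that
does not reach the attractor, exit points accumulate on the connecting orbit. Solutions shadow it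
into a neighbourhood of the attractor, which captures them because attractors persist under
asymptotically vanishing perturbations (`exists_stays_near`, `eventually_convergesTo`). (c)
Different connections depart along different half cones. A connection stays away from `η` after its
departure, so every exit from a small ball is close to the departing piece, and this determines the
side (`exists_leavesOnSide`). -/

/-! ### Grönwall estimates, uniqueness and global existence -/

section ODE

variable {E : Type*} [NormedAddCommGroup E] [NormedSpace ℝ E]
  {G H : ℝ → E → E} {J J' : Set ℝ} {u w : ℝ → E}

theorem IsSol.mono (h : IsSol G J u) (hJ : J' ⊆ J) : IsSol G J' u :=
  fun t ht => (h t (hJ ht)).mono hJ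

theorem IsSol.continuousOn (h : IsSol G J u) : ContinuousOn u J :=
  fun t ht => (h t ht).continuousWithinAt

theorem IsSol.congr_field (h : IsSol G J u) (hG : ∀ t ∈ J, G t (u t) = H t (u t)) :
    IsSol H J u :=
  fun t ht => hG t ht ▸ h t ht

/-- The values `c = -1`, `c = 1` and `c = r⁻¹` give time reversal, time shift, and the passage from
`x' = f` to `x' = f / r`. -/
theorem IsSol.comp_affine (h : IsSol G J u) (c b : ℝ) :
    IsSol (fun t y => c • G (c * t + b) y) ((fun t => c * t + b) ⁻¹' J)
      (fun t => u (c * t + b)) := fun t ht => by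
  have h1 : HasDerivWithinAt (fun t : ℝ => c * t + b) c ((fun t => c * t + b) ⁻¹' J) t := by
    simpa using (((hasDerivAt_id t).const_mul c).add_const b).hasDerivWithinAt
  exact (h (c * t + b) ht).scomp t h1 (fun s hs => hs)

theorem isSol_const {y : E} (h : ∀ t ∈ J, G t y = 0) : IsSol G J (fun _ => y) := fun t ht => by
  show HasDerivWithinAt _ (G t y) _ _
  rw [h t ht]; exact hasDerivWithinAt_const _ _ _

theorem gronwallBound_le {δ K ε x : ℝ} (hK : 0 ≤ K) (hε : 0 ≤ ε) (_hx : 0 ≤ x) :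
    gronwallBound δ K ε x ≤ (δ + ε * x) * Real.exp (K * x) := by
  rcases hK.eq_or_lt with rfl | hK
  · simp [gronwallBound_K0]
  · rw [gronwallBound_of_K_ne_0 hK.ne']
    -- This is `1 - y ≤ exp (-y)` multiplied by `exp y`, for `y = K x`; it removes the division by
    -- `K` from the bound.
    have h1 : Real.exp (K * x) - 1 ≤ K * x * Real.exp (K * x) := by
      have h2 := Real.add_one_le_exp (-(K * x))
      have h3 : Real.exp (-(K * x)) * Real.exp (K * x) = 1 := by rw [← Real.exp_add]; simp
      nlinarith [Real.exp_pos (K * x)]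
    have h4 : ε / K * (Real.exp (K * x) - 1) ≤ ε / K * (K * x * Real.exp (K * x)) := by gcongr
    have h5 : ε / K * (K * x * Real.exp (K * x)) = ε * x * Real.exp (K * x) := by field_simp
    simp only; linarith [add_mul δ (ε * x) (Real.exp (K * x))]

/-- Only `H` has to be Lipschitz, and the two fields are compared along `u` alone. One `ε` serves
for the defect and for the initial distance, so a single constant governs all later estimates. -/
theorem IsSol.dist_le_right {K : NNReal} {ε a b T : ℝ} (hu : IsSol G (Icc a b) u)
    (hw : IsSol H (Icc a b) w) (hH : ∀ t, LipschitzWith K (H t)) (hε : 0 ≤ ε)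
    (herr : ∀ t ∈ Icc a b, dist (G t (u t)) (H t (u t)) ≤ ε) (ha : dist (u a) (w a) ≤ ε)
    (hT : b - a ≤ T) : ∀ t ∈ Icc a b, dist (u t) (w t) ≤ (1 + T) * Real.exp (K * T) * ε := by
  intro t ht
  have key := dist_le_of_approx_trajectories_ODE (f' := fun t => G t (u t))
    (g' := fun t => H t (w t)) (εf := ε) (εg := 0) hH hu.continuousOn
    (fun s hs => ((hu s (Ico_subset_Icc_self hs)).mono_of_mem_nhdsWithin
      (Icc_mem_nhdsGE_of_mem hs)))
    (fun s hs => herr s (Ico_subset_Icc_self hs)) hw.continuousOn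
    (fun s hs => ((hw s (Ico_subset_Icc_self hs)).mono_of_mem_nhdsWithin
      (Icc_mem_nhdsGE_of_mem hs))) (fun s _ => by simp) ha t ht
  have h1 : 0 ≤ t - a := by linarith [ht.1]
  have h2 : t - a ≤ T := by linarith [ht.2]
  refine key.trans ((gronwallBound_le K.2 (by simpa using hε) h1).trans ?_)
  calc (ε + (ε + 0) * (t - a)) * Real.exp (K * (t - a))
      ≤ (ε + (ε + 0) * T) * Real.exp (K * T) := by
        have : 0 ≤ T := h1.trans h2
        gcongr
    _ = _ := by ring

theorem IsSol.dist_le_left {K : NNReal} {ε a b T : ℝ} (hu : IsSol G (Icc a b) u)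
    (hw : IsSol H (Icc a b) w) (hH : ∀ t, LipschitzWith K (H t)) (hε : 0 ≤ ε)
    (herr : ∀ t ∈ Icc a b, dist (G t (u t)) (H t (u t)) ≤ ε) (hb : dist (u b) (w b) ≤ ε)
    (hT : b - a ≤ T) : ∀ t ∈ Icc a b, dist (u t) (w t) ≤ (1 + T) * Real.exp (K * T) * ε := by
  intro t ht
  have hpre : Icc (-b) (-a) ⊆ (fun t : ℝ => -1 * t + 0) ⁻¹' Icc a b := fun s hs => by
    simp only [mem_preimage, mem_Icc] at hs ⊢; constructor <;> linarith [hs.1, hs.2]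
  have hL : ∀ t, LipschitzWith K (fun y => (-1 : ℝ) • H (-1 * t + 0) y) := fun t => by
    refine LipschitzWith.of_dist_le_mul fun y z => ?_
    simpa [neg_smul, dist_neg_neg] using (hH (-1 * t + 0)).dist_le_mul y z
  have key := IsSol.dist_le_right (T := T) (ε := ε) ((hu.comp_affine (-1) 0).mono hpre)
    ((hw.comp_affine (-1) 0).mono hpre) hL hε (fun s hs => by
      have := herr (-1 * s + 0) (hpre hs)
      simpa [neg_smul, dist_neg_neg] using this) (by simpa using hb) (by linarith) (-t)
      ⟨by linarith [ht.2], by linarith [ht.1]⟩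
  simpa using key

/-- Grönwall's inequality in both time directions. -/
theorem IsSol.dist_le {K : NNReal} {ε a b c T : ℝ} (hu : IsSol G (Icc a b) u)
    (hw : IsSol H (Icc a b) w) (hH : ∀ t, LipschitzWith K (H t)) (hε : 0 ≤ ε)
    (herr : ∀ t ∈ Icc a b, dist (G t (u t)) (H t (u t)) ≤ ε) (hc : c ∈ Icc a b)
    (hd : dist (u c) (w c) ≤ ε) (hT : b - a ≤ T) :
    ∀ t ∈ Icc a b, dist (u t) (w t) ≤ (1 + T) * Real.exp (K * T) * ε := by
  intro t ht
  rcases le_total c t with h | h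
  · have hs : Icc c b ⊆ Icc a b := Icc_subset_Icc_left hc.1
    exact (hu.mono hs).dist_le_right (hw.mono hs) hH hε (fun s hs' => herr s (hs hs')) hd
      (by linarith [hc.1]) t ⟨h, ht.2⟩
  · have hs : Icc a c ⊆ Icc a b := Icc_subset_Icc_right hc.2
    exact (hu.mono hs).dist_le_left (hw.mono hs) hH hε (fun s hs' => herr s (hs hs')) hd
      (by linarith [hc.2]) t ⟨ht.1, h⟩

theorem IsSol.eqOn_of_lipschitz {K : NNReal} {c : ℝ} (hu : IsSol H J u) (hw : IsSol H J w)
    (hH : ∀ t, LipschitzWith K (H t)) (hJ : J.OrdConnected) (hc : c ∈ J) (h : u c = w c) :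
    EqOn u w J := fun t ht => by
  have hsub : Icc (min c t) (max c t) ⊆ J := by
    have := hJ.uIcc_subset hc ht
    rwa [uIcc] at this
  have := (hu.mono hsub).dist_le (hw.mono hsub) hH le_rfl (fun s _ => by simp)
    ⟨min_le_left _ _, le_max_left _ _⟩ (by simp [h]) le_rfl t ⟨min_le_right _ _, le_max_right _ _⟩
  simpa using this

/-- Global existence for bounded, globally Lipschitz fields. -/
theorem exists_isSol_univ [CompleteSpace E] {K M : NNReal} (hH : ∀ t, LipschitzWith K (H t))
    (hcont : ∀ y, Continuous fun t => H t y) (hM : ∀ t y, ‖H t y‖ ≤ M) (t₀ : ℝ) (y₀ : E) :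
    ∃ u, IsSol H univ u ∧ u t₀ = y₀ := by
  have loc : ∀ k : ℕ, ∃ u : ℝ → E, u t₀ = y₀ ∧ IsSol H (Icc (t₀ - (k + 1)) (t₀ + (k + 1))) u := by
    intro k
    have hk : (0 : ℝ) ≤ k := k.cast_nonneg
    -- With speed at most `M`, a solution cannot leave the ball of radius `M (k + 1)` within time `k
    -- + 1`, so there is no restriction on the length of the interval.
    have hpl : IsPicardLindelof H (tmin := t₀ - (k + 1)) (tmax := t₀ + (k + 1))
        ⟨t₀, by constructor <;> linarith⟩ y₀ (M * (k + 1)) 0 M K :=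
      { lipschitzOnWith := fun t _ => (hH t).lipschitzOnWith
        continuousOn := fun y _ => (hcont y).continuousOn
        norm_le := fun t _ y _ => hM t y
        mul_max_le := by simp }
    obtain ⟨u, h1, h2⟩ := hpl.exists_eq_forall_mem_Icc_hasDerivWithinAt₀
    exact ⟨u, h1, h2⟩
  choose v hv0 hv using loc
  have hsub : ∀ {k l : ℕ}, k ≤ l →
      Icc (t₀ - (k + 1 : ℝ)) (t₀ + (k + 1)) ⊆ Icc (t₀ - (l + 1)) (t₀ + (l + 1)) := by
    intro k l hkl
    have : (k : ℝ) ≤ l := by exact_mod_cast hkl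
    exact Icc_subset_Icc (by linarith) (by linarith)
  have heq : ∀ {k l : ℕ}, k ≤ l → EqOn (v k) (v l) (Icc (t₀ - (k + 1)) (t₀ + (k + 1))) := by
    intro k l hkl
    have hk : (0 : ℝ) ≤ k := k.cast_nonneg
    exact (hv k).eqOn_of_lipschitz ((hv l).mono (hsub hkl)) hH ordConnected_Icc
      (c := t₀) ⟨by linarith, by linarith⟩ (by rw [hv0, hv0])
  have hmem : ∀ (t : ℝ) (l : ℕ), ⌈|t - t₀|⌉₊ ≤ l → t ∈ Icc (t₀ - (l : ℝ)) (t₀ + l) := by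
    intro t l hl
    have h1 : |t - t₀| ≤ l := (Nat.le_ceil _).trans (by exact_mod_cast hl)
    rw [abs_le] at h1
    exact ⟨by linarith, by linarith⟩
  -- The solution with index `⌈|t - t₀|⌉₊` lives on an interval reaching one unit beyond that index,
  -- which is therefore a neighbourhood of `t`.
  refine ⟨fun t => v ⌈|t - t₀|⌉₊ t, fun t _ => ?_, ?_⟩
  · set k := ⌈|t - t₀|⌉₊ with hk
    have htk := hmem t k le_rfl
    have hnhds : Ioo (t₀ - (k + 1 : ℝ)) (t₀ + (k + 1)) ∈ 𝓝 t :=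
      Ioo_mem_nhds (by linarith [htk.1]) (by linarith [htk.2])
    have h1 : HasDerivAt (v k) (H t (v k t)) t :=
      (hv k t ⟨by linarith [htk.1], by linarith [htk.2]⟩).hasDerivAt
        (mem_of_superset hnhds Ioo_subset_Icc_self)
    refine (h1.congr_of_eventuallyEq ?_).hasDerivWithinAt
    filter_upwards [hnhds] with s hs
    have hs1 := hmem s ⌈|s - t₀|⌉₊ le_rfl
    have hs2 : s ∈ Icc (t₀ - ((⌈|s - t₀|⌉₊ : ℝ) + 1)) (t₀ + ((⌈|s - t₀|⌉₊ : ℝ) + 1)) :=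
      ⟨by linarith [hs1.1], by linarith [hs1.2]⟩
    rcases le_total ⌈|s - t₀|⌉₊ k with h | h
    · exact heq h hs2
    · exact (heq h (Ioo_subset_Icc_self hs)).symm
  · simp [hv0]

end ODE

/-! ### Cut-off fields -/

section Cutoff

/-- `fc` is a bounded, globally Lipschitz field that agrees with `f` on a large ball. -/
structure IsCutoff {n d : ℕ}
    (f fc : EuclideanSpace ℝ (Fin n) → EuclideanSpace ℝ (Fin d) → EuclideanSpace ℝ (Fin n))
    (R : ℝ) (L M : NNReal) : Prop where
  lipschitz : LipschitzWith L
    (fun p : EuclideanSpace ℝ (Fin n) × EuclideanSpace ℝ (Fin d) => fc p.1 p.2)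
  bound : ∀ y l, ‖fc y l‖ ≤ M
  eq : ∀ y l, ‖y‖ ≤ R → ‖l‖ ≤ R → fc y l = f y l

variable {n d : ℕ}
  {f fc : EuclideanSpace ℝ (Fin n) → EuclideanSpace ℝ (Fin d) → EuclideanSpace ℝ (Fin n)}
  {Λ : ℝ → EuclideanSpace ℝ (Fin d)} {R r : ℝ} {L M : NNReal}

/-- A `C¹` field times a bump function has compact support, hence is bounded and globally Lipschitz.
Cut-off solutions are global and obey Grönwall, and they solve the original equation while they and
`Λ` remain in the ball of radius `R`. -/
theorem exists_isCutoff
    (hf : ContDiff ℝ 1 (fun p : EuclideanSpace ℝ (Fin n) × EuclideanSpace ℝ (Fin d) => f p.1 p.2))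
    (R : ℝ) : ∃ fc L M, IsCutoff f fc R L M := by
  let χ : ContDiffBump (0 : EuclideanSpace ℝ (Fin n) × EuclideanSpace ℝ (Fin d)) :=
    ⟨|R| + 1, |R| + 2, by positivity, by linarith⟩
  let g : EuclideanSpace ℝ (Fin n) × EuclideanSpace ℝ (Fin d) → EuclideanSpace ℝ (Fin n) :=
    fun p => χ p • f p.1 p.2
  have hg : ContDiff ℝ 1 g := χ.contDiff.smul hf
  have hsupp : HasCompactSupport g := χ.hasCompactSupport.smul_right
  obtain ⟨C, hC⟩ := hsupp.exists_bound_of_continuous hg.continuous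
  have hC0 : 0 ≤ C := (norm_nonneg _).trans (hC 0)
  obtain ⟨L, hL⟩ : ∃ L, LipschitzWith L g :=
    hg.lipschitzWith_of_hasCompactSupport hsupp (by simp)
  refine ⟨fun y l => g (y, l), L, ⟨C, hC0⟩, hL, fun y l => hC _, fun y l hy hl => ?_⟩
  have : χ (y, l) = 1 := χ.one_of_mem_closedBall (by
    rw [mem_closedBall_zero_iff, Prod.norm_def]
    exact max_le (by show ‖y‖ ≤ |R| + 1; linarith [le_abs_self R])
      (by show ‖l‖ ≤ |R| + 1; linarith [le_abs_self R]))
  simp [g, this]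

theorem IsCutoff.dist_le (h : IsCutoff f fc R L M) (y z : EuclideanSpace ℝ (Fin n))
    (l m : EuclideanSpace ℝ (Fin d)) : dist (fc y l) (fc z m) ≤ L * max (dist y z) (dist l m) :=
  h.lipschitz.dist_le_mul (y, l) (z, m)

theorem IsCutoff.lipschitzWith_rateField (h : IsCutoff f fc R L M) {q : NNReal}
    (hq : ‖r⁻¹‖₊ ≤ q) (τ : ℝ) : LipschitzWith (q * L) (rateField fc Λ r τ) := by
  refine LipschitzWith.of_dist_le_mul fun y z => ?_
  have h1 := h.dist_le y z (Λ τ) (Λ τ)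
  rw [dist_self, max_eq_left dist_nonneg] at h1
  have h2 : ‖r⁻¹‖ ≤ q := by exact_mod_cast hq
  rw [rateField, rateField, dist_smul₀, NNReal.coe_mul, mul_assoc]
  gcongr

theorem IsCutoff.continuous_rateField (h : IsCutoff f fc R L M) (hΛ : Continuous Λ)
    (y : EuclideanSpace ℝ (Fin n)) : Continuous fun τ => rateField fc Λ r τ y := by
  have := h.lipschitz.continuous.comp (by fun_prop : Continuous fun τ => (y, Λ τ))
  exact this.const_smul r⁻¹

theorem IsCutoff.norm_rateField_le (h : IsCutoff f fc R L M) (τ : ℝ)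
    (y : EuclideanSpace ℝ (Fin n)) : ‖rateField fc Λ r τ y‖ ≤ (‖r⁻¹‖₊ * M : NNReal) := by
  rw [rateField, norm_smul, NNReal.coe_mul, coe_nnnorm]
  gcongr
  exact h.bound _ _

theorem IsCutoff.exists_isSol (h : IsCutoff f fc R L M) (hΛ : Continuous Λ) (r t₀ : ℝ)
    (y₀ : EuclideanSpace ℝ (Fin n)) : ∃ u, IsSol (rateField fc Λ r) univ u ∧ u t₀ = y₀ :=
  exists_isSol_univ (h.lipschitzWith_rateField le_rfl) (h.continuous_rateField hΛ)
    h.norm_rateField_le t₀ y₀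

theorem IsCutoff.rateField_eq (h : IsCutoff f fc R L M) {τ : ℝ} {y : EuclideanSpace ℝ (Fin n)}
    (hy : ‖y‖ ≤ R) (hτ : ‖Λ τ‖ ≤ R) : rateField fc Λ r τ y = rateField f Λ r τ y := by
  rw [rateField, rateField, h.eq _ _ hy hτ]

theorem exists_bound_Icc {X : Type*} [NormedAddCommGroup X] {u : ℝ → X} {a b : ℝ}
    (hu : ContinuousOn u (Icc a b)) : ∃ R, ∀ t ∈ Icc a b, ‖u t‖ ≤ R :=
  isCompact_Icc.exists_bound_of_continuousOn hu

end Cutoff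

/-! ### Uniqueness, continuation and shadowing for maximal solutions -/

section Maximal

variable {n d : ℕ}
  {f fc : EuclideanSpace ℝ (Fin n) → EuclideanSpace ℝ (Fin d) → EuclideanSpace ℝ (Fin n)}
  {Λ : ℝ → EuclideanSpace ℝ (Fin d)} {R r : ℝ} {L M : NNReal} {J : Set ℝ}
  {u w : ℝ → EuclideanSpace ℝ (Fin n)}

/-- The field is only locally Lipschitz, but on the compact interval between `c` and `t` both
solutions and `Λ` are bounded, so both solve the same cut-off equation. -/
theorem IsSol.eqOn_rateField
    (hf : ContDiff ℝ 1 (fun p : EuclideanSpace ℝ (Fin n) × EuclideanSpace ℝ (Fin d) => f p.1 p.2))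
    (hΛ : Continuous Λ) (hu : IsSol (rateField f Λ r) J u) (hw : IsSol (rateField f Λ r) J w)
    (hJ : J.OrdConnected) {c : ℝ} (hc : c ∈ J) (h : u c = w c) : EqOn u w J := fun t ht => by
  have hsub : Icc (min c t) (max c t) ⊆ J := by
    have := hJ.uIcc_subset hc ht
    rwa [uIcc] at this
  have hu' := hu.mono hsub
  have hw' := hw.mono hsub
  obtain ⟨R₁, h1⟩ := exists_bound_Icc hu'.continuousOn
  obtain ⟨R₂, h2⟩ := exists_bound_Icc hw'.continuousOn
  obtain ⟨R₃, h3⟩ := exists_bound_Icc (a := min c t) (b := max c t) hΛ.continuousOn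
  obtain ⟨fc, L, M, hfc⟩ := exists_isCutoff hf (max R₁ (max R₂ R₃))
  have e1 := hu'.congr_field (H := rateField fc Λ r) fun s hs => (hfc.rateField_eq
    ((h1 s hs).trans (by simp)) ((h3 s hs).trans (by simp))).symm
  have e2 := hw'.congr_field (H := rateField fc Λ r) fun s hs => (hfc.rateField_eq
    ((h2 s hs).trans (by simp)) ((h3 s hs).trans (by simp))).symm
  exact e1.eqOn_of_lipschitz e2 (hfc.lipschitzWith_rateField le_rfl) ordConnected_Icc
    ⟨min_le_left _ _, le_max_left _ _⟩ h ⟨min_le_right _ _, le_max_right _ _⟩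

/-- A maximal solution contains every solution on a compact interval that it meets. -/
theorem IsMaximalSol.Icc_subset
    (hf : ContDiff ℝ 1 (fun p : EuclideanSpace ℝ (Fin n) × EuclideanSpace ℝ (Fin d) => f p.1 p.2))
    (hΛ : Continuous Λ) (hu : IsMaximalSol (rateField f Λ r) J u) {a b c : ℝ}
    (hw : IsSol (rateField f Λ r) (Icc a b) w) (hc : c ∈ Icc a b) (hcJ : c ∈ J)
    (h : u c = w c) : Icc a b ⊆ J ∧ EqOn u w (Icc a b) := by
  classical
  suffices hsub : Icc a b ⊆ J from
    ⟨hsub, (hu.isSol.mono hsub).eqOn_rateField hf hΛ hw ordConnected_Icc hc h⟩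
  obtain ⟨R₁, h1⟩ := exists_bound_Icc hw.continuousOn
  obtain ⟨R₂, h2⟩ := exists_bound_Icc (a := a - 1) (b := b + 1) hΛ.continuousOn
  -- The margin `1` keeps the cut-off solution strictly inside the ball on an open neighbourhood of
  -- `[a, b]`.
  set R := max (R₁ + 1) R₂ with hR
  obtain ⟨fc, L, M, hfc⟩ := exists_isCutoff hf R
  obtain ⟨v, hv, hvc⟩ := hfc.exists_isSol hΛ r c (w c)
  have hsub1 : Icc a b ⊆ Icc (a - 1) (b + 1) := Icc_subset_Icc (by linarith) (by linarith)
  have hvw : EqOn v w (Icc a b) := by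
    have e2 := hw.congr_field (H := rateField fc Λ r) fun s hs => (hfc.rateField_eq
      ((h1 s hs).trans (le_max_of_le_left (by linarith)))
      ((h2 s (hsub1 hs)).trans (le_max_right _ _))).symm
    exact (hv.mono (subset_univ _)).eqOn_of_lipschitz e2 (hfc.lipschitzWith_rateField le_rfl)
      ordConnected_Icc hc hvc
  have hvcont : Continuous v := continuousOn_univ.1 hv.continuousOn
  set O : Set ℝ := {t | ‖v t‖ < R} ∩ Ioo (a - 1) (b + 1) with hO
  have hOo : IsOpen O := (isOpen_lt hvcont.norm continuous_const).inter isOpen_Ioo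
  set I := connectedComponentIn O c with hI
  have hIo : IsOpen I := hOo.connectedComponentIn
  have hI_sub : I ⊆ O := connectedComponentIn_subset _ _
  have habO : Icc a b ⊆ O := fun t ht => ⟨by
    show ‖v t‖ < R
    rw [hvw ht]
    exact (h1 t ht).trans_lt (by rw [hR]; exact lt_max_of_lt_left (by linarith)),
    by linarith [ht.1], by linarith [ht.2]⟩
  have habI : Icc a b ⊆ I := isPreconnected_Icc.subset_connectedComponentIn hc habO
  have hIc : I.OrdConnected := isPreconnected_connectedComponentIn.ordConnected
  have hvI : IsSol (rateField f Λ r) I v := (hv.mono (subset_univ _)).congr_field fun t ht =>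
    hfc.rateField_eq (hI_sub ht).1.le ((h2 t (Ioo_subset_Icc_self (hI_sub ht).2)).trans (le_max_right _ _))
  have hcI : c ∈ I := habI hc
  have heq : EqOn u v (J ∩ I) := (hu.isSol.mono inter_subset_left).eqOn_rateField hf hΛ
    (hvI.mono inter_subset_right) (hu.ordConnected.inter hIc) ⟨hcJ, hcI⟩ (by rw [h, hvc])
  -- Gluing `u` and `v`, which agree on the interval `J ∩ I`, gives a solution on `J ∪ I`;
  -- maximality then forces `I ⊆ J`.
  have hmax := hu.maximal (J ∪ I) (J.piecewise u v) (hu.isOpen.union hIo)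
    ((hu.ordConnected.isPreconnected.union c hcJ hcI hIc.isPreconnected).ordConnected)
    subset_union_left ?_ (fun t ht => (piecewise_eq_of_mem J u v ht).symm)
  · exact habI.trans (subset_union_right.trans hmax)
  · intro t ht
    have hnear : ∀ {K : Set ℝ} {z : ℝ → EuclideanSpace ℝ (Fin n)}, IsOpen K → t ∈ K →
        IsSol (rateField f Λ r) K z → EqOn (J.piecewise u v) z K →
        HasDerivWithinAt (J.piecewise u v) (rateField f Λ r t (J.piecewise u v t)) (J ∪ I) t := by
      intro K z hK htK hz hzeq
      rw [hzeq htK]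
      refine (((hz t htK).hasDerivAt (hK.mem_nhds htK)).congr_of_eventuallyEq ?_).hasDerivWithinAt
      filter_upwards [hK.mem_nhds htK] with s hs using hzeq hs
    by_cases htJ : t ∈ J
    · exact hnear hu.isOpen htJ hu.isSol fun s hs => piecewise_eq_of_mem J u v hs
    · refine hnear hIo (ht.resolve_left htJ) hvI fun s hs => ?_
      by_cases hsJ : s ∈ J
      · rw [piecewise_eq_of_mem J u v hsJ]; exact heq ⟨hsJ, hs⟩
      · rw [piecewise_eq_of_notMem J u v hsJ]

/-- The first time at which a continuous function leaves an open set. -/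
theorem exists_first_exit {X : Type*} [TopologicalSpace X] {v : ℝ → X} {B : Set X} {a b : ℝ}
    (hB : IsOpen B) (hab : a ≤ b) (hv : ContinuousOn v (Icc a b)) (ha : v a ∈ B) (hb : v b ∉ B) :
    ∃ t ∈ Ioc a b, v t ∉ B ∧ ∀ s ∈ Ico a t, v s ∈ B := by
  have hcl : IsClosed (Icc a b ∩ v ⁻¹' Bᶜ) :=
    hv.preimage_isClosed_of_isClosed isClosed_Icc hB.isClosed_compl
  have hcomp : IsCompact (Icc a b ∩ v ⁻¹' Bᶜ) := isCompact_Icc.inter_left hcl |>.of_isClosed_subset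
    hcl (fun x hx => ⟨hx, hx.1⟩)
  obtain ⟨t, ht, hmin⟩ := hcomp.exists_isLeast ⟨b, ⟨hab, le_rfl⟩, hb⟩
  have hat : a < t := lt_of_le_of_ne ht.1.1 (by rintro rfl; exact ht.2 ha)
  refine ⟨t, ⟨hat, ht.1.2⟩, ht.2, fun s hs => ?_⟩
  by_contra hsB
  exact absurd (hmin ⟨⟨hs.1, hs.2.le.trans ht.1.2⟩, hsB⟩) (not_le.2 hs.2)

theorem norm_sub_eq_of_first_exit {X : Type*} [NormedAddCommGroup X] {v : ℝ → X} {p : X}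
    {ρ a t : ℝ} (hat : a < t) (hv : ContinuousOn v (Icc a t)) (ht : v t ∉ Metric.ball p ρ)
    (hs : ∀ s ∈ Ico a t, v s ∈ Metric.ball p ρ) : ‖v t - p‖ = ρ := by
  refine le_antisymm ?_ (by simpa [Metric.mem_ball, dist_eq_norm] using ht)
  have h1 : Tendsto v (𝓝[<] t) (𝓝 (v t)) :=
    (hv t ⟨hat.le, le_rfl⟩).mono_left (nhdsWithin_le_of_mem (mem_of_superset (Ico_mem_nhdsLT hat)
      Ico_subset_Icc_self))
  refine le_of_tendsto ((h1.sub_const p).norm) ?_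
  filter_upwards [Ico_mem_nhdsLT hat] with s h
  exact (by simpa [Metric.mem_ball, dist_eq_norm] using hs s h : ‖v s - p‖ < ρ).le

/-- A maximal solution exists as long as it stays bounded. -/
theorem IsMaximalSol.Icc_subset_of_bounded
    (hf : ContDiff ℝ 1 (fun p : EuclideanSpace ℝ (Fin n) × EuclideanSpace ℝ (Fin d) => f p.1 p.2))
    (hΛ : Continuous Λ) (hu : IsMaximalSol (rateField f Λ r) J u) {b c : ℝ} (hcJ : c ∈ J)
    (hcb : c ≤ b) (hR : ∀ t ∈ J ∩ Icc c b, ‖u t‖ ≤ R) : Icc c b ⊆ J := by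
  obtain ⟨R₂, h2⟩ := exists_bound_Icc (a := c) (b := b) hΛ.continuousOn
  obtain ⟨fc, L, M, hfc⟩ := exists_isCutoff hf (max (R + 1) R₂)
  obtain ⟨v, hv, hvc⟩ := hfc.exists_isSol hΛ r c (u c)
  have key : ∀ t ∈ Icc c b, (∀ s ∈ Icc c t, ‖v s‖ ≤ R + 1) → Icc c t ⊆ J ∧ EqOn u v (Icc c t) := by
    intro t ht hvt
    have hvsol : IsSol (rateField f Λ r) (Icc c t) v :=
      (hv.mono (subset_univ _)).congr_field fun s hs => hfc.rateField_eq
        ((hvt s hs).trans (le_max_left _ _))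
        ((h2 s ⟨hs.1, hs.2.trans ht.2⟩).trans (le_max_right _ _))
    exact hu.Icc_subset hf hΛ hvsol ⟨le_rfl, ht.1⟩ hcJ hvc.symm
  have hvcont : Continuous v := continuousOn_univ.1 hv.continuousOn
  -- Up to the first time at which `v` has norm `R + 1` it solves the original equation and so
  -- equals `u`; but `u` is bounded by `R`.
  have hvb : ∀ t ∈ Icc c b, v t ∈ Metric.ball (0 : EuclideanSpace ℝ (Fin n)) (R + 1) := by
    by_contra! hcon
    obtain ⟨t₁, ht₁, hvt₁⟩ := hcon
    have hc0 : v c ∈ Metric.ball (0 : EuclideanSpace ℝ (Fin n)) (R + 1) := by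
      rw [hvc, mem_ball_zero_iff]
      linarith [hR c ⟨hcJ, le_rfl, hcb⟩]
    obtain ⟨t, ht, htB, hs⟩ := exists_first_exit Metric.isOpen_ball ht₁.1 hvcont.continuousOn hc0
      hvt₁
    have hn := norm_sub_eq_of_first_exit ht.1 hvcont.continuousOn htB hs
    rw [sub_zero] at hn
    have htb : t ∈ Icc c b := ⟨ht.1.le, ht.2.trans ht₁.2⟩
    obtain ⟨h3, h4⟩ := key t htb fun s hs' => by
      rcases hs'.2.eq_or_lt with rfl | hlt
      · exact hn.le
      · exact (mem_ball_zero_iff.1 (hs s ⟨hs'.1, hlt⟩)).le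
    have h5 := hR t ⟨h3 ⟨htb.1, le_rfl⟩, htb⟩
    rw [h4 ⟨htb.1, le_rfl⟩] at h5
    linarith
  exact (key b ⟨hcb, le_rfl⟩ fun s hs => (mem_ball_zero_iff.1 (hvb s hs)).le).1

/-- A maximal solution that starts close to an approximate solution exists, and stays close to it,
on a given compact interval. -/
theorem IsMaximalSol.shadow
    (hf : ContDiff ℝ 1 (fun p : EuclideanSpace ℝ (Fin n) × EuclideanSpace ℝ (Fin d) => f p.1 p.2))
    (hΛ : Continuous Λ) (hu : IsMaximalSol (rateField f Λ r) J u) (hfc : IsCutoff f fc R L M)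
    {q : NNReal} (hq : ‖r⁻¹‖₊ ≤ q) {a b c T ε : ℝ} {G : ℝ → EuclideanSpace ℝ (Fin n) →
    EuclideanSpace ℝ (Fin n)} (hw : IsSol G (Icc a b) w) (hwR : ∀ t ∈ Icc a b, ‖w t‖ ≤ R - 1)
    (hΛR : ∀ t ∈ Icc a b, ‖Λ t‖ ≤ R)
    (herr : ∀ t ∈ Icc a b, dist (G t (w t)) (rateField f Λ r t (w t)) ≤ ε)
    (hc : c ∈ Icc a b) (hcJ : c ∈ J) (hd : dist (w c) (u c) ≤ ε) (hT : b - a ≤ T)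
    (hε : (1 + T) * Real.exp ((q * L : NNReal) * T) * ε ≤ 1) :
    Icc a b ⊆ J ∧ ∀ t ∈ Icc a b, dist (w t) (u t) ≤ (1 + T) * Real.exp ((q * L : NNReal) * T) * ε := by
  obtain ⟨v, hv, hvc⟩ := hfc.exists_isSol hΛ r c (u c)
  -- The global cut-off solution `v` can be compared with `w` before anything is known about `u`.
  -- The total error is at most `1`, so `v` never leaves the ball where the fields agree, and
  -- therefore `v` is `u`.
  have h1 := hw.dist_le (hv.mono (subset_univ _)) (hfc.lipschitzWith_rateField hq)
    (dist_nonneg.trans hd) (fun t ht => by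
      rw [hfc.rateField_eq ((hwR t ht).trans (by linarith)) (hΛR t ht)]
      exact herr t ht) hc (by rwa [hvc]) hT
  have h2 : ∀ t ∈ Icc a b, ‖v t‖ ≤ R := fun t ht => by
    have h3 := (h1 t ht).trans hε
    have h4 := norm_le_norm_add_norm_sub (w t) (v t)
    rw [dist_eq_norm] at h3
    linarith [hwR t ht]
  have hvsol : IsSol (rateField f Λ r) (Icc a b) v :=
    (hv.mono (subset_univ _)).congr_field fun s hs => hfc.rateField_eq (h2 s hs) (hΛR s hs)
  obtain ⟨h5, h6⟩ := hu.Icc_subset hf hΛ hvsol hc hcJ hvc.symm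
  exact ⟨h5, fun t ht => by rw [h6 ht]; exact h1 t ht⟩

end Maximal

/-! ### Quadratic forms for linear maps without imaginary eigenvalues -/

section Lyapunov

/-- The transpose has an eigenvector `ℓ`. Its eigenvalue also belongs to `A`: otherwise `A - σ`
would be injective, hence surjective, while `ℓ` vanishes on its range. -/
theorem exists_hasEigenvalue_left {V : Type*} [AddCommGroup V] [Module ℂ V]
    [FiniteDimensional ℂ V] [Nontrivial V] (A : Module.End ℂ V) :
    ∃ σ : ℂ, A.HasEigenvalue σ ∧ ∃ ℓ : V →ₗ[ℂ] ℂ, ℓ ≠ 0 ∧ ∀ v, ℓ (A v) = σ * ℓ v := by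
  have : Nontrivial (Module.Dual ℂ V) := inferInstance
  obtain ⟨σ, hσ⟩ := Module.End.exists_eigenvalue
    (A.dualMap : Module.Dual ℂ V →ₗ[ℂ] Module.Dual ℂ V)
  obtain ⟨ℓ, hℓ⟩ := hσ.exists_hasEigenvector
  have h1 : ∀ v, ℓ (A v) = σ * ℓ v := fun v => by
    have := congrArg (fun g : Module.Dual ℂ V => g v) hℓ.apply_eq_smul
    simpa using this
  refine ⟨σ, ?_, ℓ, hℓ.2, h1⟩
  rw [Module.End.hasEigenvalue_iff, Module.End.eigenspace_def]
  intro hker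
  have hsurj := LinearMap.surjective_of_injective (LinearMap.ker_eq_bot.1 hker)
  apply hℓ.2
  ext v
  obtain ⟨w, rfl⟩ := hsurj v
  simp [h1]

/-- A linear map without purely imaginary eigenvalues admits a quadratic form that increases along
its flow. -/
theorem exists_lyapunov_complex (N : ℕ) : ∀ (V : Type*) [NormedAddCommGroup V] [NormedSpace ℂ V]
    [FiniteDimensional ℂ V], Module.finrank ℂ V = N → ∀ A : Module.End ℂ V,
    (∀ σ, A.HasEigenvalue σ → σ.re ≠ 0) → ∃ B : V →ₗ[ℝ] V →ₗ[ℝ] ℝ, (∀ v w, B v w = B w v) ∧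
      (∃ c > 0, ∀ v, c * ‖v‖ ^ 2 ≤ B v (A v)) ∧
      ((∀ σ, A.HasEigenvalue σ → σ.re < 0) → ∃ c > 0, ∀ v, B v v ≤ -(c * ‖v‖ ^ 2)) := by
  induction N with
  | zero =>
    intro V _ _ _ hN A _
    have := Module.finrank_zero_iff.1 hN
    exact ⟨0, by simp, ⟨1, one_pos, fun v => by simp [Subsingleton.elim v 0]⟩,
      fun _ => ⟨1, one_pos, fun v => by simp [Subsingleton.elim v 0]⟩⟩
  | succ N ih =>
    intro V _ _ _ hN A hA
    have : Nontrivial V := Module.nontrivial_of_finrank_pos (R := ℂ) (by omega)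
    obtain ⟨σ, hσ, ℓ, hℓ0, hℓ⟩ := exists_hasEigenvalue_left A
    -- Induction on the dimension: the kernel of a left eigenvector is an invariant hyperplane, and
    -- `A` is block triangular with respect to it and the complement spanned by `e`.
    set W := LinearMap.ker ℓ with hW
    have hAW : ∀ w ∈ W, A w ∈ W := fun w hw => by
      rw [hW, LinearMap.mem_ker] at hw ⊢
      rw [hℓ, hw, mul_zero]
    have hWdim : Module.finrank ℂ W = N := by
      have := Module.Dual.finrank_ker_add_one_of_ne_zero (f := ℓ) hℓ0
      rw [hN] at this
      exact Nat.succ_injective this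
    have heig : ∀ τ, Module.End.HasEigenvalue (A.restrict hAW) τ → A.HasEigenvalue τ := fun τ hτ => by
      obtain ⟨w, hw⟩ := hτ.exists_hasEigenvector
      refine Module.End.hasEigenvalue_of_hasEigenvector (x := (w : V)) ⟨?_, ?_⟩
      · rw [Module.End.mem_eigenspace_iff]
        exact congrArg Subtype.val hw.apply_eq_smul
      · simpa using hw.2
    obtain ⟨BW, hsymm, ⟨c, hc, hpos⟩, hneg⟩ := ih W hWdim (A.restrict hAW)
      fun τ hτ => hA τ (heig τ hτ)
    obtain ⟨e', he'⟩ : ∃ e', ℓ e' ≠ 0 := by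
      by_contra! h
      exact hℓ0 (LinearMap.ext h)
    set e := (ℓ e')⁻¹ • e' with he_def
    have he : ℓ e = 1 := by simp [he_def, he']
    let π : V →ₗ[ℂ] W := LinearMap.codRestrict W (LinearMap.id - ℓ.smulRight e) fun v => by
      simp [hW, he]
    have hπ : ∀ v, (π v : V) = v - ℓ v • e := fun v => rfl
    have hπA : ∀ v, π (A v) = (A.restrict hAW) (π v) + ℓ v • π (A e) := fun v => by
      apply Subtype.ext
      simp only [hπ, hℓ, Submodule.coe_add, Submodule.coe_smul, LinearMap.coe_restrict_apply,
        map_sub, map_smul, he, smul_sub, mul_one, smul_smul]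
      rw [mul_comm (ℓ v) σ]; abel
    obtain ⟨C, hC0, hC⟩ : ∃ C ≥ 0, ∀ w w', |BW w w'| ≤ C * ‖w‖ * ‖w'‖ :=
      ⟨_, norm_nonneg BW.toContinuousBilinearMap, fun w w' =>
        BW.toContinuousBilinearMap.le_opNorm₂ w w'⟩
    have hσ0 := hA σ hσ
    set C₂ := C * ‖π (A e)‖ with hC₂
    have hC₂0 : 0 ≤ C₂ := by positivity
    -- The weight of the new direction makes `k * σ.re` large enough to absorb the off-diagonal
    -- term: by Young's inequality this term costs half of the expansion on `W` and `C₂² / (2 c)`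
    -- times `‖ℓ v‖²`, and `c / 2` is left over.
    set k := (c / 2 + C₂ ^ 2 / (2 * c)) / σ.re with hk
    have hkσ : k * σ.re = c / 2 + C₂ ^ 2 / (2 * c) := by rw [hk]; field_simp
    let B : V →ₗ[ℝ] V →ₗ[ℝ] ℝ := LinearMap.mk₂ ℝ
      (fun v w => BW (π v) (π w) + k * ((ℓ v).re * (ℓ w).re + (ℓ v).im * (ℓ w).im))
      (fun v v' w => by simp; ring)
      (fun a v w => by
        have h1 : π (a • v) = a • π v := LinearMap.map_smul_of_tower π a v
        have h2 : ℓ (a • v) = a • ℓ v := LinearMap.map_smul_of_tower ℓ a v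
        simp [h1, h2]; ring)
      (fun v w w' => by simp; ring)
      (fun a v w => by
        have h1 : π (a • w) = a • π w := LinearMap.map_smul_of_tower π a w
        have h2 : ℓ (a • w) = a • ℓ w := LinearMap.map_smul_of_tower ℓ a w
        simp [h1, h2]; ring)
    have hB : ∀ v w, B v w =
      BW (π v) (π w) + k * ((ℓ v).re * (ℓ w).re + (ℓ v).im * (ℓ w).im) := fun v w => rfl
    have hnorm : ∀ v, ‖v‖ ^ 2 ≤ 2 * (1 + ‖e‖ ^ 2) * (‖π v‖ ^ 2 + ‖ℓ v‖ ^ 2) := fun v => by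
      have h1 : ‖v‖ ≤ ‖π v‖ + ‖ℓ v‖ * ‖e‖ := by
        calc ‖v‖ = ‖(π v : V) + ℓ v • e‖ := by rw [hπ]; simp
          _ ≤ ‖π v‖ + ‖ℓ v • e‖ := norm_add_le _ _
          _ = _ := by rw [norm_smul]
      have h2 : ‖v‖ ^ 2 ≤ (‖π v‖ + ‖ℓ v‖ * ‖e‖) ^ 2 := by gcongr
      nlinarith [sq_nonneg (‖π v‖ - ‖ℓ v‖ * ‖e‖), sq_nonneg (‖π v‖ * ‖e‖), sq_nonneg (‖ℓ v‖)]
    refine ⟨B, fun v w => by rw [hB, hB, hsymm]; ring, ?_, ?_⟩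
    · refine ⟨c / 2 / (2 * (1 + ‖e‖ ^ 2)), by positivity, fun v => ?_⟩
      have h1 : B v (A v) = BW (π v) (A.restrict hAW (π v)) + BW (π v) (ℓ v • π (A e)) +
          k * σ.re * ‖ℓ v‖ ^ 2 := by
        rw [hB, hπA, map_add, hℓ, ← Complex.normSq_eq_norm_sq, Complex.normSq_apply]
        simp only [Complex.mul_re, Complex.mul_im]
        ring
      have h2 := hpos (π v)
      have h3 : |BW (π v) (ℓ v • π (A e))| ≤ C₂ * ‖π v‖ * ‖ℓ v‖ := by
        refine (hC _ _).trans (le_of_eq ?_)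
        rw [norm_smul, hC₂]; ring
      have h4 : C₂ * ‖π v‖ * ‖ℓ v‖ ≤ c / 2 * ‖π v‖ ^ 2 + C₂ ^ 2 / (2 * c) * ‖ℓ v‖ ^ 2 := by
        have h5 : c / 2 * ‖π v‖ ^ 2 + C₂ ^ 2 / (2 * c) * ‖ℓ v‖ ^ 2 - C₂ * ‖π v‖ * ‖ℓ v‖ =
          (c * ‖π v‖ - C₂ * ‖ℓ v‖) ^ 2 / (2 * c) := by field_simp; ring
        have h6 : 0 ≤ (c * ‖π v‖ - C₂ * ‖ℓ v‖) ^ 2 / (2 * c) := by positivity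
        linarith
      have h5 : c / 2 * (‖π v‖ ^ 2 + ‖ℓ v‖ ^ 2) ≤ B v (A v) := by
        rw [h1, hkσ]
        linarith [neg_abs_le (BW (π v) (ℓ v • π (A e)))]
      refine le_trans ?_ h5
      rw [div_mul_eq_mul_div, div_le_iff₀ (by positivity)]
      have := mul_le_mul_of_nonneg_left (hnorm v) (by positivity : 0 ≤ c / 2)
      linarith
    · intro hre
      obtain ⟨c', hc', hBW⟩ := hneg fun τ hτ => hre τ (heig τ hτ)
      -- The sign of `k` is that of the real part of `σ`, so for a sink every diagonal block of the
      -- form is negative.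
      have hk0 : k < 0 := div_neg_of_pos_of_neg (by positivity) (hre σ hσ)
      refine ⟨min c' (-k) / (2 * (1 + ‖e‖ ^ 2)),
        div_pos (lt_min hc' (by linarith)) (by positivity), fun v => ?_⟩
      have h1 : B v v = BW (π v) (π v) + k * ‖ℓ v‖ ^ 2 := by
        rw [hB, ← Complex.normSq_eq_norm_sq, Complex.normSq_apply]
      have h2 : min c' (-k) * (‖π v‖ ^ 2 + ‖ℓ v‖ ^ 2) ≤ -B v v := by
        rw [h1, mul_add]
        have h3 : min c' (-k) * ‖π v‖ ^ 2 ≤ c' * ‖π v‖ ^ 2 := by gcongr; exact min_le_left _ _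
        have h4 : min c' (-k) * ‖ℓ v‖ ^ 2 ≤ -k * ‖ℓ v‖ ^ 2 := by gcongr; exact min_le_right _ _
        linarith [hBW (π v)]
      have h3 : min c' (-k) / (2 * (1 + ‖e‖ ^ 2)) * ‖v‖ ^ 2 ≤
          min c' (-k) * (‖π v‖ ^ 2 + ‖ℓ v‖ ^ 2) := by
        rw [div_mul_eq_mul_div, div_le_iff₀ (by positivity)]
        have := mul_le_mul_of_nonneg_left (hnorm v) (lt_min hc' (by linarith : 0 < -k)).le
        linarith
      linarith

/-- The complex form for the complexified matrix is pulled back along the isometric inclusion `j` of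
`ℝⁿ` into `ℂⁿ`, which intertwines the two maps. Eigenvalues of the complexification are roots of the
real characteristic polynomial. -/
theorem exists_lyapunov {n : ℕ} (A : EuclideanSpace ℝ (Fin n) →L[ℝ] EuclideanSpace ℝ (Fin n))
    (hA : ∀ μ : ℂ, Polynomial.aeval μ (LinearMap.charpoly A.toLinearMap) = 0 → μ.re ≠ 0) :
    ∃ B : EuclideanSpace ℝ (Fin n) →L[ℝ] EuclideanSpace ℝ (Fin n) →L[ℝ] ℝ,
      (∀ v w, B v w = B w v) ∧ (∃ c > 0, ∀ v, c * ‖v‖ ^ 2 ≤ B v (A v)) ∧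
      ((∀ μ : ℂ, Polynomial.aeval μ (LinearMap.charpoly A.toLinearMap) = 0 → μ.re < 0) →
        ∃ c > 0, ∀ v, B v v ≤ -(c * ‖v‖ ^ 2)) := by
  let b := (EuclideanSpace.basisFun (Fin n) ℝ).toBasis
  let M := LinearMap.toMatrix b b A.toLinearMap
  let Mc : Matrix (Fin n) (Fin n) ℂ := M.map (algebraMap ℝ ℂ)
  have hroot : ∀ σ, Module.End.HasEigenvalue (Matrix.toLin' Mc) σ →
      Polynomial.aeval σ (LinearMap.charpoly A.toLinearMap) = 0 := fun σ hσ => by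
    rw [Module.End.hasEigenvalue_iff_isRoot_charpoly, Matrix.charpoly_toLin',
      Matrix.charpoly_map, Polynomial.IsRoot, Polynomial.eval_map_algebraMap,
      LinearMap.charpoly_toMatrix] at hσ
    exact hσ
  let j : EuclideanSpace ℝ (Fin n) →ₗ[ℝ] (EuclideanSpace ℂ (Fin n)) :=
    { toFun := fun v => WithLp.toLp 2 fun i => (v i : ℂ)
      map_add' := fun v w => by ext i; simp
      map_smul' := fun a v => by ext i; simp }
  let e := (WithLp.linearEquiv 2 ℂ (Fin n → ℂ))
  let Ac : Module.End ℂ (EuclideanSpace ℂ (Fin n)) := e.symm.conj (Matrix.toLin' Mc)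
  have hAc : ∀ σ, Ac.HasEigenvalue σ →
      Polynomial.aeval σ (LinearMap.charpoly A.toLinearMap) = 0 := fun σ hσ => by
    apply hroot
    rw [Module.End.hasEigenvalue_iff_isRoot_charpoly] at hσ ⊢
    rwa [LinearEquiv.charpoly_conj] at hσ
  have hj : ∀ v, j (A v) = Ac (j v) := fun v => by
    ext i
    have h1 : A v i = ∑ k, M i k * v k := by
      have := congrFun (LinearMap.toMatrix_mulVec_repr b b A.toLinearMap v) i
      simpa [b, Matrix.mulVec, dotProduct] using this.symm
    simp [j, Ac, e, LinearEquiv.conj_apply, h1, Mc, Matrix.mulVec, dotProduct]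
  have hjn : ∀ v, ‖j v‖ = ‖v‖ := fun v => by
    simp [EuclideanSpace.norm_eq, j]
  obtain ⟨B, hs, ⟨c, hc, hp⟩, hn⟩ := exists_lyapunov_complex _ (EuclideanSpace ℂ (Fin n)) rfl Ac
    fun σ hσ => hA σ (hAc σ hσ)
  let B' : EuclideanSpace ℝ (Fin n) →ₗ[ℝ] EuclideanSpace ℝ (Fin n) →ₗ[ℝ] ℝ := B.compl₁₂ j j
  have hB' : ∀ v w, B' v w = B (j v) (j w) := fun v w => rfl
  refine ⟨B'.toContinuousBilinearMap, fun v w => ?_, ⟨c, hc, fun v => ?_⟩, fun h => ?_⟩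
  · simp only [LinearMap.toContinuousBilinearMap_apply, hB', hs]
  · rw [LinearMap.toContinuousBilinearMap_apply, hB', hj, ← hjn]
    exact hp _
  · obtain ⟨c', hc', h'⟩ := hn fun σ hσ => h σ (hAc σ hσ)
    refine ⟨c', hc', fun v => ?_⟩
    rw [LinearMap.toContinuousBilinearMap_apply, hB', ← hjn]
    exact h' _

end Lyapunov

/-! ### Expansion of a quadratic form along differences of solutions -/

section Cone

theorem mul_sub_le_of_hasDerivWithinAt {g g' : ℝ → ℝ} {a b m : ℝ} (hab : a ≤ b)
    (hg : ∀ t ∈ Icc a b, HasDerivWithinAt g (g' t) (Icc a b) t) (hm : ∀ t ∈ Icc a b, m ≤ g' t) :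
    m * (b - a) ≤ g b - g a := by
  have hd : ∀ t ∈ Ioo a b, HasDerivAt g (g' t) t := fun t ht =>
    (hg t (Ioo_subset_Icc_self ht)).hasDerivAt (Icc_mem_nhds ht.1 ht.2)
  refine (convex_Icc a b).mul_sub_le_image_sub_of_le_deriv
    (fun t ht => (hg t ht).continuousWithinAt) ?_ ?_ a ⟨le_rfl, hab⟩ b ⟨hab, le_rfl⟩ hab
  · rw [interior_Icc]
    exact fun t ht => (hd t ht).differentiableAt.differentiableWithinAt
  · rw [interior_Icc]
    exact fun t ht => by rw [(hd t ht).deriv]; exact hm t (Ioo_subset_Icc_self ht)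

variable {E : Type*} [NormedAddCommGroup E] [InnerProductSpace ℝ E]

theorem hasDerivWithinAt_form {B : E →L[ℝ] E →L[ℝ] ℝ} (hB : ∀ v w, B v w = B w v) {u : ℝ → E}
    {u' : E} {s : Set ℝ} {t : ℝ} (hu : HasDerivWithinAt u u' s t) :
    HasDerivWithinAt (fun t => B (u t) (u t)) (2 * B (u t) u') s t := by
  have h := (B.hasFDerivAt.comp_hasDerivWithinAt t hu).clm_apply hu
  refine h.congr_deriv ?_
  rw [hB u' (u t)]; simp; ring

theorem abs_form_le (B : E →L[ℝ] E →L[ℝ] ℝ) (v : E) : |B v v| ≤ ‖B‖ * ‖v‖ ^ 2 := by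
  have := B.le_opNorm₂ v v
  rw [Real.norm_eq_abs] at this
  linarith [sq ‖v‖]

/-- The quadratic form of `B` expands differences of solutions of `u' = G(t, u)` at the times `I`
in the ball of radius `R` around `η`. -/
def IsExpanding (B : E →L[ℝ] E →L[ℝ] ℝ) (c L : ℝ) (G : ℝ → E → E) (I : Set ℝ) (η : E) (R : ℝ) :
    Prop :=
  ∀ t ∈ I, ∀ y ∈ Metric.ball η R, ∀ z ∈ Metric.ball η R,
    c * ‖y - z‖ ^ 2 ≤ 2 * B (y - z) (G t y - G t z) ∧ ‖G t y - G t z‖ ≤ L * ‖y - z‖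

variable {B : E →L[ℝ] E →L[ℝ] ℝ} {c L R : ℝ} {G : ℝ → E → E} {I : Set ℝ} {η : E} {u w : ℝ → E}

theorem IsSol.hasDerivWithinAt_form_sub (hB : ∀ v w, B v w = B w v) {J : Set ℝ} (hu : IsSol G J u)
    (hw : IsSol G J w) : ∀ t ∈ J, HasDerivWithinAt (fun t => B (u t - w t) (u t - w t))
      (2 * B (u t - w t) (G t (u t) - G t (w t))) J t := fun t ht =>
  hasDerivWithinAt_form hB ((hu t ht).fun_sub (hw t ht))

variable (hB : ∀ v w, B v w = B w v) (hc : 0 < c) (hG : IsExpanding B c L G I η R)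

include hB hc hG

/-- Integration of the expansion inequality: while the difference keeps a positive distance from
zero, the form gains at least linearly in time. A bounded form cannot do this forever. -/
theorem IsExpanding.add_le {a b m : ℝ} (hab : a ≤ b) (hI : Icc a b ⊆ I)
    (hu : IsSol G (Icc a b) u) (hw : IsSol G (Icc a b) w)
    (huR : ∀ t ∈ Icc a b, u t ∈ Metric.ball η R) (hwR : ∀ t ∈ Icc a b, w t ∈ Metric.ball η R)
    (hm : ∀ t ∈ Icc a b, m ≤ ‖u t - w t‖ ^ 2) :
    B (u a - w a) (u a - w a) + c * m * (b - a) ≤ B (u b - w b) (u b - w b) := by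
  have := mul_sub_le_of_hasDerivWithinAt (m := c * m) hab (hu.hasDerivWithinAt_form_sub hB hw)
    fun t ht => (mul_le_mul_of_nonneg_left (hm t ht) hc.le).trans
      (hG t (hI ht) _ (huR t ht) _ (hwR t ht)).1
  linarith

theorem IsExpanding.mono {a b : ℝ} (hab : a ≤ b) (hI : Icc a b ⊆ I)
    (hu : IsSol G (Icc a b) u) (hw : IsSol G (Icc a b) w)
    (huR : ∀ t ∈ Icc a b, u t ∈ Metric.ball η R) (hwR : ∀ t ∈ Icc a b, w t ∈ Metric.ball η R) :
    B (u a - w a) (u a - w a) ≤ B (u b - w b) (u b - w b) := by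
  have := hG.add_le hB hc hab hI hu hw huR hwR (m := 0) fun t _ => by positivity
  linarith

/-- Two solutions that stay close to `η` in the future have difference outside the cone. -/
theorem IsExpanding.nonpos_of_Ici {a : ℝ} (hI : Ici a ⊆ I) (hu : IsSol G (Ici a) u)
    (hw : IsSol G (Ici a) w) (huR : ∀ t ∈ Ici a, u t ∈ Metric.ball η R)
    (hwR : ∀ t ∈ Ici a, w t ∈ Metric.ball η R) : B (u a - w a) (u a - w a) ≤ 0 := by
  by_contra! hpos
  set V := fun t => B (u t - w t) (u t - w t) with hV
  set C := ‖B‖ + 1 with hC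
  have hC0 : 0 < C := by positivity
  have hVC : ∀ t, V t ≤ C * ‖u t - w t‖ ^ 2 := fun t => by
    have := (le_abs_self _).trans (abs_form_le B (u t - w t))
    simp only [hV]; nlinarith [sq_nonneg ‖u t - w t‖]
  have hsub : ∀ {s t : ℝ}, a ≤ s → Icc s t ⊆ Ici a := fun hs t ht => hs.trans ht.1
  have hmono : ∀ t ∈ Ici a, V a ≤ V t := fun t ht =>
    hG.mono hB hc ht ((hsub le_rfl).trans hI) (hu.mono (hsub le_rfl)) (hw.mono (hsub le_rfl))
      (fun s hs => huR s hs.1) (fun s hs => hwR s hs.1)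
  have hgrow : ∀ t ∈ Ici a, V a + c * (V a / C) * (t - a) ≤ V t := fun t ht =>
    hG.add_le hB hc ht ((hsub le_rfl).trans hI) (hu.mono (hsub le_rfl)) (hw.mono (hsub le_rfl))
      (fun s hs => huR s hs.1) (fun s hs => hwR s hs.1) fun s hs => by
        rw [div_le_iff₀ hC0]
        linarith [hmono s hs.1, hVC s]
  have hbd : ∀ t ∈ Ici a, V t ≤ C * (2 * R) ^ 2 := fun t ht => by
    refine (hVC t).trans ?_
    have h1 := huR t ht
    have h2 := hwR t ht
    rw [Metric.mem_ball] at h1 h2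
    have h3 : ‖u t - w t‖ ≤ 2 * R := by
      rw [← dist_eq_norm]; linarith [dist_triangle_right (u t) (w t) η]
    gcongr
  have hk : 0 < c * (V a / C) := by have : 0 < V a := hpos; positivity
  have hR0 : 0 ≤ C * (2 * R) ^ 2 := by positivity
  -- Since `V a > 0` keeps `‖u - w‖²` above `V a / C`, the form gains linearly; at this time the
  -- gain alone equals the a priori bound `C (2 R)²`.
  have h4 := hgrow (a + C * (2 * R) ^ 2 / (c * (V a / C))) (by
    show a ≤ _; linarith [div_nonneg hR0 hk.le])
  have h5 := hbd (a + C * (2 * R) ^ 2 / (c * (V a / C))) (by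
    show a ≤ _; linarith [div_nonneg hR0 hk.le])
  rw [add_sub_cancel_left, mul_div_cancel₀ _ hk.ne'] at h4
  have h6 : 0 < V a := hpos
  linarith

/-- Two solutions that stayed close to `η` in the past have difference inside the cone. -/
theorem IsExpanding.pos_of_Iic {b : ℝ} (hI : Iic b ⊆ I) (hu : IsSol G (Iic b) u)
    (hw : IsSol G (Iic b) w) (huR : ∀ t ∈ Iic b, u t ∈ Metric.ball η R)
    (hwR : ∀ t ∈ Iic b, w t ∈ Metric.ball η R) (hne : u b ≠ w b) :
    0 < B (u b - w b) (u b - w b) := by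
  by_contra! hneg
  set V := fun t => B (u t - w t) (u t - w t) with hV
  set C := ‖B‖ + 1 with hC
  have hC0 : 0 < C := by positivity
  have hVC : ∀ t, -V t ≤ C * ‖u t - w t‖ ^ 2 := fun t => by
    have := (neg_le_abs _).trans (abs_form_le B (u t - w t))
    simp only [hV]; nlinarith [sq_nonneg ‖u t - w t‖]
  have hsub : ∀ {s t : ℝ}, t ≤ b → Icc s t ⊆ Iic b := fun hs t ht => ht.2.trans hs
  have hstep : ∀ {s t m : ℝ}, s ≤ t → t ≤ b → (∀ τ ∈ Icc s t, m ≤ ‖u τ - w τ‖ ^ 2) →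
      V s + c * m * (t - s) ≤ V t := fun hst htb hm =>
    hG.add_le hB hc hst ((hsub htb).trans hI) (hu.mono (hsub htb)) (hw.mono (hsub htb))
      (fun s hs => huR s (hs.2.trans htb)) (fun s hs => hwR s (hs.2.trans htb)) hm
  have hn0 : 0 < ‖u b - w b‖ ^ 2 := by
    have : 0 < ‖u b - w b‖ := norm_pos_iff.2 (sub_ne_zero.2 hne)
    positivity
  obtain ⟨s, hsb, hs⟩ : ∃ s < b, ∀ t ∈ Icc s b, ‖u b - w b‖ ^ 2 / 2 ≤ ‖u t - w t‖ ^ 2 := by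
    have hcont : ContinuousWithinAt (fun t => ‖u t - w t‖ ^ 2) (Iic b) b :=
      (((hu.continuousOn b self_mem_Iic).sub (hw.continuousOn b self_mem_Iic)).norm.pow 2)
    have := hcont.eventually (lt_mem_nhds (half_lt_self hn0))
    obtain ⟨s, hs, hs'⟩ := (mem_nhdsLE_iff_exists_Icc_subset).1 this
    exact ⟨s, hs, fun t ht => (hs' ht : _ < _).le⟩
  -- Although `V b` may vanish, the form strictly increases before `b` because the difference is
  -- nonzero there. It is thus strictly negative at `s`, and going further back it would decrease
  -- without bound.
  have hVs : V s < 0 := by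
    have h1 := hstep hsb.le le_rfl hs
    have h2 : 0 < c * (‖u b - w b‖ ^ 2 / 2) * (b - s) := by
      have : 0 < b - s := by linarith
      positivity
    have h3 : V b ≤ 0 := hneg
    linarith
  have hgrow : ∀ t ≤ s, V t + c * (-V s / C) * (s - t) ≤ V s := fun t ht =>
    hstep ht hsb.le fun τ hτ => by
      rw [div_le_iff₀ hC0]
      have := hstep (m := 0) hτ.2 hsb.le fun _ _ => by positivity
      linarith [hVC τ]
  have hbd : ∀ t ≤ s, -V t ≤ C * (2 * R) ^ 2 := fun t ht => by
    refine (hVC t).trans ?_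
    have h1 := huR t (ht.trans hsb.le)
    have h2 := hwR t (ht.trans hsb.le)
    rw [Metric.mem_ball] at h1 h2
    have h3 : ‖u t - w t‖ ≤ 2 * R := by
      rw [← dist_eq_norm]; linarith [dist_triangle_right (u t) (w t) η]
    gcongr
  have hk : 0 < c * (-V s / C) := by have : 0 < -V s := by linarith
                                     positivity
  have hR0 : 0 ≤ C * (2 * R) ^ 2 := by positivity
  have hle : s - C * (2 * R) ^ 2 / (c * (-V s / C)) ≤ s := by linarith [div_nonneg hR0 hk.le]
  have h4 := hgrow _ hle
  have h5 := hbd _ hle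
  rw [sub_sub_cancel, mul_div_cancel₀ _ hk.ne'] at h4
  linarith

/-- The past makes the form of a nonzero difference positive, the future makes it nonpositive. -/
theorem IsExpanding.eq_of_univ (hI : I = univ) (hu : IsSol G univ u) (hw : IsSol G univ w)
    (huR : ∀ t, u t ∈ Metric.ball η R) (hwR : ∀ t, w t ∈ Metric.ball η R) (t : ℝ) :
    u t = w t := by
  subst hI
  by_contra hne
  have h1 := hG.nonpos_of_Ici hB hc (a := t) (subset_univ _) (hu.mono (subset_univ _))
    (hw.mono (subset_univ _)) (fun s _ => huR s) (fun s _ => hwR s)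
  have h2 := hG.pos_of_Iic hB hc (b := t) (subset_univ _) (hu.mono (subset_univ _))
    (hw.mono (subset_univ _)) (fun s _ => huR s) (fun s _ => hwR s) hne
  linarith

/-- As long as the difference of two solutions is outside the cone, it is controlled by its initial
value. -/
theorem IsExpanding.norm_sq_le (hL : 0 ≤ L) {a b : ℝ} (hab : a ≤ b) (hI : Icc a b ⊆ I)
    (hu : IsSol G (Icc a b) u) (hw : IsSol G (Icc a b) w)
    (huR : ∀ t ∈ Icc a b, u t ∈ Metric.ball η R) (hwR : ∀ t ∈ Icc a b, w t ∈ Metric.ball η R)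
    (hneg : B (u b - w b) (u b - w b) ≤ 0) :
    ‖u b - w b‖ ^ 2 ≤ (1 + 2 * L / c * ‖B‖) * ‖u a - w a‖ ^ 2 := by
  have hV := hu.hasDerivWithinAt_form_sub hB hw
  obtain ⟨N, hNi⟩ : ∃ N : E →L[ℝ] E →L[ℝ] ℝ, ∀ v w, N v w = inner ℝ v w :=
    ⟨innerSL ℝ, fun _ _ => rfl⟩
  have hN := hu.hasDerivWithinAt_form_sub (B := N)
    (fun v w => by rw [hNi, hNi]; exact real_inner_comm _ _) hw
  -- The function `(2 L / c) B Δ Δ - ‖Δ‖²` is nondecreasing: the first term grows at rate at least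
  -- `2 L ‖Δ‖²`, the second at most so. Only the sign of the form at the final time `b` is then
  -- needed.
  have h := mul_sub_le_of_hasDerivWithinAt (m := 0) hab
    (fun t ht => ((hV t ht).const_mul (2 * L / c)).sub (hN t ht)) fun t ht => by
      obtain ⟨h1, h2⟩ := hG t (hI ht) _ (huR t ht) _ (hwR t ht)
      have h3 : inner ℝ (u t - w t) (G t (u t) - G t (w t)) ≤ ‖u t - w t‖ * (L * ‖u t - w t‖) :=
        (real_inner_le_norm _ _).trans (by gcongr)
      have h4 : 2 * L / c * (c * ‖u t - w t‖ ^ 2) ≤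
        2 * L / c * (2 * B (u t - w t) (G t (u t) - G t (w t))) := by gcongr
      have h5 : 2 * L / c * (c * ‖u t - w t‖ ^ 2) = 2 * L * ‖u t - w t‖ ^ 2 := by field_simp
      rw [hNi]
      nlinarith
  simp only [Pi.sub_apply, hNi, real_inner_self_eq_norm_sq, zero_mul] at h
  have h6 : 2 * L / c * B (u b - w b) (u b - w b) ≤ 0 :=
    mul_nonpos_of_nonneg_of_nonpos (by positivity) hneg
  have h7 : 2 * L / c * -B (u a - w a) (u a - w a) ≤ 2 * L / c * (‖B‖ * ‖u a - w a‖ ^ 2) := by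
    gcongr
    exact (neg_le_abs _).trans (abs_form_le _ _)
  linarith

end Cone

/-! ### Expansion near the equilibrium, uniformly in the parameter -/

section Local

variable {n d : ℕ}
  {f fc : EuclideanSpace ℝ (Fin n) → EuclideanSpace ℝ (Fin d) → EuclideanSpace ℝ (Fin n)}
  {Λ : ℝ → EuclideanSpace ℝ (Fin d)} {lam : EuclideanSpace ℝ (Fin d)}
  {B : EuclideanSpace ℝ (Fin n) →L[ℝ] EuclideanSpace ℝ (Fin n) →L[ℝ] ℝ}
  {η : EuclideanSpace ℝ (Fin n)} {c L δ R : ℝ}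

/-- The quadratic form of `B` expands differences of solutions of `y' = f (y, l)` near `η`, for all
parameters `l` near `lam`. -/
def IsLocallyExpanding
    (f : EuclideanSpace ℝ (Fin n) → EuclideanSpace ℝ (Fin d) → EuclideanSpace ℝ (Fin n))
    (B : EuclideanSpace ℝ (Fin n) →L[ℝ] EuclideanSpace ℝ (Fin n) →L[ℝ] ℝ) (c L : ℝ)
    (lam : EuclideanSpace ℝ (Fin d)) (δ : ℝ) (η : EuclideanSpace ℝ (Fin n)) (R : ℝ) : Prop :=
  ∀ l ∈ Metric.ball lam δ, IsExpanding B c L (fun _ y => f y l) univ η R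

/-- Strict differentiability of `f` jointly in state and parameter, applied to two points with the
same parameter, makes the linear estimate survive with one constant for all nearby parameters. -/
theorem exists_isLocallyExpanding
    (hf : ContDiff ℝ 1 (fun p : EuclideanSpace ℝ (Fin n) × EuclideanSpace ℝ (Fin d) => f p.1 p.2))
    (hc : 0 < c)
    (h : ∀ v, c * ‖v‖ ^ 2 ≤ B v (fderiv ℝ (fun y => f y lam) η v)) :
    ∃ R > 0, ∃ L ≥ 0, ∃ δ > 0, IsLocallyExpanding f B c L lam δ η R := by
  set D := fderiv ℝ (fun p : EuclideanSpace ℝ (Fin n) × EuclideanSpace ℝ (Fin d) => f p.1 p.2)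
    (η, lam) with hD
  set A := fderiv ℝ (fun y => f y lam) η with hA
  have hs : HasStrictFDerivAt
      (fun p : EuclideanSpace ℝ (Fin n) × EuclideanSpace ℝ (Fin d) => f p.1 p.2) D (η, lam) :=
    hf.contDiffAt.hasStrictFDerivAt (by simp)
  have hAD : ∀ v, A v = D (v, 0) := fun v => by
    have h1 : HasFDerivAt (fun y : EuclideanSpace ℝ (Fin n) => (y, lam))
        (ContinuousLinearMap.inl ℝ _ _) η := hasFDerivAt_prodMk_left η lam
    have h2 : HasFDerivAt (fun y => f y lam) (D.comp (ContinuousLinearMap.inl ℝ _ _)) η :=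
      HasFDerivAt.comp (g := fun p : EuclideanSpace ℝ (Fin n) × EuclideanSpace ℝ (Fin d) =>
        f p.1 p.2) η hs.hasFDerivAt h1
    rw [hA, h2.fderiv]; rfl
  -- The derivative of `B Δ Δ` doubles the linear bound to `2 c`; a remainder of size `e ‖Δ‖` costs
  -- at most `c`, so `c` remains.
  set e := c / (2 * (‖B‖ + 1)) with he
  have he0 : 0 < e := by positivity
  have h1 := hs.isLittleO.def he0
  rw [nhds_prod_eq, Filter.eventually_prod_self_iff'] at h1
  obtain ⟨S, hS, hSS⟩ := h1
  obtain ⟨ρ, hρ, hball⟩ := Metric.mem_nhds_iff.1 hS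
  refine ⟨ρ, hρ, ‖A‖ + e, by positivity, ρ, hρ, fun l hl t _ y hy z hz => ?_⟩
  have hmem : ∀ x ∈ Metric.ball η ρ, (x, l) ∈ S := fun x hx => hball (by
    rw [Metric.mem_ball, Prod.dist_eq]
    exact max_lt hx hl)
  have h2 := hSS _ (hmem y hy) _ (hmem z hz)
  have h3 : D ((y, l) - (z, l)) = A (y - z) := by rw [hAD]; simp
  have h4 : ‖((y, l) - (z, l) : EuclideanSpace ℝ (Fin n) × EuclideanSpace ℝ (Fin d))‖ = ‖y - z‖ := by
    simp [Prod.norm_def]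
  simp only [h3, h4] at h2
  set Δ := y - z with hΔ
  set X := f y l - f z l - A Δ with hX
  have h5 : f y l - f z l = A Δ + X := by rw [hX]; abel
  rw [h5]
  constructor
  · have h6 : |B Δ X| ≤ ‖B‖ * ‖Δ‖ * (e * ‖Δ‖) := by
      refine (B.le_opNorm₂ Δ X).trans ?_
      gcongr
    have h7 : ‖B‖ * ‖Δ‖ * (e * ‖Δ‖) ≤ c / 2 * ‖Δ‖ ^ 2 := by
      have : ‖B‖ * e ≤ c / 2 := by
        rw [he, mul_div_assoc', div_le_div_iff₀ (by positivity) two_pos]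
        nlinarith [norm_nonneg B]
      nlinarith [sq_nonneg ‖Δ‖]
    rw [map_add]
    linarith [h Δ, neg_abs_le (B Δ X)]
  · refine (norm_add_le _ _).trans ?_
    rw [add_mul]
    exact add_le_add (A.le_opNorm _) h2

theorem IsLocallyExpanding.isExpanding (h : IsLocallyExpanding f B c L lam δ η R) {r : ℝ}
    (hr : 0 < r) : IsExpanding B (r⁻¹ * c) (r⁻¹ * L) (rateField f Λ r)
      {t | Λ t ∈ Metric.ball lam δ} η R := fun t ht y hy z hz => by
  obtain ⟨h1, h2⟩ := h (Λ t) ht t (mem_univ _) y hy z hz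
  have h3 : rateField f Λ r t y - rateField f Λ r t z =
      r⁻¹ • (f y (Λ t) - f z (Λ t)) := by
    rw [rateField, rateField, smul_sub]
  have hr' : 0 < r⁻¹ := inv_pos.2 hr
  rw [h3]
  constructor
  · rw [map_smul, smul_eq_mul, mul_assoc]
    calc r⁻¹ * (c * ‖y - z‖ ^ 2) ≤ r⁻¹ * (2 * B (y - z) (f y (Λ t) - f z (Λ t))) := by gcongr
      _ = _ := by ring
  · rw [norm_smul, Real.norm_of_nonneg hr'.le, mul_assoc]
    gcongr

end Local

/-! ### Passage to the future limit system -/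

section Limits

variable {n d : ℕ}
  {f fc : EuclideanSpace ℝ (Fin n) → EuclideanSpace ℝ (Fin d) → EuclideanSpace ℝ (Fin n)}
  {Λ Λ' : ℝ → EuclideanSpace ℝ (Fin d)} {lam : EuclideanSpace ℝ (Fin d)} {R r r' : ℝ}
  {L M : NNReal}

theorem IsCutoff.dist_rateField_le (h : IsCutoff f fc R L M) (τ : ℝ)
    (y : EuclideanSpace ℝ (Fin n)) :
    dist (rateField fc Λ r τ y) (rateField fc Λ' r' τ y) ≤
      |r⁻¹ - r'⁻¹| * M + |r'⁻¹| * (L * dist (Λ τ) (Λ' τ)) := by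
  have h1 : rateField fc Λ r τ y - rateField fc Λ' r' τ y =
      (r⁻¹ - r'⁻¹) • fc y (Λ τ) + r'⁻¹ • (fc y (Λ τ) - fc y (Λ' τ)) := by
    simp only [rateField, sub_smul, smul_sub]; abel
  have h2 := h.dist_le y y (Λ τ) (Λ' τ)
  rw [dist_self, max_eq_right dist_nonneg, dist_eq_norm] at h2
  rw [dist_eq_norm, h1]
  refine (norm_add_le _ _).trans ?_
  rw [norm_smul, norm_smul, Real.norm_eq_abs, Real.norm_eq_abs]
  gcongr
  exact h.bound _ _

/-- At late times and for rates close to `r`, the field is close to the future limit field. -/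
theorem IsCutoff.eventually_dist_le (h : IsCutoff f fc R L M) (hlim : Tendsto Λ atTop (𝓝 lam))
    (hr : 0 < r) {ε : ℝ} (hε : 0 < ε) :
    ∃ T, ∀ᶠ r' in 𝓝 r, ∀ τ ≥ T, ∀ y,
      dist (rateField fc Λ r' τ y) (rateField fc (fun _ => lam) r τ y) ≤ ε := by
  have h1 : Tendsto (fun r' : ℝ => |r'⁻¹ - r⁻¹| * M) (𝓝 r) (𝓝 0) := by
    have : Tendsto (fun r' : ℝ => |r'⁻¹ - r⁻¹| * M) (𝓝 r) (𝓝 (|r⁻¹ - r⁻¹| * M)) :=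
      (((tendsto_inv₀ hr.ne').sub_const _).abs).mul_const _
    simpa using this
  have h3 : Tendsto (fun τ => |r⁻¹| * (L * dist (Λ τ) lam)) atTop (𝓝 0) := by
    have : Tendsto (fun τ => |r⁻¹| * (L * dist (Λ τ) lam)) atTop
        (𝓝 (|r⁻¹| * (L * dist lam lam))) :=
      ((hlim.dist tendsto_const_nhds).const_mul _).const_mul _
    simpa using this
  obtain ⟨T, hT⟩ := eventually_atTop.1 (h3.eventually (gt_mem_nhds (half_pos hε)))
  refine ⟨T, ?_⟩
  filter_upwards [h1.eventually (gt_mem_nhds (half_pos hε))] with r' hr' τ hτ y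
  refine (h.dist_rateField_le τ y).trans ?_
  linarith [hT τ hτ]

theorem eventually_nnnorm_inv_le (hr : 0 < r) : ∀ᶠ r' in 𝓝 r, ‖r'⁻¹‖₊ ≤ ‖r⁻¹‖₊ + 1 := by
  have : Tendsto (fun r' : ℝ => ‖r'⁻¹‖₊) (𝓝 r) (𝓝 ‖r⁻¹‖₊) := (tendsto_inv₀ hr.ne').nnnorm
  exact (this.eventually (gt_mem_nhds (lt_add_one _))).mono fun _ h => h.le

theorem IsSol.shift {v : ℝ → EuclideanSpace ℝ (Fin n)} {J : Set ℝ}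
    (hv : IsSol (rateField f (fun _ => lam) r) J v) (b : ℝ) :
    IsSol (rateField f (fun _ => lam) r) {t | t + b ∈ J} (fun t => v (t + b)) := by
  have := hv.comp_affine 1 b
  simp only [one_smul, one_mul] at this
  exact this

/-- Solutions at late times converge to solutions of the future limit system. -/
theorem IsCutoff.tendsto (h : IsCutoff f fc R L M) (hlim : Tendsto Λ atTop (𝓝 lam))
    (hlR : ‖lam‖ < R) (hr : 0 < r) {rk ck sk : ℕ → ℝ} (hrk : Tendsto rk atTop (𝓝 r))
    (hck : Tendsto ck atTop atTop) {s : ℝ} (hsk : Tendsto sk atTop (𝓝 s))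
    {wk : ℕ → ℝ → EuclideanSpace ℝ (Fin n)} {z : EuclideanSpace ℝ (Fin n)}
    (hz : Tendsto (fun k => wk k (ck k)) atTop (𝓝 z)) {v : ℝ → EuclideanSpace ℝ (Fin n)}
    (hv : IsSol (rateField fc (fun _ => lam) r) univ v) (hv0 : v 0 = z)
    (hw : ∀ᶠ k in atTop, IsSol (rateField f Λ (rk k)) (uIcc (ck k) (ck k + sk k)) (wk k) ∧
      ∀ t ∈ uIcc (ck k) (ck k + sk k), ‖wk k t‖ ≤ R) :
    Tendsto (fun k => wk k (ck k + sk k)) atTop (𝓝 (v s)) := by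
  have hvs : Tendsto (fun k => v (sk k)) atTop (𝓝 (v s)) :=
    (continuousOn_univ.1 hv.continuousOn).continuousAt.tendsto.comp hsk
  refine tendsto_of_tendsto_of_dist hvs ?_
  rw [Metric.tendsto_atTop']
  suffices H : ∀ ε > 0, ∀ᶠ k in atTop, dist (v (sk k)) (wk k (ck k + sk k)) < ε by
    intro ε hε
    obtain ⟨N, hN⟩ := eventually_atTop.1 (H ε hε)
    exact ⟨N, fun k hk => by simpa [abs_of_nonneg dist_nonneg] using hN k hk.le⟩
  intro ε hε
  -- Eventually `|sk k| < T`, so one Grönwall constant serves all the intervals. A start later than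
  -- the threshold by `T` keeps them late, also when `sk k` is negative.
  set T := |s| + 1 with hT
  set q := ‖r⁻¹‖₊ + 1 with hq
  set C := (1 + T) * Real.exp ((q * L : NNReal) * T) with hC
  have hC0 : 0 < C := by positivity
  set e := ε / (2 * C) with he
  have he0 : 0 < e := by positivity
  obtain ⟨T₁, hT₁⟩ := h.eventually_dist_le hlim hr he0
  obtain ⟨T₂, hT₂⟩ := eventually_atTop.1 (hlim.norm.eventually (gt_mem_nhds hlR))
  filter_upwards [hw, hrk.eventually hT₁, hck.eventually (eventually_ge_atTop (max T₁ T₂ + T)),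
    hsk.abs.eventually (gt_mem_nhds (lt_add_one |s|)), (Metric.tendsto_nhds.1 hz) e he0] with
    k ⟨hk1, hk2⟩ hk3 hk4 hk5 hk6
  have hlate : ∀ t ∈ uIcc (ck k) (ck k + sk k), max T₁ T₂ ≤ t := fun t ht => by
    have h1 := abs_sub_left_of_mem_uIcc ht
    rw [add_sub_cancel_left] at h1
    linarith [neg_abs_le (t - ck k)]
  have hv' : IsSol (rateField fc (fun _ => lam) r) univ (fun t => v (t + -ck k)) := by
    simpa using hv.shift (-ck k)
  have hw' := hk1.congr_field (H := rateField fc Λ (rk k)) fun t ht =>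
    (h.rateField_eq (hk2 t ht) (hT₂ t ((le_max_right _ _).trans (hlate t ht))).le).symm
  have hlip : ∀ τ, LipschitzWith (q * L) (rateField fc (fun _ => lam) r τ) :=
    h.lipschitzWith_rateField (by rw [hq]; exact le_self_add)
  have key := IsSol.dist_le (T := T) (c := ck k) hw' (hv'.mono (subset_univ _)) hlip he0.le
    (fun t ht => hk3 t ((le_max_left _ _).trans (hlate t ht)) _) left_mem_uIcc
    (by simpa [hv0] using hk6.le) (by
      have := max_sub_min_eq_abs (ck k) (ck k + sk k)
      rw [add_sub_cancel_left] at this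
      linarith) (ck k + sk k) right_mem_uIcc
  rw [dist_comm]
  have h9 : C * e = ε / 2 := by rw [he]; field_simp
  have h10 : dist (wk k (ck k + sk k)) (v (ck k + sk k + -ck k)) ≤ C * e := key
  rw [show ck k + sk k + -ck k = sk k by ring] at h10
  linarith

/-- A limit of solutions at late times is a solution of the future limit system. -/
theorem exists_limit_solution
    (hf : ContDiff ℝ 1 (fun p : EuclideanSpace ℝ (Fin n) × EuclideanSpace ℝ (Fin d) => f p.1 p.2))
    (hlim : Tendsto Λ atTop (𝓝 lam)) (hr : 0 < r) {rk ck : ℕ → ℝ}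
    (hrk : Tendsto rk atTop (𝓝 r)) (hck : Tendsto ck atTop atTop)
    {wk : ℕ → ℝ → EuclideanSpace ℝ (Fin n)} {z : EuclideanSpace ℝ (Fin n)}
    (hz : Tendsto (fun k => wk k (ck k)) atTop (𝓝 z)) {K : Set (EuclideanSpace ℝ (Fin n))}
    (hK : IsCompact K) {J : Set ℝ}
    (hw : ∀ s ∈ J, ∀ᶠ k in atTop, IsSol (rateField f Λ (rk k)) (uIcc (ck k) (ck k + s)) (wk k) ∧
      ∀ t ∈ uIcc (ck k) (ck k + s), wk k t ∈ K) :
    ∃ v, IsSol (rateField f (fun _ => lam) r) J v ∧ v 0 = z ∧ ∀ s ∈ J, v s ∈ K := by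
  obtain ⟨R, hR⟩ := hK.isBounded.exists_norm_le
  obtain ⟨fc, L, M, hfc⟩ := exists_isCutoff hf (max R (‖lam‖ + 1))
  obtain ⟨v, hv, hv0⟩ := hfc.exists_isSol (Λ := fun _ => lam) continuous_const r 0 z
  -- The cut-off limit solution stays in the closed set `K` as a pointwise limit of states in `K`;
  -- hence it solves the original limit equation.
  have hmem : ∀ s ∈ J, v s ∈ K := fun s hs => by
    refine hK.isClosed.mem_of_tendsto (hfc.tendsto hlim
      ((lt_add_one _).trans_le (le_max_right _ _)) hr hrk hck (sk := fun _ => s)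
      tendsto_const_nhds hz hv hv0 ((hw s hs).mono fun k hk => ⟨hk.1, fun t ht =>
        (hR _ (hk.2 t ht)).trans (le_max_left _ _)⟩)) ?_
    exact (hw s hs).mono fun k hk => hk.2 _ right_mem_uIcc
  refine ⟨v, (hv.mono (subset_univ _)).congr_field fun s hs => hfc.rateField_eq
    ((hR _ (hmem s hs)).trans (le_max_left _ _)) ((lt_add_one _).le.trans (le_max_right _ _)),
    hv0, hmem⟩

end Limits

/-! ### The cone at an equilibrium regular edge state -/

section EdgeState

variable {n d : ℕ}

/-- The normal direction of a regular threshold at an equilibrium is a left eigenvector of the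
linearisation, with a nonnegative eigenvalue. -/
theorem inner_map_eq_of_growth {E : Type*} [NormedAddCommGroup E] [InnerProductSpace ℝ E]
    [CompleteSpace E] (A : E →L[ℝ] E) {ν : E} (hν : ‖ν‖ = 1) {C a b : ℝ} (hC : 0 < C) (ha : 0 < a)
    (hab : b < a)
    (h : ∀ t ≥ (0 : ℝ), ∀ v : ℝ → E, IsSol (fun _ => A) (Icc 0 t) v →
      (inner ℝ (v 0) ν = 0 → ‖v t‖ ≤ C * Real.exp (b * t) * ‖v 0‖) ∧
      C⁻¹ * Real.exp (a * t) * |inner ℝ (v 0) ν| ≤ |inner ℝ (v t) ν|) :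
    ∃ μ ≥ (0 : ℝ), ∀ v, inner ℝ (A v) ν = μ * inner ℝ v ν := by
  set S : ℝ → E →L[ℝ] E := fun t => NormedSpace.exp (t • A) with hS
  have hSd : ∀ (w : E) (t : ℝ), HasDerivAt (fun t => S t w) (A (S t w)) t := fun w t => by
    have h1 : HasDerivAt S (A * S t) t := hasDerivAt_exp_smul_const' A t
    simpa using h1.clm_apply (hasDerivAt_const t w)
  have hS0 : ∀ w, S 0 w = w := fun w => by simp [hS]
  have hsol : ∀ (w : E) (s : ℝ) (J : Set ℝ), IsSol (fun _ => A) J (fun t => S (s + t) w) :=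
    fun w s J t _ => by
      have := (hSd w (s + t)).comp_const_add s t
      exact this.hasDerivWithinAt
  -- Tangent vectors stay tangent: a normal component acquired at time `s` would then grow like `exp
  -- (a t)`, whereas the whole vector grows at most like `exp (b t)` with `b < a`.
  have hinv : ∀ w, inner ℝ w ν = 0 → ∀ s ≥ (0 : ℝ), inner ℝ (S s w) ν = 0 := by
    intro w hw s hs
    have key : ∀ t ≥ (0 : ℝ), |inner ℝ (S s w) ν| ≤
        C * (C * Real.exp (b * s) * ‖w‖) * Real.exp ((b - a) * t) := by
      intro t ht
      have h1 := (h t ht (fun t => S (s + t) w) (hsol w s _)).2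
      have h2 := (h (s + t) (by linarith) (fun t => S (0 + t) w) (hsol w 0 _)).1
        (by simpa [hS0] using hw)
      simp only [add_zero, zero_add, hS0] at h1 h2
      have h3 : |inner ℝ (S (s + t) w) ν| ≤ ‖S (s + t) w‖ := by
        simpa [hν] using abs_real_inner_le_norm (S (s + t) w) ν
      have h4 : C⁻¹ * Real.exp (a * t) * |inner ℝ (S s w) ν| ≤
        C * Real.exp (b * (s + t)) * ‖w‖ := h1.trans (h3.trans h2)
      have h5 : C * (C * Real.exp (b * s) * ‖w‖) * Real.exp ((b - a) * t) =
          (C * Real.exp (-(a * t))) * (C * Real.exp (b * (s + t)) * ‖w‖) := by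
        rw [show (b - a) * t = -(a * t) + b * t by ring, mul_add b, Real.exp_add, Real.exp_add]
        ring
      have h6 : |inner ℝ (S s w) ν| =
          (C * Real.exp (-(a * t))) * (C⁻¹ * Real.exp (a * t) * |inner ℝ (S s w) ν|) := by
        rw [Real.exp_neg]; field_simp
      rw [h5, h6]
      gcongr
    have hlim : Tendsto (fun t : ℝ => C * (C * Real.exp (b * s) * ‖w‖) * Real.exp ((b - a) * t))
        atTop (𝓝 0) := by
      have h1 : Tendsto (fun t : ℝ => (b - a) * t) atTop atBot :=
        tendsto_id.const_mul_atTop_of_neg (by linarith)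
      simpa using (Real.tendsto_exp_atBot.comp h1).const_mul (C * (C * Real.exp (b * s) * ‖w‖))
    have := ge_of_tendsto hlim ((eventually_ge_atTop 0).mono key)
    exact abs_eq_zero.1 (le_antisymm this (abs_nonneg _))
  have hAinv : ∀ w, inner ℝ w ν = 0 → inner ℝ (A w) ν = 0 := fun w hw => by
    have h1 : HasDerivWithinAt (fun t => inner ℝ (S t w) ν) (inner ℝ (A w) ν) (Ici 0) 0 := by
      have := ((hSd w 0).inner ℝ (hasDerivAt_const 0 ν)).hasDerivWithinAt (s := Ici 0)
      simpa [hS0] using this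
    have h2 : HasDerivWithinAt (fun t => inner ℝ (S t w) ν) 0 (Ici 0) 0 :=
      (hasDerivWithinAt_const (0 : ℝ) (Ici 0) (0 : ℝ)).congr (fun t ht => hinv w hw t ht)
        (hinv w hw 0 le_rfl)
    exact (uniqueDiffWithinAt_Ici 0).eq_deriv _ h1 h2
  have hνν : inner ℝ ν ν = (1 : ℝ) := by simp [hν]
  set μ : ℝ := inner ℝ (A ν) ν with hμ
  have hmain : ∀ v, inner ℝ (A v) ν = μ * inner ℝ v ν := fun v => by
    have h1 := hAinv (v - (inner ℝ v ν : ℝ) • ν) (by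
      rw [inner_sub_left, real_inner_smul_left, hνν]; ring)
    rw [map_sub, map_smul, inner_sub_left, real_inner_smul_left] at h1
    linarith
  refine ⟨μ, ?_, hmain⟩
  by_contra! hneg
  -- The normal component of the solution from `ν` is `exp (μ t)`. For `μ < 0` it would stay below
  -- `1`, while its growth bound at time `C / a` is `C⁻¹ exp C ≥ 1 + C⁻¹`.
  have hexp : ∀ t, inner ℝ (S t ν) ν * Real.exp (-(μ * t)) = (1 : ℝ) := by
    have hd : ∀ t : ℝ, HasDerivAt (fun t => inner ℝ (S t ν) ν * Real.exp (-(μ * t))) 0 t := by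
      intro t
      have h1 : HasDerivAt (fun t => inner ℝ (S t ν) ν) (μ * inner ℝ (S t ν) ν) t := by
        have := (hSd ν t).inner ℝ (hasDerivAt_const t ν)
        simpa [hmain] using this
      have h2 : HasDerivAt (fun t : ℝ => Real.exp (-(μ * t))) (Real.exp (-(μ * t)) * -μ) t := by
        have := ((hasDerivAt_id t).const_mul μ).neg.exp
        simpa using this
      exact (h1.mul h2).congr_deriv (by ring)
    intro t
    have := is_const_of_deriv_eq_zero (fun t => (hd t).differentiableAt) (fun t => (hd t).deriv) t 0
    simpa [hS0, hν] using this
  have h1 : ∀ t ≥ (0 : ℝ), C⁻¹ * Real.exp (a * t) ≤ 1 := fun t ht => by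
    have h2 := (h t ht (fun t => S (0 + t) ν) (hsol ν 0 _)).2
    simp only [add_zero, zero_add, hS0, hνν, abs_one, mul_one] at h2
    refine h2.trans ?_
    have h3 : inner ℝ (S t ν) ν = Real.exp (μ * t) := by
      have := hexp t
      rw [Real.exp_neg] at this
      field_simp at this
      exact this
    rw [h3, abs_of_pos (Real.exp_pos _), Real.exp_le_one_iff]
    nlinarith
  have h2 := h1 (C / a) (by positivity)
  have h3 := Real.add_one_le_exp (a * (C / a))
  rw [mul_div_cancel₀ _ ha.ne'] at h2 h3
  have h4 : C⁻¹ * (C + 1) ≤ C⁻¹ * Real.exp C := by gcongr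
  have h5 : C⁻¹ * (C + 1) = 1 + C⁻¹ := by field_simp
  have h6 : 0 < C⁻¹ := by positivity
  linarith

/-- A hypersurface contains points in every tangential direction. -/
theorem exists_mem_hypersurface {E : Type*} [NormedAddCommGroup E] [InnerProductSpace ℝ E]
    {θ W : Set E} {η ν w : E} {g : E → ℝ} {c : ℝ} (hν : ‖ν‖ = 1) (hW : IsOpen W) (hη : η ∈ W)
    (hηθ : η ∈ θ) (hg : ContDiffOn ℝ 1 g W) (hiff : ∀ x ∈ W, x ∈ θ ↔ g x = 0) (hc : c ≠ 0)
    (hd : fderiv ℝ g η = c • innerSL ℝ ν) (hw : inner ℝ ν w = 0) {κ : ℝ} (hκ : 0 < κ) :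
    ∀ᶠ ε in 𝓝[>] (0 : ℝ), ∃ k ∈ Icc (-κ) κ, η + ε • (w + k • ν) ∈ θ := by
  have hgd : HasFDerivAt g (c • innerSL ℝ ν) η := by
    rw [← hd]
    exact ((hg.contDiffAt (hW.mem_nhds hη)).differentiableAt (by simp)).hasFDerivAt
  -- Along the ray in direction `w + k ν` the derivative of `g` at `η` is `c k`. So `g` has opposite
  -- signs for `k = κ` and `k = -κ` at small `ε`, and the intermediate value theorem in `k` yields a
  -- zero.
  have hsign : ∀ k : ℝ, 0 < k ^ 2 → ∀ᶠ ε in 𝓝[>] (0 : ℝ), 0 < c * k * g (η + ε • (w + k • ν)) := by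
    intro k hk
    have h1 : HasDerivAt (fun ε : ℝ => η + ε • (w + k • ν)) (w + k • ν) 0 := by
      simpa using ((hasDerivAt_id (0 : ℝ)).smul_const (w + k • ν)).const_add η
    have h2 : HasDerivAt (fun ε : ℝ => c * k * g (η + ε • (w + k • ν))) (c ^ 2 * k ^ 2) 0 := by
      have h3 : HasFDerivAt g (c • innerSL ℝ ν) (η + (0 : ℝ) • (w + k • ν)) := by simpa using hgd
      refine ((h3.comp_hasDerivAt (0 : ℝ) h1).const_mul (c * k)).congr_deriv ?_
      have h4 : inner ℝ ν (w + k • ν) = k := by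
        rw [inner_add_right, hw, real_inner_smul_right, real_inner_self_eq_norm_sq, hν]; ring
      simp only [smul_apply, innerSL_apply_apply, h4, smul_eq_mul]
      ring
    have h3 := (hasDerivAt_iff_tendsto_slope.1 h2).mono_left
      (nhdsWithin_mono _ (fun x hx => ne_of_gt hx) : 𝓝[>] (0 : ℝ) ≤ 𝓝[≠] 0)
    have h4 : 0 < c ^ 2 * k ^ 2 := by positivity
    filter_upwards [h3.eventually (lt_mem_nhds h4), self_mem_nhdsWithin] with ε h5 h6
    have h7 : g η = 0 := (hiff η hη).1 hηθ
    rw [slope_def_field, zero_smul, add_zero, h7, mul_zero, sub_zero, sub_zero] at h5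
    exact (div_pos_iff_of_pos_right h6).1 h5
  obtain ⟨ρ, hρ, hball⟩ := Metric.isOpen_iff.1 hW η hη
  have hsmall : ∀ᶠ ε in 𝓝[>] (0 : ℝ), ε * (‖w‖ + κ) < ρ := by
    have : Tendsto (fun ε : ℝ => ε * (‖w‖ + κ)) (𝓝[>] 0) (𝓝 0) := by
      have h : Tendsto (fun ε : ℝ => ε * (‖w‖ + κ)) (𝓝 0) (𝓝 (0 * (‖w‖ + κ))) :=
        tendsto_id.mul_const _
      rw [zero_mul] at h
      exact h.mono_left nhdsWithin_le_nhds
    exact this.eventually (gt_mem_nhds hρ)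
  filter_upwards [hsign κ (by positivity), hsign (-κ) (by rw [neg_sq]; positivity), hsmall,
    self_mem_nhdsWithin] with ε h1 h2 h3 h4
  have hε : 0 < ε := h4
  have hinW : ∀ k ∈ Icc (-κ) κ, η + ε • (w + k • ν) ∈ W := fun k hk => hball (by
    rw [Metric.mem_ball, dist_eq_norm, add_sub_cancel_left, norm_smul, Real.norm_of_nonneg hε.le]
    refine lt_of_le_of_lt ?_ h3
    gcongr
    refine (norm_add_le _ _).trans ?_
    rw [norm_smul, hν, mul_one]
    gcongr
    exact abs_le.2 hk)
  have hcont : ContinuousOn (fun k : ℝ => g (η + ε • (w + k • ν))) (uIcc (-κ) κ) := by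
    rw [uIcc_of_le (by linarith)]
    exact hg.continuousOn.comp (by fun_prop) hinW
  have h0 : (0 : ℝ) ∈ uIcc (g (η + ε • (w + (-κ) • ν))) (g (η + ε • (w + κ • ν))) := by
    rw [mem_uIcc]
    set x := g (η + ε • (w + (-κ) • ν))
    set y := g (η + ε • (w + κ • ν))
    have h5 : c * y > 0 := by
      have : 0 < κ * (c * y) := by linarith
      exact (pos_iff_pos_of_mul_pos this).1 hκ
    have h6 : c * x < 0 := by
      have : 0 < κ * (-(c * x)) := by linarith
      linarith [(pos_iff_pos_of_mul_pos this).1 hκ]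
    rcases lt_or_gt_of_ne hc with hc | hc
    · right; constructor <;> nlinarith
    · left; constructor <;> nlinarith
  obtain ⟨k, hk, hk0⟩ := intermediate_value_uIcc hcont h0
  rw [uIcc_of_le (by linarith)] at hk
  exact ⟨k, hk, (hiff _ (hinW k hk)).2 hk0⟩

/-- Near an equilibrium that is an attractor for the flow on `θ`, points of `θ` are not inside an
expanded cone. -/
theorem exists_forall_form_nonpos {F : EuclideanSpace ℝ (Fin n) → EuclideanSpace ℝ (Fin n)}
    {η : EuclideanSpace ℝ (Fin n)} {θ : Set (EuclideanSpace ℝ (Fin n))}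
    {B : EuclideanSpace ℝ (Fin n) →L[ℝ] EuclideanSpace ℝ (Fin n) →L[ℝ] ℝ}
    (hB : ∀ v w, B v w = B w v) {c L R : ℝ} (hc : 0 < c) (hL : 0 ≤ L) (hR : 0 < R)
    (hF : IsExpanding B c L (fun _ => F) univ η R) (hη : F η = 0)
    (hatt : IsAttractorIn F θ {η}) (hst : θ ⊆ stableSet F η) :
    ∃ ι > 0, ∀ y ∈ θ ∩ Metric.ball η ι, B (y - η) (y - η) ≤ 0 := by
  -- Otherwise states of `θ` inside the cone tend to `η`. Each of their solutions must leave the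
  -- ball of radius `R / 2`, at times that tend to infinity by Grönwall, and the exit points
  -- accumulate at a point of the `ω`-limit set other than `η`.
  by_contra! hcon
  obtain ⟨U, hU, hω⟩ := hatt.attracts
  rw [nhdsSet_singleton] at hU
  obtain ⟨ι, hι, hball⟩ := Metric.mem_nhds_iff.1 hU
  have hpos : ∀ m : ℕ, 0 < min ι (1 / ((m : ℝ) + 1)) := fun m => lt_min hι (by positivity)
  choose y hy hypos using fun m : ℕ => hcon _ (hpos m)
  -- The inclusion in the stable set is needed only to provide forward solutions for all time.
  choose u hu hu0 _ using fun m => hst (hy m).1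
  have hdist : ∀ m, dist (y m) η < 1 / ((m : ℝ) + 1) := fun m =>
    (Metric.mem_ball.1 (hy m).2).trans_le (min_le_right _ _)
  have hRh : Metric.ball η (R / 2) ⊆ Metric.ball η R := Metric.ball_subset_ball (by linarith)
  have hexit : ∀ᶠ m : ℕ in atTop, ∃ t > 0, ‖u m t - η‖ = R / 2 ∧
      ∀ s ∈ Ico 0 t, u m s ∈ Metric.ball η (R / 2) := by
    have h0 : ∀ᶠ m : ℕ in atTop, 1 / ((m : ℝ) + 1) < R / 2 :=
      tendsto_one_div_add_atTop_nhds_zero_nat.eventually (gt_mem_nhds (by linarith))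
    filter_upwards [h0] with m hm
    have h1 : u m 0 ∈ Metric.ball η (R / 2) := by
      rw [hu0, Metric.mem_ball]; exact (hdist m).trans hm
    obtain ⟨t, ht, htR⟩ : ∃ t ≥ 0, u m t ∉ Metric.ball η (R / 2) := by
      by_contra! hstay
      have := hF.nonpos_of_Ici hB hc (subset_univ _) (hu m) (isSol_const (y := η) fun _ _ => hη)
        (fun t ht => hRh (hstay t ht)) (fun t _ => Metric.mem_ball_self hR)
      rw [hu0] at this
      linarith [hypos m]
    have hcont : ContinuousOn (u m) (Icc 0 t) := (hu m).continuousOn.mono fun s hs => hs.1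
    obtain ⟨s, hs, hsB, hs'⟩ := exists_first_exit Metric.isOpen_ball ht hcont h1 htR
    exact ⟨s, hs.1, norm_sub_eq_of_first_exit hs.1
      (hcont.mono (Icc_subset_Icc_right hs.2)) hsB hs', hs'⟩
  obtain ⟨N, hN⟩ := eventually_atTop.1 hexit
  choose! t ht htR hts using hN
  have hlip : LipschitzOnWith L.toNNReal F (Metric.ball η R) :=
    LipschitzOnWith.of_dist_le_mul fun a ha b hb => by
      rw [dist_eq_norm, dist_eq_norm, Real.coe_toNNReal _ hL]
      exact (hF 0 (mem_univ _) a ha b hb).2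
  have hgron : ∀ m ≥ N, R / 2 ≤ 1 / ((m : ℝ) + 1) * Real.exp (L * t m) := by
    intro m hm
    have hsol : IsSol (fun _ => F) (Icc 0 (t m)) (u m) := (hu m).mono fun s hs => hs.1
    have := dist_le_of_trajectories_ODE_of_mem (v := fun _ => F) (s := fun _ => Metric.ball η R)
      (K := L.toNNReal) (f := u m) (g := fun _ => η) (a := 0) (b := t m)
      (δ := 1 / ((m : ℝ) + 1)) (fun _ _ => hlip) hsol.continuousOn
      (fun s hs => ((hsol s (Ico_subset_Icc_self hs)).mono_of_mem_nhdsWithin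
        (Icc_mem_nhdsGE_of_mem hs))) (fun s hs => hRh (hts m hm s hs)) continuousOn_const
      (fun s _ => by rw [hη]; exact hasDerivWithinAt_const _ _ _)
      (fun s _ => Metric.mem_ball_self hR) (by rw [hu0]; exact (hdist m).le) (t m)
      ⟨(ht m hm).le, le_rfl⟩
    rwa [dist_eq_norm, htR m hm, Real.coe_toNNReal _ hL, sub_zero] at this
  have htinf : Tendsto t atTop atTop := by
    refine tendsto_atTop.2 fun T => ?_
    have h1 : Tendsto (fun m : ℕ => 1 / ((m : ℝ) + 1) * Real.exp (L * T)) atTop (𝓝 0) := by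
      simpa using tendsto_one_div_add_atTop_nhds_zero_nat.mul_const (Real.exp (L * T))
    filter_upwards [h1.eventually (gt_mem_nhds (by linarith : 0 < R / 2)), eventually_ge_atTop N]
      with m h2 hm
    by_contra! hlt
    have h3 := hgron m hm
    have h4 : 1 / ((m : ℝ) + 1) * Real.exp (L * t m) ≤ 1 / ((m : ℝ) + 1) * Real.exp (L * T) := by
      gcongr
    linarith
  have hsph : ∀ m, u (m + N) (t (m + N)) ∈ Metric.sphere η (R / 2) := fun m => by
    rw [mem_sphere_iff_norm]; exact htR _ (by omega)
  obtain ⟨z, hz, φ, hφ, hlim⟩ := (isCompact_sphere η (R / 2)).tendsto_subseq hsph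
  have hzω : z ∈ omegaLimitSet F (U ∩ θ) := by
    simp only [omegaLimitSet, mem_iInter]
    intro T hT
    refine mem_closure_of_tendsto hlim ?_
    have h1 : Tendsto (fun k => t (φ k + N)) atTop atTop :=
      htinf.comp ((tendsto_add_atTop_nat N).comp hφ.tendsto_atTop)
    filter_upwards [h1.eventually (eventually_gt_atTop T)] with k hk
    refine ⟨t (φ k + N), hk, u (φ k + N), (hu _).mono fun s hs => hs.1, ?_, rfl⟩
    rw [hu0]
    exact ⟨hball (Metric.ball_subset_ball (min_le_left _ _) (hy _).2), (hy _).1⟩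
  rw [hω, mem_singleton_iff] at hzω
  rw [hzω, mem_sphere_iff_norm, sub_self, norm_zero] at hz
  linarith

/-- Near an equilibrium regular edge state there is an expanded quadratic form whose positive cone
is transverse to the threshold. -/
theorem IsEquilibriumRegularEdgeState.exists_cone
    {f : EuclideanSpace ℝ (Fin n) → EuclideanSpace ℝ (Fin d) → EuclideanSpace ℝ (Fin n)}
    (hf : ContDiff ℝ 1 (fun p : EuclideanSpace ℝ (Fin n) × EuclideanSpace ℝ (Fin d) => f p.1 p.2))
    {lam : EuclideanSpace ℝ (Fin d)} {η : EuclideanSpace ℝ (Fin n)}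
    (hη : IsEquilibriumRegularEdgeState (fun y => f y lam) η) :
    ∃ ν : EuclideanSpace ℝ (Fin n), ‖ν‖ = 1 ∧
    ∃ B : EuclideanSpace ℝ (Fin n) →L[ℝ] EuclideanSpace ℝ (Fin n) →L[ℝ] ℝ,
      (∀ v w, B v w = B w v) ∧ (∀ v, inner ℝ v ν = 0 → B v v ≤ 0) ∧
      (∀ v, v ≠ 0 → ‖v‖ / 8 ≤ |inner ℝ v ν| → 0 < B v v) ∧
      ∃ c > 0, ∃ R > 0, ∃ L ≥ 0, ∃ δ > 0, IsLocallyExpanding f B c L lam δ η R := by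
  obtain ⟨⟨hη0, hhyp⟩, θ, hθ, hatt, hst⟩ := hη
  have hηθ : η ∈ θ := hatt.subset rfl
  obtain ⟨ν, hν, C, a, b, hC, ha, hab, hrate⟩ := hθ.normally_repelling
  set A := fderiv ℝ (fun y => f y lam) η with hA
  obtain ⟨μ, hμ, hAν⟩ := inner_map_eq_of_growth A (hν.norm_normal η hηθ) hC ha hab
    fun t ht v hv => hrate t ht (fun _ => η) v (isSol_const fun _ _ => hη0) hηθ hv
  obtain ⟨B, hB, ⟨c, hc, hBc⟩, -⟩ := exists_lyapunov A hhyp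
  obtain ⟨R, hR, L, hL, δ, hδ, hexp⟩ := exists_isLocallyExpanding hf hc hBc
  obtain ⟨ι, hι, hneg⟩ := exists_forall_form_nonpos hB hc hL hR
    (hexp lam (Metric.mem_ball_self hδ)) hη0 hatt hst
  obtain ⟨W, hW, hηW, g, hg, hiff, hgrad⟩ := hν.local_eq η hηθ
  obtain ⟨k, hk, hgk⟩ := hgrad η ⟨hηW, hηθ⟩
  have hn := hν.norm_normal η hηθ
  set N := ν η with hN
  -- A tangent vector inside the cone could be perturbed slightly along the normal so as to point to
  -- states of `θ` arbitrarily close to `η`, which lie outside the cone.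
  have hBneg : ∀ w, inner ℝ w N = 0 → B w w ≤ 0 := by
    intro w hw
    by_contra! hpos
    have hcont : Continuous fun k : ℝ => B (w + k • N) (w + k • N) := by fun_prop
    have h1 : ∀ᶠ k in 𝓝 (0 : ℝ), 0 < B (w + k • N) (w + k • N) :=
      hcont.continuousAt.eventually (lt_mem_nhds (by simpa using hpos))
    obtain ⟨κ, hκ, hκ'⟩ := Metric.eventually_nhds_iff.1 h1
    have h2 := exists_mem_hypersurface hn hW hηW hηθ hg hiff hk hgk
      (by rwa [real_inner_comm]) (half_pos hκ)
    have hsmall : ∀ᶠ ε in 𝓝[>] (0 : ℝ), ε * (‖w‖ + κ / 2) < ι := by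
      have h : Tendsto (fun ε : ℝ => ε * (‖w‖ + κ / 2)) (𝓝 0) (𝓝 (0 * (‖w‖ + κ / 2))) :=
        tendsto_id.mul_const _
      rw [zero_mul] at h
      exact (h.mono_left nhdsWithin_le_nhds).eventually (gt_mem_nhds hι)
    obtain ⟨ε, ⟨k', hk', hmem⟩, h3, h4⟩ := (h2.and (hsmall.and self_mem_nhdsWithin)).exists
    have hε : 0 < ε := h4
    have habs : |k'| ≤ κ / 2 := abs_le.2 hk'
    have h5 := hneg _ ⟨hmem, by
      rw [Metric.mem_ball, dist_eq_norm, add_sub_cancel_left, norm_smul, Real.norm_of_nonneg hε.le]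
      refine lt_of_le_of_lt ?_ h3
      gcongr
      refine (norm_add_le _ _).trans ?_
      rw [norm_smul, hn, mul_one]
      gcongr
      exact habs⟩
    simp only [add_sub_cancel_left, map_smul, smul_apply, smul_eq_mul] at h5
    have h6 := hκ' (y := k') (by rw [Real.dist_eq, sub_zero]; linarith)
    have : 0 < ε * (ε * B (w + k' • N) (w + k' • N)) := by positivity
    linarith
  -- If `|⟨v, N⟩| ≥ ‖v‖ / 8`, the added term `K ⟨v, N⟩²` is at least `(‖B‖ + 1) ‖v‖²` and outweighs
  -- `B`. It vanishes on tangent vectors and keeps the expansion, since `N` is a left eigenvector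
  -- with `μ ≥ 0`.
  set K := 64 * (‖B‖ + 1) with hK
  have hK0 : 0 < K := by positivity
  let Q : EuclideanSpace ℝ (Fin n) →L[ℝ] EuclideanSpace ℝ (Fin n) →L[ℝ] ℝ :=
    B + K • (innerSL ℝ N).smulRight (innerSL ℝ N)
  have hQ : ∀ v w, Q v w = B v w + K * (inner ℝ v N * inner ℝ w N) := fun v w => by
    simp [Q, real_inner_comm]
  have hQc : ∀ v, c * ‖v‖ ^ 2 ≤ Q v (A v) := fun v => by
    rw [hQ, hAν]
    have : 0 ≤ K * (inner ℝ v N * (μ * inner ℝ v N)) := by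
      have : K * (inner ℝ v N * (μ * inner ℝ v N)) = K * μ * (inner ℝ v N) ^ 2 := by ring
      rw [this]; positivity
    linarith [hBc v]
  refine ⟨N, hn, Q, fun v w => by rw [hQ, hQ, hB]; ring, fun v hv => ?_, fun v hv0 hv => ?_, c, hc,
    exists_isLocallyExpanding hf hc hQc⟩
  · rw [hQ, hv]; simpa using hBneg v hv
  · rw [hQ]
    have h1 := (neg_le_abs _).trans (abs_form_le B v)
    have h2 : (‖v‖ / 8) ^ 2 ≤ |inner ℝ v N| ^ 2 := by gcongr
    rw [sq_abs] at h2
    have h3 : 0 < ‖v‖ ^ 2 := by have := norm_pos_iff.2 hv0; positivity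
    nlinarith [norm_nonneg B]

end EdgeState

/-! ### Continuous dependence of the solutions on the rate -/

section Continuity

/-- Barrier argument: where `g` first reaches the level `m` from below, difference quotients from
the left are nonnegative. -/
theorem lt_of_deriv_neg_at_level {g g' : ℝ → ℝ} {T m : ℝ} (hg : ∀ t ≤ T, HasDerivAt g (g' t) t)
    (hearly : ∀ᶠ t in atBot, g t < m) (h : ∀ t ≤ T, g t = m → g' t < 0) : ∀ t ≤ T, g t < m := by
  intro t ht
  by_contra! hm
  obtain ⟨t₀, ht₀, hle⟩ := (hearly.and (eventually_le_atBot t)).exists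
  have hcont : ContinuousOn g (Icc t₀ t) := fun s hs =>
    (hg s (hs.2.trans ht)).continuousAt.continuousWithinAt
  obtain ⟨s, hs, hsB, hs'⟩ := exists_first_exit isOpen_Iio hle hcont ht₀ (not_lt.2 hm)
  have hsm : m ≤ g s := not_lt.1 hsB
  have hd := hg s (hs.2.trans ht)
  have hleft : Tendsto g (𝓝[<] s) (𝓝 (g s)) := hd.continuousAt.tendsto.mono_left nhdsWithin_le_nhds
  have heq : g s = m := le_antisymm (le_of_tendsto hleft (by
    filter_upwards [Ico_mem_nhdsLT hs.1] with σ hσ using (hs' σ hσ).le)) hsm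
  have h1 := (hasDerivAt_iff_tendsto_slope.1 hd).mono_left
    (nhdsWithin_mono _ (fun x hx => ne_of_lt hx) : 𝓝[<] s ≤ 𝓝[≠] s)
  have h2 : 0 ≤ g' s := ge_of_tendsto h1 (by
    filter_upwards [Ico_mem_nhdsLT hs.1, self_mem_nhdsWithin] with σ hσ hσs
    rw [slope_def_field]
    have h3 : g σ < m := hs' σ hσ
    exact div_nonneg_of_nonpos (by linarith) (by linarith [show σ < s from hσs]))
  linarith [h s (hs.2.trans ht) heq]

variable {n d : ℕ}
  {f : EuclideanSpace ℝ (Fin n) → EuclideanSpace ℝ (Fin d) → EuclideanSpace ℝ (Fin n)}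
  {Λ : ℝ → EuclideanSpace ℝ (Fin d)} {lam : EuclideanSpace ℝ (Fin d)}
  {B : EuclideanSpace ℝ (Fin n) →L[ℝ] EuclideanSpace ℝ (Fin n) →L[ℝ] ℝ}
  {e : EuclideanSpace ℝ (Fin n)} {c c' L δ R r : ℝ}

/-- Near a sink of the past limit system, a solution stays close to every approximate solution to
which it is asymptotic in the past. -/
theorem IsLocallyExpanding.norm_sub_lt (hloc : IsLocallyExpanding f B c L lam δ e R)
    (hB : ∀ v w, B v w = B w v) (hc' : 0 < c') (hneg : ∀ v, B v v ≤ -(c' * ‖v‖ ^ 2)) (hr : 0 < r)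
    (hc : 0 < c) {u w W : ℝ → EuclideanSpace ℝ (Fin n)} {T ρ κ : ℝ}
    (hu : ∀ t ≤ T, HasDerivAt u (rateField f Λ r t (u t)) t) (hw : ∀ t ≤ T, HasDerivAt w (W t) t)
    (hΛ : ∀ t ≤ T, Λ t ∈ Metric.ball lam δ) (hwR : ∀ t ≤ T, w t ∈ Metric.ball e (R / 2))
    (hρ : 0 < ρ) (hρR : ρ ≤ R / 2) (huw : Tendsto (fun t => u t - w t) atBot (𝓝 0))
    (hdef : ∀ t ≤ T, ‖rateField f Λ r t (w t) - W t‖ ≤ κ)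
    (hκ : 2 * ‖B‖ * κ < r⁻¹ * c * (Real.sqrt (c' / (‖B‖ + 1)) * ρ)) :
    ∀ t ≤ T, ‖u t - w t‖ < ρ := by
  have hbig : ∀ v, -B v v ≤ (‖B‖ + 1) * ‖v‖ ^ 2 := fun v => by
    have := (neg_le_abs _).trans (abs_form_le B v)
    nlinarith [sq_nonneg ‖v‖]
  have hr' : 0 < r⁻¹ := inv_pos.2 hr
  -- Near a sink `-B` is positive definite and serves as a squared norm. On its level `c' ρ²` the
  -- difference has norm between `√(c' / (‖B‖ + 1)) ρ` and `ρ`, and there `hκ` says that the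
  -- contraction beats the defect `κ`.
  suffices h : ∀ t ≤ T, -B (u t - w t) (u t - w t) < c' * ρ ^ 2 by
    intro t ht
    have h1 := hneg (u t - w t)
    have h2 : c' * ‖u t - w t‖ ^ 2 < c' * ρ ^ 2 := by linarith [h t ht]
    exact lt_of_pow_lt_pow_left₀ 2 hρ.le (lt_of_mul_lt_mul_left h2 hc'.le)
  refine lt_of_deriv_neg_at_level
    (g' := fun t => -(2 * B (u t - w t) (rateField f Λ r t (u t) - W t))) (fun t ht => ?_) ?_ ?_
  · have h1 := (hasDerivWithinAt_form (s := univ) hB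
      ((hu t ht).fun_sub (hw t ht)).hasDerivWithinAt).neg
    exact h1.hasDerivAt univ_mem
  · have h1 : Tendsto (fun t => -B (u t - w t) (u t - w t)) atBot (𝓝 0) := by
      have hcont : Continuous fun v : EuclideanSpace ℝ (Fin n) => -B v v := by fun_prop
      have := (hcont.tendsto 0).comp huw
      simpa [Function.comp_def] using this
    exact h1.eventually (gt_mem_nhds (by positivity))
  · intro t ht heq
    set Δ := u t - w t with hΔ
    have h1 : ‖Δ‖ ≤ ρ := by
      have : c' * ‖Δ‖ ^ 2 ≤ c' * ρ ^ 2 := by linarith [hneg Δ]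
      exact (abs_le_of_sq_le_sq' (le_of_mul_le_mul_left this hc') hρ.le).2
    have h2 : Real.sqrt (c' / (‖B‖ + 1)) * ρ ≤ ‖Δ‖ := by
      refine (abs_le_of_sq_le_sq' ?_ (norm_nonneg _)).2
      rw [mul_pow, Real.sq_sqrt (by positivity), div_mul_eq_mul_div, div_le_iff₀ (by positivity)]
      linarith [hbig Δ]
    have hΔ0 : 0 < ‖Δ‖ := lt_of_lt_of_le (by
      have : 0 < Real.sqrt (c' / (‖B‖ + 1)) := Real.sqrt_pos.2 (by positivity)
      positivity) h2
    have h3 := hwR t ht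
    have h4 : u t ∈ Metric.ball e R := by
      rw [Metric.mem_ball] at h3 ⊢
      have := dist_triangle (u t) (w t) e
      rw [dist_eq_norm (u t) (w t)] at this
      linarith
    have h5 := (hloc.isExpanding (Λ := Λ) hr t (hΛ t ht) _ h4 _
      (Metric.ball_subset_ball (by linarith) h3)).1
    have h6 : |B Δ (rateField f Λ r t (w t) - W t)| ≤ ‖B‖ * ‖Δ‖ * κ := by
      refine (B.le_opNorm₂ _ _).trans ?_
      gcongr
      exact hdef t ht
    have h7 : rateField f Λ r t (u t) - W t =
        (rateField f Λ r t (u t) - rateField f Λ r t (w t)) + (rateField f Λ r t (w t) - W t) := by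
      abel
    have h8 : ‖Δ‖ * (2 * ‖B‖ * κ) < ‖Δ‖ * (r⁻¹ * c * ‖Δ‖) := by
      refine mul_lt_mul_of_pos_left (hκ.trans_le ?_) hΔ0
      gcongr
    show -(2 * B Δ (rateField f Λ r t (u t) - W t)) < 0
    rw [h7, map_add]
    nlinarith [neg_abs_le (B Δ (rateField f Λ r t (w t) - W t))]
variable {J : ℝ → Set ℝ} {x : ℝ → ℝ → EuclideanSpace ℝ (Fin n)} {rc : ℝ}

/-- Solutions that tend to a sink of the past limit system depend continuously on the rate. -/
theorem continuity_of_past_limit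
    (hf : ContDiff ℝ 1 (fun p : EuclideanSpace ℝ (Fin n) × EuclideanSpace ℝ (Fin d) => f p.1 p.2))
    (hΛ : Continuous Λ) (hmax : ∀ r > 0, IsMaximalSol (rateField f Λ r) (J r) (x r))
    (hlim : Tendsto Λ atBot (𝓝 lam)) (hsink : IsHyperbolicSink (fun y => f y lam) e)
    (hpast : ∀ r > 0, (∀ᶠ τ in atBot, τ ∈ J r) ∧ Tendsto (x r) atBot (𝓝 e)) (hrc : 0 < rc) :
    ∃ a₀ ∈ J rc, ∀ ε > 0, ∀ᶠ r in 𝓝 rc, a₀ ∈ J r ∧ dist (x rc a₀) (x r a₀) < ε := by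
  obtain ⟨he0, hre⟩ := hsink
  obtain ⟨B, hB, ⟨c, hc, hBc⟩, hneg⟩ := exists_lyapunov _ fun μ hμ => (hre μ hμ).ne
  obtain ⟨c', hc', hneg⟩ := hneg hre
  obtain ⟨R, hR, L, hL, δ, hδ, hloc⟩ := exists_isLocallyExpanding hf hc hBc
  set ω := Real.sqrt (c' / (‖B‖ + 1)) with hω
  have hω0 : 0 < ω := Real.sqrt_pos.2 (by positivity)
  have hsmall : ∃ κ > 0, 2 * ‖B‖ * κ < c * (ω * (R / 2)) := by
    refine ⟨c * (ω * (R / 2)) / (2 * (2 * ‖B‖ + 1)), by positivity, ?_⟩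
    rw [mul_div_assoc', div_lt_iff₀ (by positivity)]
    have : 0 < c * (ω * (R / 2)) := by positivity
    nlinarith [norm_nonneg B]
  obtain ⟨κ, hκ, hκ'⟩ := hsmall
  have hfe : Tendsto (fun τ => ‖f e (Λ τ)‖) atBot (𝓝 0) := by
    have h1 : Continuous fun l => f e l := hf.continuous.comp (by fun_prop : Continuous fun l => (e, l))
    have h2 := ((h1.tendsto lam).comp hlim).norm
    have he0' : f e lam = 0 := he0
    rwa [he0', norm_zero] at h2
  obtain ⟨T, hT⟩ := eventually_atBot.1 ((hfe.eventually (gt_mem_nhds hκ)).and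
    (hlim.eventually (Metric.ball_mem_nhds lam hδ)))
  have hIic : ∀ r > 0, ∀ t ∈ J r, Iic t ⊆ J r := fun r hr t ht s hs => by
    obtain ⟨a, ha, has⟩ := ((hpast r hr).1.and (eventually_le_atBot s)).exists
    exact (hmax r hr).ordConnected.out ha ht ⟨has, hs⟩
  have hderiv : ∀ r > 0, ∀ t ∈ J r, HasDerivAt (x r) (rateField f Λ r t (x r t)) t :=
    fun r hr t ht => ((hmax r hr).isSol t ht).hasDerivAt ((hmax r hr).isOpen.mem_nhds ht)
  -- Comparison with the constant `e`. Defect and contraction both scale with `r⁻¹`, so the same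
  -- time `T` works for every rate.
  have hnear : ∀ r > 0, ∀ t ∈ J r, t ≤ T → ‖x r t - e‖ < R / 2 := by
    intro r hr t ht htT
    have hr' : 0 < r⁻¹ := inv_pos.2 hr
    refine hloc.norm_sub_lt hB hc' hneg hr hc (T := t) (w := fun _ => e) (W := fun _ => 0)
      (κ := r⁻¹ * κ) (fun s hs => hderiv r hr s (hIic r hr t ht hs))
      (fun s _ => hasDerivAt_const _ _) (fun s hs => (hT s (hs.trans htT)).2)
      (fun s _ => Metric.mem_ball_self (by linarith)) (by linarith) le_rfl ?_ ?_ ?_ t le_rfl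
    · simpa using (hpast r hr).2.sub_const e
    · intro s hs
      rw [sub_zero, rateField, norm_smul, Real.norm_of_nonneg hr'.le]
      gcongr
      exact (hT s (hs.trans htT)).1.le
    · have := mul_lt_mul_of_pos_left hκ' hr'
      linarith
  have hTJ : ∀ r > 0, T ∈ J r := by
    intro r hr
    obtain ⟨a, ha, haT⟩ := ((hpast r hr).1.and (eventually_le_atBot T)).exists
    refine (hmax r hr).Icc_subset_of_bounded hf hΛ ha haT (R := ‖e‖ + R / 2) (fun t ht => ?_)
      ⟨haT, le_rfl⟩
    have h1 := hnear r hr t ht.1 ht.2.2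
    have h2 := norm_le_norm_add_norm_sub e (x r t)
    rw [norm_sub_rev] at h2
    linarith
  refine ⟨T, hTJ rc hrc, fun ε hε => ?_⟩
  set ρ := min ε (R / 2) with hρ
  have hρ0 : 0 < ρ := lt_min hε (by linarith)
  -- Comparison of `x r` with `x rc`: the defect is `|r⁻¹ - rc⁻¹|` times a bound for `f` along `x
  -- rc`, and it tends to zero.
  have hev : ∀ᶠ r in 𝓝 rc, 2 * ‖B‖ * (|r⁻¹ - rc⁻¹| * (L * (R / 2) + κ)) < r⁻¹ * c * (ω * ρ) := by
    have hinv : Tendsto (fun r : ℝ => r⁻¹) (𝓝 rc) (𝓝 rc⁻¹) := tendsto_inv₀ hrc.ne'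
    have h1 : Tendsto (fun r : ℝ => 2 * ‖B‖ * (|r⁻¹ - rc⁻¹| * (L * (R / 2) + κ))) (𝓝 rc)
        (𝓝 (2 * ‖B‖ * (|rc⁻¹ - rc⁻¹| * (L * (R / 2) + κ)))) :=
      (((hinv.sub_const _).abs).mul_const _).const_mul _
    have h2 : Tendsto (fun r : ℝ => r⁻¹ * c * (ω * ρ)) (𝓝 rc) (𝓝 (rc⁻¹ * c * (ω * ρ))) :=
      (hinv.mul_const _).mul_const _
    refine h1.eventually_lt h2 ?_
    rw [sub_self, abs_zero, zero_mul, mul_zero]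
    have : 0 < rc⁻¹ := inv_pos.2 hrc
    positivity
  filter_upwards [hev, lt_mem_nhds hrc] with r hr1 hr
  refine ⟨hTJ r hr, ?_⟩
  rw [dist_comm, dist_eq_norm]
  refine lt_of_lt_of_le ?_ (min_le_left ε (R / 2))
  refine hloc.norm_sub_lt hB hc' hneg hr hc (T := T) (w := x rc)
    (W := fun t => rateField f Λ rc t (x rc t)) (κ := |r⁻¹ - rc⁻¹| * (L * (R / 2) + κ))
    (fun s hs => hderiv r hr s (hIic r hr T (hTJ r hr) hs))
    (fun s hs => hderiv rc hrc s (hIic rc hrc T (hTJ rc hrc) hs)) (fun s hs => (hT s hs).2)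
    (fun s hs => mem_ball_iff_norm.2 (hnear rc hrc s (hIic rc hrc T (hTJ rc hrc) hs) hs)) hρ0
    (min_le_right _ _) ?_ (fun s hs => ?_) hr1 T le_rfl
  · simpa using (hpast r hr).2.sub (hpast rc hrc).2
  · rw [rateField, rateField, ← sub_smul, norm_smul, Real.norm_eq_abs]
    have h1 := hnear rc hrc s (hIic rc hrc T (hTJ rc hrc) hs) hs
    have h2 := (hloc (Λ s) (hT s hs).2 0 (mem_univ _) (x rc s)
      (mem_ball_iff_norm.2 (by linarith)) e (Metric.mem_ball_self hR)).2
    have h3 : L * ‖x rc s - e‖ ≤ L * (R / 2) := by gcongr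
    have h4 := norm_le_norm_add_norm_sub (f e (Λ s)) (f (x rc s) (Λ s))
    rw [norm_sub_rev] at h4
    gcongr
    linarith [(hT s hs).1]

/-- Solutions of the family depend continuously on the rate, on compact intervals of late times. -/
theorem IsSolutionFamily.continuity
    (hf : ContDiff ℝ 1 (fun p : EuclideanSpace ℝ (Fin n) × EuclideanSpace ℝ (Fin d) => f p.1 p.2))
    (hΛ : Continuous Λ) (hx : IsSolutionFamily f Λ J x) (hrc : 0 < rc)
    (hex : ∃ T : ℝ, Ioi T ⊆ J rc) :
    ∃ a₀, Ici a₀ ⊆ J rc ∧ ∀ b ≥ a₀, ∀ ε > 0, ∀ᶠ r in 𝓝 rc, Icc a₀ b ⊆ J r ∧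
      ∀ t ∈ Icc a₀ b, dist (x rc t) (x r t) < ε := by
  obtain ⟨hmax, hcase⟩ := hx
  have hbase : ∃ a₀ ∈ J rc, ∀ ε > 0, ∀ᶠ r in 𝓝 rc, a₀ ∈ J r ∧ dist (x rc a₀) (x r a₀) < ε := by
    rcases hcase with ⟨x₀, t₀, h0⟩ | ⟨lamMinus, e, h1, h2, h3⟩
    · refine ⟨t₀, (h0 rc hrc).1, fun ε hε => ?_⟩
      filter_upwards [lt_mem_nhds hrc] with r hr
      exact ⟨(h0 r hr).1, by rw [(h0 r hr).2, (h0 rc hrc).2, dist_self]; exact hε⟩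
    · exact continuity_of_past_limit hf hΛ hmax h1 h2 h3 hrc
  obtain ⟨a₀, ha₀, hcont⟩ := hbase
  obtain ⟨T, hT⟩ := hex
  have hIci : Ici a₀ ⊆ J rc := fun t ht => (hmax rc hrc).ordConnected.out ha₀
    (hT (show T < max t (T + 1) from (lt_add_one T).trans_le (le_max_right _ _)))
    ⟨ht, le_max_left _ _⟩
  refine ⟨a₀, hIci, fun b hb ε hε => ?_⟩
  have hsub : Icc a₀ b ⊆ J rc := fun t ht => hIci ht.1
  have hsol := (hmax rc hrc).isSol.mono hsub
  obtain ⟨R₁, hR₁⟩ := exists_bound_Icc hsol.continuousOn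
  obtain ⟨R₂, hR₂⟩ := exists_bound_Icc (a := a₀) (b := b) hΛ.continuousOn
  obtain ⟨fc, L, M, hfc⟩ := exists_isCutoff hf (max (R₁ + 1) R₂)
  set q := ‖rc⁻¹‖₊ + 1 with hq
  have hT0 : 0 ≤ b - a₀ := by linarith
  set C := (1 + (b - a₀)) * Real.exp ((q * L : NNReal) * (b - a₀)) with hC
  have hC0 : 0 < C := by positivity
  -- After amplification by the Grönwall constant the error is below `ε`, and at most `1` as
  -- shadowing requires.
  set e := min (ε / 2) 1 / C with he
  have he0 : 0 < e := div_pos (lt_min (half_pos hε) one_pos) hC0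
  have hCe : C * e = min (ε / 2) 1 := by rw [he]; field_simp
  have hinv : Tendsto (fun r : ℝ => |rc⁻¹ - r⁻¹| * M) (𝓝 rc) (𝓝 0) := by
    have : Tendsto (fun r : ℝ => |rc⁻¹ - r⁻¹| * M) (𝓝 rc) (𝓝 (|rc⁻¹ - rc⁻¹| * M)) :=
      ((tendsto_const_nhds.sub (tendsto_inv₀ hrc.ne')).abs).mul_const _
    simpa using this
  filter_upwards [hcont e he0, eventually_nnnorm_inv_le hrc, hinv.eventually (gt_mem_nhds he0),
    lt_mem_nhds hrc] with r ⟨hr1, hr2⟩ hr3 hr4 hr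
  obtain ⟨h1, h2⟩ := (hmax r hr).shadow hf hΛ hfc hr3 (T := b - a₀) (c := a₀) (ε := e) hsol
    (fun t ht => (hR₁ t ht).trans (by linarith [le_max_left (R₁ + 1) R₂]))
    (fun t ht => (hR₂ t ht).trans (le_max_right _ _)) (fun t ht => by
      have hn : ‖x rc t‖ ≤ max (R₁ + 1) R₂ :=
        (hR₁ t ht).trans (by linarith [le_max_left (R₁ + 1) R₂])
      have hl := (hR₂ t ht).trans (le_max_right (R₁ + 1) R₂)
      rw [← hfc.rateField_eq hn hl, ← hfc.rateField_eq hn hl]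
      refine (hfc.dist_rateField_le (Λ' := Λ) t _).trans ?_
      rw [dist_self, mul_zero, mul_zero, add_zero]
      exact hr4.le) ⟨le_rfl, hb⟩ hr1 hr2.le le_rfl (hCe.le.trans (min_le_right _ _))
  refine ⟨h1, fun t ht => (h2 t ht).trans_lt ?_⟩
  have := hCe.le.trans (min_le_left _ _)
  linarith

end Continuity

/-! ### Persistence of attractors under asymptotically vanishing perturbations -/

section Attractor

variable {n d : ℕ}
  {f : EuclideanSpace ℝ (Fin n) → EuclideanSpace ℝ (Fin d) → EuclideanSpace ℝ (Fin n)}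
  {Λ : ℝ → EuclideanSpace ℝ (Fin d)} {lam : EuclideanSpace ℝ (Fin d)} {r : ℝ}
  {A : Set (EuclideanSpace ℝ (Fin n))}

theorem IsSol.rescale {v : ℝ → EuclideanSpace ℝ (Fin n)} {J : Set ℝ}
    (hv : IsSol (fun _ y => f y lam) J v) (r : ℝ) :
    IsSol (rateField f (fun _ => lam) r) {t | r⁻¹ * t ∈ J} (fun t => v (r⁻¹ * t)) := by
  have := hv.comp_affine r⁻¹ 0
  simp only [add_zero] at this
  exact this

/-- In the time of `x' = f`, the state `v 0` is reached from `v (-r (T + 1)) ∈ U` after time `T +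
1`, for every `T`. -/
theorem mem_omegaLimitSet_of_backward (hr : 0 < r) {U : Set (EuclideanSpace ℝ (Fin n))}
    {v : ℝ → EuclideanSpace ℝ (Fin n)} (hv : IsSol (rateField f (fun _ => lam) r) (Iic 0) v)
    (hU : ∀ t ≤ 0, v t ∈ U) : v 0 ∈ omegaLimitSet (fun y => f y lam) U := by
  simp only [omegaLimitSet, mem_iInter]
  intro T hT
  refine subset_closure ⟨T + 1, by linarith, fun t => v (r * t + -(r * (T + 1))), ?_, ?_, ?_⟩
  · have h1 := hv.comp_affine r (-(r * (T + 1)))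
    refine (h1.mono fun t ht => ?_).congr_field fun t _ => ?_
    · show r * t + -(r * (T + 1)) ≤ 0
      nlinarith [ht.2]
    · simp only [rateField, smul_smul, mul_inv_cancel₀ hr.ne', one_smul]
  · refine hU _ ?_
    have : 0 < r * (T + 1) := by positivity
    linarith
  · simp

theorem isCompact_setOf_infDist_le (hA : IsCompact A) (hne : A.Nonempty) (ε : ℝ) :
    IsCompact {y | Metric.infDist y A ≤ ε} := by
  refine (hA.cthickening (r := ε)).of_isClosed_subset
    (isClosed_le (Metric.continuous_infDist_pt A) continuous_const) fun y hy => ?_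
  obtain ⟨a, ha, hya⟩ := hA.exists_infDist_eq_dist hne y
  exact Metric.mem_cthickening_of_dist_le y a ε A ha (by rw [← hya]; exact hy)

/-- A closed `ε₀`-neighbourhood of `A` fits into a neighbourhood whose `ω`-limit set is `A`, and
this limit set captures all backward solutions. Later, limits of late solutions are shown to lie in
`A` in this way. -/
theorem IsAttractor.mem_of_backward (hA : IsAttractor (fun y => f y lam) A) :
    ∃ ε₀ > 0, ∀ ε ≤ ε₀, ∀ r > 0, ∀ v, IsSol (rateField f (fun _ => lam) r) (Iic 0) v →
      (∀ t ≤ 0, Metric.infDist (v t) A ≤ ε) → v 0 ∈ A := by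
  obtain ⟨U, hU, hω⟩ := hA.attracts
  obtain ⟨ε₀, hε₀, hsub⟩ := hA.isCompact.exists_cthickening_subset_open isOpen_interior
    (subset_interior_iff_mem_nhdsSet.2 hU)
  refine ⟨ε₀, hε₀, fun ε hε r hr v hv hvA => ?_⟩
  rw [inter_univ] at hω
  rw [← hω]
  refine mem_omegaLimitSet_of_backward hr hv fun t ht => interior_subset (hsub ?_)
  obtain ⟨a, ha, hya⟩ := hA.isCompact.exists_infDist_eq_dist hA.nonempty (v t)
  exact Metric.mem_cthickening_of_dist_le _ a _ A ha (by rw [← hya]; exact (hvA t ht).trans hε)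

theorem mem_closure_of_first_exit {X : Type*} [TopologicalSpace X] {v : ℝ → X} {O : Set X}
    {a t : ℝ} (hat : a < t) (hv : ContinuousOn v (Icc a t)) (hs : ∀ s ∈ Ico a t, v s ∈ O) :
    v t ∈ closure O :=
  mem_closure_of_tendsto ((hv t ⟨hat.le, le_rfl⟩).mono_left (nhdsWithin_le_of_mem
    (mem_of_superset (Ico_mem_nhdsLT hat) Ico_subset_Icc_self)))
    (by filter_upwards [Ico_mem_nhdsLT hat] with s h using hs s h)

/-- Solutions that start closer and closer to an attractor need longer and longer to reach a given
distance from it. -/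
theorem IsAttractor.eventually_lt_exit_time (hA : IsAttractor (fun y => f y lam) A)
    (hf : ContDiff ℝ 1 (fun p : EuclideanSpace ℝ (Fin n) × EuclideanSpace ℝ (Fin d) => f p.1 p.2))
    (hlim : Tendsto Λ atTop (𝓝 lam)) (hr : 0 < r) {ε : ℝ} (hε : 0 < ε) {rk a t : ℕ → ℝ}
    {w : ℕ → ℝ → EuclideanSpace ℝ (Fin n)} (hrlim : Tendsto rk atTop (𝓝 r))
    (hainf : Tendsto a atTop atTop) (hat : ∀ m, a m < t m)
    (hw : ∀ m, IsSol (rateField f Λ (rk m)) (Icc (a m) (t m)) (w m))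
    (hwa : Tendsto (fun m => Metric.infDist (w m (a m)) A) atTop (𝓝 0))
    (hwt : ∀ m, Metric.infDist (w m (t m)) A = ε)
    (hws : ∀ m, ∀ s ∈ Icc (a m) (t m), Metric.infDist (w m s) A ≤ ε) :
    ∀ S : ℝ, ∀ᶠ m in atTop, S < t m - a m := by
  have hK := isCompact_setOf_infDist_le hA.isCompact hA.nonempty ε
  have hcontA := Metric.continuous_infDist_pt A
  intro S
  by_contra hnot
  rw [not_eventually] at hnot
  obtain ⟨ψ, hψ, hψS⟩ := extraction_of_frequently_atTop hnot
  have hmem1 : ∀ m, w (ψ m) (a (ψ m)) ∈ {y | Metric.infDist y A ≤ ε} := fun m =>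
    hws (ψ m) (a (ψ m)) ⟨le_rfl, (hat _).le⟩
  have hmem2 : ∀ m, t (ψ m) - a (ψ m) ∈ Icc 0 S := fun m =>
    ⟨by linarith [hat (ψ m)], not_lt.1 (hψS m)⟩
  -- If the durations stayed bounded along a subsequence, initial states and durations would
  -- converge to some `z ∈ A` and `s`. The limit solution from `z` remains in `A` by invariance, yet
  -- at time `s` its distance from `A` would be `ε`.
  obtain ⟨⟨z, s⟩, hzs, φ, hφ, hlimφ⟩ := (hK.prod (isCompact_Icc (a := (0 : ℝ))
    (b := S))).tendsto_subseq fun m => mk_mem_prod (hmem1 m) (hmem2 m)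
  have hθ : Tendsto (fun k => ψ (φ k)) atTop atTop := hψ.tendsto_atTop.comp hφ.tendsto_atTop
  have hz : Tendsto (fun k => w (ψ (φ k)) (a (ψ (φ k)))) atTop (𝓝 z) :=
    (continuous_fst.tendsto _).comp hlimφ
  have hs : Tendsto (fun k => t (ψ (φ k)) - a (ψ (φ k))) atTop (𝓝 s) :=
    (continuous_snd.tendsto _).comp hlimφ
  have hzA : z ∈ A := by
    rw [hA.isCompact.isClosed.mem_iff_infDist_zero hA.nonempty]
    exact tendsto_nhds_unique ((hcontA.tendsto z).comp hz)
      (hwa.comp hθ)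
  obtain ⟨u, hu, hu0, huA⟩ := hA.invariant z hzA
  obtain ⟨R, hR⟩ := hK.isBounded.exists_norm_le
  obtain ⟨fc, L, M, hfc⟩ := exists_isCutoff hf (max R (‖lam‖ + 1))
  obtain ⟨v, hv, hv0⟩ := hfc.exists_isSol (Λ := fun _ => lam) continuous_const r 0 z
  have hAK : ∀ y ∈ A, ‖y‖ ≤ max R (‖lam‖ + 1) := fun y hy => by
    have hyK : Metric.infDist y A ≤ ε := by rw [Metric.infDist_zero_of_mem hy]; exact hε.le
    exact (hR y hyK).trans (le_max_left _ _)
  have hlamR : ‖lam‖ < max R (‖lam‖ + 1) := (lt_add_one _).trans_le (le_max_right _ _)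
  have hu' : IsSol (rateField fc (fun _ => lam) r) univ (fun t => u (r⁻¹ * t)) := by
    refine IsSol.congr_field (G := rateField f (fun _ => lam) r) (hu.rescale r) fun t _ => ?_
    exact (hfc.rateField_eq (Λ := fun _ => lam) (hAK _ (huA (r⁻¹ * t))) hlamR.le).symm
  have hvA : v s ∈ A := by
    rw [hv.eqOn_of_lipschitz hu' (hfc.lipschitzWith_rateField le_rfl) ordConnected_univ
      (mem_univ 0) (by simp [hv0, hu0]) (mem_univ s)]
    exact huA _
  have hck : ∀ k, a (ψ (φ k)) + (t (ψ (φ k)) - a (ψ (φ k))) = t (ψ (φ k)) := fun k => by ring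
  have hconv : Tendsto (fun k => w (ψ (φ k)) (a (ψ (φ k)) + (t (ψ (φ k)) - a (ψ (φ k))))) atTop
      (𝓝 (v s)) := hfc.tendsto (Λ := Λ) hlim hlamR hr
    (rk := fun k => rk (ψ (φ k))) (hrlim.comp hθ) (ck := fun k => a (ψ (φ k))) (hainf.comp hθ)
    (sk := fun k => t (ψ (φ k)) - a (ψ (φ k))) hs (wk := fun k => w (ψ (φ k))) hz hv hv0
    (Eventually.of_forall fun k => by
      rw [hck, uIcc_of_le (hat _).le]
      exact ⟨hw _, fun τ hτ => (hR _ (hws _ τ hτ)).trans (le_max_left _ _)⟩)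
  simp only [hck] at hconv
  have h1 := (hcontA.tendsto _).comp hconv
  have h2 : Tendsto (fun k => Metric.infDist (w (ψ (φ k)) (t (ψ (φ k)))) A) atTop (𝓝 ε) := by
    simp only [hwt]; exact tendsto_const_nhds
  have h3 := tendsto_nhds_unique h1 h2
  rw [Metric.infDist_zero_of_mem hvA] at h3
  linarith

/-- Attractors are stable under asymptotically small perturbations of the field. -/
theorem IsAttractor.exists_stays_near (hA : IsAttractor (fun y => f y lam) A)
    (hf : ContDiff ℝ 1 (fun p : EuclideanSpace ℝ (Fin n) × EuclideanSpace ℝ (Fin d) => f p.1 p.2))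
    (hlim : Tendsto Λ atTop (𝓝 lam)) (hr : 0 < r) :
    ∃ ε₀ > 0, ∀ ε ∈ Ioc 0 ε₀, ∃ ε' > 0, ∃ T₀ : ℝ, ∀ᶠ r' in 𝓝 r, ∀ (w : ℝ → _) (a b : ℝ), T₀ ≤ a →
      IsSol (rateField f Λ r') (Icc a b) w → Metric.infDist (w a) A < ε' →
      ∀ t ∈ Icc a b, Metric.infDist (w t) A < ε := by
  obtain ⟨ε₀, hε₀, hback⟩ := hA.mem_of_backward
  refine ⟨ε₀, hε₀, fun ε ⟨hε, hεε₀⟩ => ?_⟩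
  by_contra! hcon
  have hK := isCompact_setOf_infDist_le hA.isCompact hA.nonempty ε
  have hcontA := Metric.continuous_infDist_pt A
  -- A failure of stability produces solutions that start ever later and closer to `A` and first
  -- reach distance `ε` after ever longer times. Recentred at that moment, they converge to a
  -- backward solution within distance `ε`, which must end in `A`.
  have hseq : ∀ m : ℕ, ∃ (r' : ℝ) (w : ℝ → EuclideanSpace ℝ (Fin n)) (a t : ℝ),
      dist r' r < 1 / ((m : ℝ) + 1) ∧ (m : ℝ) ≤ a ∧ a < t ∧
      IsSol (rateField f Λ r') (Icc a t) w ∧ Metric.infDist (w a) A < 1 / ((m : ℝ) + 1) ∧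
      Metric.infDist (w t) A = ε ∧ ∀ s ∈ Icc a t, Metric.infDist (w s) A ≤ ε := by
    intro m
    have hm : 0 < 1 / ((m : ℝ) + 1) := by positivity
    obtain ⟨r', ⟨w, a, b, ha, hw, hwa, t', ht', hwt'⟩, hr'⟩ :=
      ((hcon (min ε (1 / ((m : ℝ) + 1))) (lt_min hε hm) m).and_eventually
        (Metric.ball_mem_nhds r hm)).exists
    have hopen : IsOpen {y | Metric.infDist y A < ε} := isOpen_lt hcontA continuous_const
    have hwc : ContinuousOn w (Icc a t') := hw.continuousOn.mono (Icc_subset_Icc_right ht'.2)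
    obtain ⟨t, ht, htO, hts⟩ := exists_first_exit hopen ht'.1 hwc (hwa.trans_le (min_le_left _ _))
      (not_lt.2 hwt')
    have hcl : Metric.infDist (w t) A ≤ ε := by
      have h1 := mem_closure_of_first_exit ht.1 (hwc.mono (Icc_subset_Icc_right ht.2)) hts
      exact closure_lt_subset_le hcontA continuous_const h1
    refine ⟨r', w, a, t, hr', ha, ht.1, hw.mono (Icc_subset_Icc_right (ht.2.trans ht'.2)),
      hwa.trans_le (min_le_right _ _), le_antisymm hcl (not_lt.1 htO), fun s hs => ?_⟩
    rcases hs.2.eq_or_lt with rfl | hlt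
    · exact hcl
    · exact (hts s ⟨hs.1, hlt⟩ : _ < _).le
  choose rk w a t hrk ham hat hw hwa hwt hws using hseq
  have h0 : Tendsto (fun m : ℕ => 1 / ((m : ℝ) + 1)) atTop (𝓝 0) :=
    tendsto_one_div_add_atTop_nhds_zero_nat
  have hrlim : Tendsto rk atTop (𝓝 r) := tendsto_iff_dist_tendsto_zero.2
    (squeeze_zero (fun _ => dist_nonneg) (fun m => (hrk m).le) h0)
  have hainf : Tendsto a atTop atTop := tendsto_atTop_mono ham tendsto_natCast_atTop_atTop
  have htinf : Tendsto t atTop atTop := tendsto_atTop_mono (fun m => (hat m).le) hainf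
  have hdiff := hA.eventually_lt_exit_time hf hlim hr hε hrlim hainf hat hw
    (squeeze_zero (fun _ => Metric.infDist_nonneg) (fun m => (hwa m).le) h0) hwt hws
  obtain ⟨z, _, φ, hφ, hz⟩ := hK.tendsto_subseq (x := fun m => w m (t m))
    fun m => hws m (t m) ⟨(hat m).le, le_rfl⟩
  have hφ' := hφ.tendsto_atTop
  obtain ⟨v, hv, hv0, hvK⟩ := exists_limit_solution hf hlim hr (hrlim.comp hφ') (htinf.comp hφ')
    (wk := fun k => w (φ k)) hz hK (J := Iic 0) fun s hs => by
      filter_upwards [hφ'.eventually (hdiff (-s))] with k hk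
      have hs' : s ≤ 0 := hs
      have hsub : uIcc (t (φ k)) (t (φ k) + s) ⊆ Icc (a (φ k)) (t (φ k)) := by
        rw [uIcc_of_ge (by linarith)]
        exact Icc_subset_Icc_left (by linarith)
      exact ⟨(hw _).mono hsub, fun τ hτ => hws _ τ (hsub hτ)⟩
  have hzA : z ∈ A := by
    rw [← hv0]
    exact hback ε hεε₀ r hr v hv fun t ht => hvK t ht
  have h2 : Tendsto (fun k => Metric.infDist (w (φ k) (t (φ k))) A) atTop (𝓝 ε) := by
    simp only [hwt]; exact tendsto_const_nhds
  have h3 := tendsto_nhds_unique ((hcontA.tendsto z).comp hz) h2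
  rw [Metric.infDist_zero_of_mem hzA] at h3
  linarith

theorem tendsto_infDist_of_limit {K : Set (EuclideanSpace ℝ (Fin n))} (hK : IsCompact K)
    {w : ℝ → EuclideanSpace ℝ (Fin n)} {a : ℝ} (hw : ∀ t ≥ a, w t ∈ K)
    (h : ∀ (tk : ℕ → ℝ) (z : _), Tendsto tk atTop atTop →
      Tendsto (fun k => w (tk k)) atTop (𝓝 z) → z ∈ A) :
    Tendsto (fun t => Metric.infDist (w t) A) atTop (𝓝 0) := by
  rw [Metric.tendsto_nhds]
  by_contra! hcon
  obtain ⟨ε, hε, hfreq⟩ := hcon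
  obtain ⟨tk, htk, htk'⟩ := exists_seq_forall_of_frequently hfreq
  obtain ⟨N, hN⟩ := eventually_atTop.1 (htk.eventually (eventually_ge_atTop a))
  obtain ⟨z, _, φ, hφ, hz⟩ := hK.tendsto_subseq (x := fun k => w (tk (k + N)))
    fun k => hw _ (hN _ (by omega))
  have hzA := h (fun k => tk (φ k + N)) z
    (htk.comp ((tendsto_add_atTop_nat N).comp hφ.tendsto_atTop)) hz
  have h1 := ((Metric.continuous_infDist_pt A).tendsto z).comp hz
  rw [Metric.infDist_zero_of_mem hzA] at h1
  obtain ⟨k, hk⟩ := ((Metric.tendsto_nhds.1 h1) ε hε).exists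
  exact absurd hk (not_lt.2 (htk' _))

theorem uIcc_subset_Ici_of_le {a c s : ℝ} (h : a + |s| ≤ c) : uIcc c (c + s) ⊆ Ici a :=
  fun t ht => by
    have h1 := abs_sub_left_of_mem_uIcc ht
    rw [add_sub_cancel_left] at h1
    show a ≤ t
    linarith [neg_abs_le (t - c)]

/-- A solution that remains close to an attractor converges to it. -/
theorem IsAttractor.tendsto_of_stays_near (hA : IsAttractor (fun y => f y lam) A)
    (hf : ContDiff ℝ 1 (fun p : EuclideanSpace ℝ (Fin n) × EuclideanSpace ℝ (Fin d) => f p.1 p.2))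
    (hlim : Tendsto Λ atTop (𝓝 lam)) :
    ∃ ε₀ > 0, ∀ r > 0, ∀ (w : ℝ → _) (a : ℝ), IsSol (rateField f Λ r) (Ici a) w →
      (∀ t ≥ a, Metric.infDist (w t) A ≤ ε₀) →
      Tendsto (fun t => Metric.infDist (w t) A) atTop (𝓝 0) := by
  obtain ⟨ε₀, hε₀, hback⟩ := hA.mem_of_backward
  have hK := isCompact_setOf_infDist_le hA.isCompact hA.nonempty ε₀
  refine ⟨ε₀, hε₀, fun r hr w a hw hwA => tendsto_infDist_of_limit hK hwA fun tk z htk hz => ?_⟩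
  obtain ⟨v, hv, hv0, hvK⟩ := exists_limit_solution hf hlim hr (rk := fun _ => r)
    tendsto_const_nhds htk (wk := fun _ => w) hz hK (J := Iic 0) fun s _ => by
      filter_upwards [htk.eventually (eventually_ge_atTop (a + |s|))] with k hk
      exact ⟨hw.mono (uIcc_subset_Ici_of_le hk), fun t ht => hwA t (uIcc_subset_Ici_of_le hk ht)⟩
  rw [← hv0]
  exact hback ε₀ le_rfl r hr v hv fun t ht => hvK t ht

variable {B : EuclideanSpace ℝ (Fin n) →L[ℝ] EuclideanSpace ℝ (Fin n) →L[ℝ] ℝ}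
  {η : EuclideanSpace ℝ (Fin n)} {c L δ R ρ : ℝ}

theorem IsLocallyExpanding.isExpanding_limit (hloc : IsLocallyExpanding f B c L lam δ η R)
    (hδ : 0 < δ) (hr : 0 < r) :
    IsExpanding B (r⁻¹ * c) (r⁻¹ * L) (rateField f (fun _ => lam) r) univ η R :=
  fun t _ => hloc.isExpanding (Λ := fun _ => lam) hr t (Metric.mem_ball_self hδ)

theorem isSol_const_limit (hη : f η lam = 0) (J : Set ℝ) :
    IsSol (rateField f (fun _ => lam) r) J (fun _ => η) :=
  isSol_const fun t _ => by rw [rateField, hη, smul_zero]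

/-- A solution that remains close to the equilibrium `η` converges to it. -/
theorem IsLocallyExpanding.tendsto_of_stays (hloc : IsLocallyExpanding f B c L lam δ η R)
    (hf : ContDiff ℝ 1 (fun p : EuclideanSpace ℝ (Fin n) × EuclideanSpace ℝ (Fin d) => f p.1 p.2))
    (hlim : Tendsto Λ atTop (𝓝 lam)) (hB : ∀ v w, B v w = B w v) (hc : 0 < c) (hδ : 0 < δ)
    (hη : f η lam = 0) (hρ : 0 ≤ ρ) (hρR : ρ < R) (hr : 0 < r) {w : ℝ → EuclideanSpace ℝ (Fin n)}
    {a : ℝ} (hw : IsSol (rateField f Λ r) (Ici a) w) (hwρ : ∀ t ≥ a, w t ∈ Metric.closedBall η ρ) :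
    Tendsto (fun t => Metric.infDist (w t) {η}) atTop (𝓝 0) := by
  refine tendsto_infDist_of_limit (isCompact_closedBall η ρ) hwρ fun tk z htk hz => ?_
  obtain ⟨v, hv, hv0, hvK⟩ := exists_limit_solution hf hlim hr (rk := fun _ => r)
    tendsto_const_nhds htk (wk := fun _ => w) hz (isCompact_closedBall η ρ) (J := univ)
    fun s _ => by
      filter_upwards [htk.eventually (eventually_ge_atTop (a + |s|))] with k hk
      exact ⟨hw.mono (uIcc_subset_Ici_of_le hk), fun t ht => hwρ t (uIcc_subset_Ici_of_le hk ht)⟩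
  rw [← hv0, mem_singleton_iff]
  exact (hloc.isExpanding_limit hδ hr).eq_of_univ hB (mul_pos (inv_pos.2 hr) hc) rfl hv
    (isSol_const_limit hη univ) (fun t => Metric.closedBall_subset_ball hρR (hvK t (mem_univ t)))
    (fun _ => Metric.mem_ball_self (hρ.trans_lt hρR)) 0

end Attractor

/-! ### Exit from the edge state and convergence along a connection -/

section Tipping

/-- The properties of a family of solutions near a critical rate, and of the future limit system
near the edge state `η`, on which the arguments below rest. -/
structure IsTippingSetting {n d : ℕ}
    (f : EuclideanSpace ℝ (Fin n) → EuclideanSpace ℝ (Fin d) → EuclideanSpace ℝ (Fin n))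
    (Λ : ℝ → EuclideanSpace ℝ (Fin d)) (lam : EuclideanSpace ℝ (Fin d)) (J : ℝ → Set ℝ)
    (x : ℝ → ℝ → EuclideanSpace ℝ (Fin n)) (η : EuclideanSpace ℝ (Fin n)) (rc : ℝ)
    (ν : EuclideanSpace ℝ (Fin n))
    (B : EuclideanSpace ℝ (Fin n) →L[ℝ] EuclideanSpace ℝ (Fin n) →L[ℝ] ℝ) (c L δ R : ℝ) :
    Prop where
  contDiff : ContDiff ℝ 1
    (fun p : EuclideanSpace ℝ (Fin n) × EuclideanSpace ℝ (Fin d) => f p.1 p.2)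
  continuous : Continuous Λ
  lim : Tendsto Λ atTop (𝓝 lam)
  maximal : ∀ r > 0, IsMaximalSol (rateField f Λ r) (J r) (x r)
  rc_pos : 0 < rc
  tendsto : Tendsto (x rc) atTop (𝓝 η)
  not_convergesTo : ∀ᶠ r in 𝓝[≠] rc, ¬ ConvergesTo (J r) (x r) {η}
  continuity : ∃ a₀, Ici a₀ ⊆ J rc ∧ ∀ b ≥ a₀, ∀ ε > 0, ∀ᶠ r in 𝓝 rc, Icc a₀ b ⊆ J r ∧
    ∀ t ∈ Icc a₀ b, dist (x rc t) (x r t) < ε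
  eq_zero : f η lam = 0
  norm_normal : ‖ν‖ = 1
  symm : ∀ v w, B v w = B w v
  nonpos : ∀ v, inner ℝ v ν = 0 → B v v ≤ 0
  pos : ∀ v, v ≠ 0 → ‖v‖ / 8 ≤ |inner ℝ v ν| → 0 < B v v
  c_pos : 0 < c
  L_nonneg : 0 ≤ L
  δ_pos : 0 < δ
  R_pos : 0 < R
  expanding : IsLocallyExpanding f B c L lam δ η R

theorem exists_isTippingSetting {n d : ℕ}
    {f : EuclideanSpace ℝ (Fin n) → EuclideanSpace ℝ (Fin d) → EuclideanSpace ℝ (Fin n)}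
    (hf : ContDiff ℝ 1 (fun p : EuclideanSpace ℝ (Fin n) × EuclideanSpace ℝ (Fin d) => f p.1 p.2))
    {Λ : ℝ → EuclideanSpace ℝ (Fin d)} (hΛ : Continuous Λ)
    {lam : EuclideanSpace ℝ (Fin d)} (hlim : Tendsto Λ atTop (𝓝 lam))
    {J : ℝ → Set ℝ} {x : ℝ → ℝ → EuclideanSpace ℝ (Fin n)} (hx : IsSolutionFamily f Λ J x)
    {η : EuclideanSpace ℝ (Fin n)} (hη : IsEquilibriumRegularEdgeState (fun y => f y lam) η)
    {rc : ℝ} (hrc : IsCriticalRate J x η rc) :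
    ∃ ν B c L δ R, IsTippingSetting f Λ lam J x η rc ν B c L δ R := by
  obtain ⟨ν, hν, B, hB, hneg, hpos, c, hc, R, hR, L, hL, δ, hδ, hloc⟩ := hη.exists_cone hf
  obtain ⟨hrc0, ⟨hex, hconv⟩, δ', hδ', hnot⟩ := hrc
  refine ⟨ν, B, c, L, δ, R, hf, hΛ, hlim, hx.1, hrc0, ?_, ?_, hx.continuity hf hΛ hrc0 hex, hη.1.1,
    hν, hB, hneg, hpos, hc, hL, hδ, hR, hloc⟩
  · simp only [Metric.infDist_singleton] at hconv
    exact tendsto_iff_dist_tendsto_zero.2 hconv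
  · filter_upwards [nhdsWithin_le_nhds (Metric.ball_mem_nhds rc hδ'), self_mem_nhdsWithin] with r h1 h2
    exact hnot r (abs_pos.2 (sub_ne_zero.2 h2)) h1

/-- `p` is a limit of states of the solutions `x r` at late times, with rates along `l`. -/
def IsTailPoint {n : ℕ} (J : ℝ → Set ℝ) (x : ℝ → ℝ → EuclideanSpace ℝ (Fin n)) (l : Filter ℝ)
    (p : EuclideanSpace ℝ (Fin n)) : Prop :=
  ∀ T : ℝ, ∀ ε > 0, ∃ᶠ r in l, ∃ τ ∈ J r, T < τ ∧ dist p (x r τ) < ε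

variable {n d : ℕ}
  {f : EuclideanSpace ℝ (Fin n) → EuclideanSpace ℝ (Fin d) → EuclideanSpace ℝ (Fin n)}
  {Λ : ℝ → EuclideanSpace ℝ (Fin d)} {lam : EuclideanSpace ℝ (Fin d)} {J : ℝ → Set ℝ}
  {x : ℝ → ℝ → EuclideanSpace ℝ (Fin n)} {η ν : EuclideanSpace ℝ (Fin n)} {rc : ℝ}
  {B : EuclideanSpace ℝ (Fin n) →L[ℝ] EuclideanSpace ℝ (Fin n) →L[ℝ] ℝ} {c L δ R : ℝ}

/-- In this form both tails are the same notion for two filters, so that later arguments treat them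
at once. Restricting to `T > 0` is harmless, since `T` may be increased. -/
theorem mem_upperEdgeTail_iff (p : EuclideanSpace ℝ (Fin n)) :
    p ∈ upperEdgeTail J x rc ↔ IsTailPoint J x (𝓝[>] rc) p := by
  simp only [upperEdgeTail, mem_iInter, Metric.mem_closure_iff]
  constructor
  · intro h T ε hε
    rw [(nhdsGT_basis rc).frequently_iff]
    intro b hb
    obtain ⟨_, ⟨r, hr, τ, hτ, hT, rfl⟩, hd⟩ := h (max T 1) (by positivity) (b - rc) (by linarith) ε hε
    exact ⟨r, by simpa using hr, τ, hτ, (le_max_left _ _).trans_lt hT, hd⟩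
  · intro h T _ δ hδ ε hε
    obtain ⟨r, ⟨τ, hτ, hT, hd⟩, hr⟩ := ((h T ε hε).and_eventually
      (Ioo_mem_nhdsGT (show rc < rc + δ by linarith))).exists
    exact ⟨_, ⟨r, hr, τ, hτ, hT, rfl⟩, hd⟩

theorem mem_lowerEdgeTail_iff (p : EuclideanSpace ℝ (Fin n)) :
    p ∈ lowerEdgeTail J x rc ↔ IsTailPoint J x (𝓝[<] rc) p := by
  simp only [lowerEdgeTail, mem_iInter, Metric.mem_closure_iff]
  constructor
  · intro h T ε hε
    rw [(nhdsLT_basis rc).frequently_iff]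
    intro b hb
    obtain ⟨_, ⟨r, hr, τ, hτ, hT, rfl⟩, hd⟩ := h (max T 1) (by positivity) (rc - b) (by linarith) ε hε
    exact ⟨r, by simpa using hr, τ, hτ, (le_max_left _ _).trans_lt hT, hd⟩
  · intro h T _ δ hδ ε hε
    obtain ⟨r, ⟨τ, hτ, hT, hd⟩, hr⟩ := ((h T ε hε).and_eventually
      (Ioo_mem_nhdsLT (show rc - δ < rc by linarith))).exists
    exact ⟨_, ⟨r, hr, τ, hτ, hT, rfl⟩, hd⟩

theorem isTailPoint_of_tendsto {l : Filter ℝ} {rk tk : ℕ → ℝ} (hrk : Tendsto rk atTop l)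
    (htk : Tendsto tk atTop atTop) (hJ : ∀ᶠ k in atTop, tk k ∈ J (rk k))
    {p : EuclideanSpace ℝ (Fin n)} (hp : Tendsto (fun k => x (rk k) (tk k)) atTop (𝓝 p)) :
    IsTailPoint J x l p := fun T ε hε => by
  refine hrk.frequently (Eventually.frequently ?_)
  filter_upwards [hJ, htk.eventually (eventually_gt_atTop T), (Metric.tendsto_nhds.1 hp) ε hε]
    with k h1 h2 h3
  exact ⟨tk k, h1, h2, by rwa [dist_comm]⟩

variable (S : IsTippingSetting f Λ lam J x η rc ν B c L δ R)

include S

/-- At late times, solutions with rates close to `rc` are close to `η` for a long time. -/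
theorem IsTippingSetting.exists_near {ρ : ℝ} (hρ : 0 < ρ) : ∃ T, ∀ b : ℝ, ∀ᶠ r in 𝓝 rc,
    Icc T b ⊆ J r ∧ ∀ t ∈ Icc T b, x r t ∈ Metric.ball η ρ := by
  obtain ⟨a₀, ha₀, hcont⟩ := S.continuity
  obtain ⟨T, hT⟩ := eventually_atTop.1 ((Metric.tendsto_nhds.1 S.tendsto) (ρ / 2) (half_pos hρ))
  refine ⟨max a₀ T, fun b => ?_⟩
  filter_upwards [hcont (max a₀ b) (le_max_left _ _) (ρ / 2) (half_pos hρ)] with r ⟨h1, h2⟩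
  have hsub : Icc (max a₀ T) b ⊆ Icc a₀ (max a₀ b) :=
    Icc_subset_Icc (le_max_left _ _) (le_max_right _ _)
  refine ⟨hsub.trans h1, fun t ht => ?_⟩
  have h3 := h2 t (hsub ht)
  have h4 := hT t ((le_max_right _ _).trans ht.1)
  rw [Metric.mem_ball]
  rw [dist_comm] at h3
  linarith [dist_triangle (x r t) (x rc t) η]

/-- Solutions with rates close to `rc` leave each small ball around `η`. -/
theorem IsTippingSetting.exists_exit {ρ : ℝ} (hρ : 0 < ρ) (hρR : ρ < R) : ∃ T₁, ∀ T ≥ T₁,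
    ∀ᶠ r in 𝓝[≠] rc, ∃ t > T, Icc T t ⊆ J r ∧ x r t ∉ Metric.ball η ρ ∧
      ∀ s ∈ Ico T t, x r s ∈ Metric.ball η ρ := by
  obtain ⟨T₁, hT₁⟩ := S.exists_near hρ
  refine ⟨T₁, fun T hT => ?_⟩
  filter_upwards [nhdsWithin_le_nhds (hT₁ T), S.not_convergesTo,
    nhdsWithin_le_nhds (lt_mem_nhds S.rc_pos)] with r ⟨h1, h2⟩ h3 hr
  have hTJ : T ∈ J r := h1 ⟨hT, le_rfl⟩
  have hTb := h2 T ⟨hT, le_rfl⟩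
  have hmax := S.maximal r hr
  obtain ⟨t₂, ht₂, htJ, htb⟩ : ∃ t₂ ≥ T, t₂ ∈ J r ∧ x r t₂ ∉ Metric.ball η ρ := by
    -- A solution that never left would be bounded, hence exist for all time, and converge to `η`,
    -- which is excluded for rates near `rc`.
    by_contra! hstay
    have hIci : Ici T ⊆ J r := fun t ht => by
      refine hmax.Icc_subset_of_bounded S.contDiff S.continuous hTJ (b := t) ht (R := ‖η‖ + ρ)
        (fun s hs => ?_) ⟨ht, le_rfl⟩
      have h4 := hstay s hs.2.1 hs.1
      rw [mem_ball_iff_norm] at h4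
      have h5 := norm_le_norm_add_norm_sub η (x r s)
      rw [norm_sub_rev] at h5
      linarith
    exact h3 ⟨⟨T, fun t ht => hIci (show T < t from ht).le⟩,
      S.expanding.tendsto_of_stays S.contDiff S.lim S.symm S.c_pos S.δ_pos S.eq_zero hρ.le hρR hr
        (hmax.isSol.mono hIci) fun t ht => Metric.ball_subset_closedBall (hstay t ht (hIci ht))⟩
  have hsub : Icc T t₂ ⊆ J r := hmax.ordConnected.out hTJ htJ
  obtain ⟨t, ht, h4, h5⟩ := exists_first_exit Metric.isOpen_ball ht₂
    (hmax.isSol.continuousOn.mono hsub) hTb htb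
  exact ⟨t, ht.1, (Icc_subset_Icc_right ht.2).trans hsub, h4, h5⟩

/-- Solutions with rates close to `rc` follow solutions of the future limit system at late times. -/
theorem IsTippingSetting.shadow {v : ℝ → EuclideanSpace ℝ (Fin n)} {a b s₀ : ℝ}
    (hv : IsSol (rateField f (fun _ => lam) rc) (Icc a b) v) (hs₀ : s₀ ∈ Icc a b) {ε : ℝ}
    (hε : 0 < ε) : ∃ ε' > 0, ∃ T : ℝ, ∀ᶠ r in 𝓝 rc, ∀ τ ∈ J r, T ≤ τ → dist (v s₀) (x r τ) < ε' →
      ∀ s ∈ Icc a b, τ + (s - s₀) ∈ J r ∧ dist (v s) (x r (τ + (s - s₀))) < ε := by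
  obtain ⟨R₁, hR₁⟩ := exists_bound_Icc hv.continuousOn
  obtain ⟨fc, Lc, M, hfc⟩ := exists_isCutoff S.contDiff (max (R₁ + 1) (‖lam‖ + 1))
  set q := ‖rc⁻¹‖₊ + 1 with hq
  have hT0 : 0 ≤ b - a := by linarith [hs₀.1, hs₀.2]
  set C := (1 + (b - a)) * Real.exp ((q * Lc : NNReal) * (b - a)) with hC
  have hC0 : 0 < C := by positivity
  set e := min (ε / 2) 1 / C with he
  have he0 : 0 < e := div_pos (lt_min (half_pos hε) one_pos) hC0
  have hCe : C * e = min (ε / 2) 1 := by rw [he]; field_simp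
  obtain ⟨T₁, hT₁⟩ := hfc.eventually_dist_le S.lim S.rc_pos he0
  have hlamR : ‖lam‖ < max (R₁ + 1) (‖lam‖ + 1) := (lt_add_one _).trans_le (le_max_right _ _)
  obtain ⟨T₂, hT₂⟩ := eventually_atTop.1 (S.lim.norm.eventually (gt_mem_nhds hlamR))
  refine ⟨e, he0, max T₁ T₂ + (b - a), ?_⟩
  filter_upwards [hT₁, lt_mem_nhds S.rc_pos, eventually_nnnorm_inv_le S.rc_pos] with r hr1 hr hr3
  intro τ hτ hTτ hd
  have hw : IsSol (rateField f (fun _ => lam) rc) (Icc (τ + (a - s₀)) (τ + (b - s₀)))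
      (fun t => v (t + (s₀ - τ))) := (hv.shift (s₀ - τ)).mono fun t ht =>
    ⟨by linarith [ht.1], by linarith [ht.2]⟩
  have hmem : ∀ t ∈ Icc (τ + (a - s₀)) (τ + (b - s₀)), t + (s₀ - τ) ∈ Icc a b := fun t ht =>
    ⟨by linarith [ht.1], by linarith [ht.2]⟩
  have hlate : ∀ t ∈ Icc (τ + (a - s₀)) (τ + (b - s₀)), max T₁ T₂ ≤ t := fun t ht => by
    linarith [ht.1, hs₀.2]
  have hvR : ∀ t ∈ Icc (τ + (a - s₀)) (τ + (b - s₀)), ‖v (t + (s₀ - τ))‖ + 1 ≤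
      max (R₁ + 1) (‖lam‖ + 1) := fun t ht =>
    le_max_of_le_left (by linarith [hR₁ _ (hmem t ht)])
  have hΛR : ∀ t ∈ Icc (τ + (a - s₀)) (τ + (b - s₀)), ‖Λ t‖ ≤ max (R₁ + 1) (‖lam‖ + 1) :=
    fun t ht => (hT₂ t ((le_max_right _ _).trans (hlate t ht))).le
  obtain ⟨h1, h2⟩ := (S.maximal r hr).shadow S.contDiff S.continuous hfc hr3 (T := b - a) (c := τ)
    (ε := e) hw (fun t ht => by linarith [hvR t ht]) hΛR (fun t ht => by
      rw [dist_comm, ← hfc.rateField_eq (by linarith [hvR t ht]) (hΛR t ht),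
        ← hfc.rateField_eq (Λ := fun _ => lam) (by linarith [hvR t ht]) hlamR.le]
      exact hr1 t ((le_max_left _ _).trans (hlate t ht)) _)
    ⟨by linarith [hs₀.1], by linarith [hs₀.2]⟩ hτ (by simpa using hd.le) (by linarith)
    (hCe.le.trans (min_le_right _ _))
  intro s hs
  have hs' : τ + (s - s₀) ∈ Icc (τ + (a - s₀)) (τ + (b - s₀)) :=
    ⟨by linarith [hs.1], by linarith [hs.2]⟩
  refine ⟨h1 hs', ?_⟩
  have h3 := (h2 _ hs').trans (hCe.le.trans (min_le_left _ _))
  rw [show τ + (s - s₀) + (s₀ - τ) = s by ring] at h3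
  linarith

/-- First exit points from a small ball have limit points, as the rate tends to `rc`. -/
theorem IsTippingSetting.exists_exit_limit {l : Filter ℝ} (hl : l ≤ 𝓝[≠] rc) {ρ : ℝ} (hρ : 0 < ρ)
    (hρR : ρ < R) : ∃ T₁, ∀ T ≥ T₁, ∀ rk : ℕ → ℝ, Tendsto rk atTop l →
    ∃ (φ : ℕ → ℕ) (tk : ℕ → ℝ) (p : _), StrictMono φ ∧ Tendsto tk atTop atTop ∧
      Tendsto (fun k => x (rk (φ k)) (tk k)) atTop (𝓝 p) ∧ ‖p - η‖ = ρ ∧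
      ∀ k, T < tk k ∧ Icc T (tk k) ⊆ J (rk (φ k)) ∧ x (rk (φ k)) (tk k) ∉ Metric.ball η ρ ∧
        ∀ s ∈ Ico T (tk k), x (rk (φ k)) s ∈ Metric.ball η ρ := by
  obtain ⟨T₁, hT₁⟩ := S.exists_near hρ
  obtain ⟨T₂, hT₂⟩ := S.exists_exit hρ hρR
  refine ⟨max T₁ T₂, fun T hT rk hrk => ?_⟩
  have hpos : ∀ᶠ k in atTop, 0 < rk k :=
    (hrk.mono_right (hl.trans nhdsWithin_le_nhds)).eventually (lt_mem_nhds S.rc_pos)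
  obtain ⟨N, hN⟩ := eventually_atTop.1
    ((hrk.eventually (hl (hT₂ T ((le_max_right _ _).trans hT)))).and hpos)
  choose t ht1 ht2 ht3 ht4 using fun k : ℕ => (hN (k + N) (by omega)).1
  have hsph : ∀ k, x (rk (k + N)) (t k) ∈ Metric.sphere η ρ := fun k => by
    rw [mem_sphere_iff_norm]
    exact norm_sub_eq_of_first_exit (ht1 k) (((S.maximal _ (hN (k + N)
      (by omega)).2).isSol.continuousOn).mono (ht2 k)) (ht3 k) (ht4 k)
  obtain ⟨p, hp, φ, hφ, hlim⟩ := (isCompact_sphere η ρ).tendsto_subseq hsph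
  -- Up to any given time `b`, solutions with rates sufficiently close to `rc` are still in the
  -- ball.
  have htinf : Tendsto t atTop atTop := by
    refine tendsto_atTop.2 fun b => ?_
    have h1 : Tendsto (fun k => rk (k + N)) atTop (𝓝 rc) :=
      (hrk.mono_right (hl.trans nhdsWithin_le_nhds)).comp (tendsto_add_atTop_nat N)
    filter_upwards [h1.eventually (hT₁ b)] with k hk
    by_contra! hlt
    exact ht3 k (hk.2 (t k) ⟨((le_max_left _ _).trans hT).trans (ht1 k).le, hlt.le⟩)
  exact ⟨fun k => φ k + N, fun k => t (φ k), p, fun a b hab => by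
    have := hφ hab
    show φ a + N < φ b + N
    omega, htinf.comp hφ.tendsto_atTop, hlim,
    mem_sphere_iff_norm.1 hp, fun k => ⟨ht1 _, ht2 _, ht3 _, ht4 _⟩⟩

/-- If an edge tail is a connection to an attractor, then the solutions converge to it. -/
theorem IsTippingSetting.eventually_convergesTo {l : Filter ℝ} [l.IsCountablyGenerated]
    (hl : l ≤ 𝓝[≠] rc) {A : Set (EuclideanSpace ℝ (Fin n))}
    (hA : IsAttractor (fun y => f y lam) A) {φ : ℝ → EuclideanSpace ℝ (Fin n)}
    (hC : IsConnection (fun y => f y lam) η A φ {p | IsTailPoint J x l p}) :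
    ∀ᶠ r in l, ConvergesTo (J r) (x r) A := by
  by_contra hcon
  rw [not_eventually] at hcon
  obtain ⟨rk, hrk, hrk'⟩ := exists_seq_forall_of_frequently hcon
  have hηA : 0 < Metric.infDist η A :=
    (hA.isCompact.isClosed.notMem_iff_infDist_pos hA.nonempty).1 hC.notMem
  -- The sphere of radius `ρ` avoids both `η` and `A`, so a limit of exit points can only lie on the
  -- connecting orbit.
  set ρ := min (R / 2) (Metric.infDist η A / 2) with hρ
  have hρ0 : 0 < ρ := lt_min (half_pos S.R_pos) (half_pos hηA)
  have hρR : ρ < R := (min_le_left _ _).trans_lt (half_lt_self S.R_pos)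
  obtain ⟨T₁, hT₁⟩ := S.exists_exit_limit hl hρ0 hρR
  obtain ⟨ψ, tk, p, hψ, htk, hp, hpρ, hexit⟩ := hT₁ T₁ le_rfl rk hrk
  have hrψ : Tendsto (fun k => rk (ψ k)) atTop l := hrk.comp hψ.tendsto_atTop
  have hptail : IsTailPoint J x l p := isTailPoint_of_tendsto hrψ htk
    (Eventually.of_forall fun k => (hexit k).2.1 ⟨(hexit k).1.le, le_rfl⟩) hp
  have hprange : p ∈ range φ := by
    rcases hC.subset hptail with (h | h) | h
    · rw [mem_singleton_iff.1 h, sub_self, norm_zero] at hpρ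
      exact absurd hpρ hρ0.ne
    · exact h
    · have h1 := Metric.infDist_le_dist_of_mem (x := η) h
      rw [dist_comm, dist_eq_norm, hpρ] at h1
      have := min_le_right (R / 2) (Metric.infDist η A / 2)
      linarith
  obtain ⟨s₁, hs₁⟩ := hprange
  have hrc' : rc⁻¹ ≠ 0 := inv_ne_zero S.rc_pos.ne'
  have hφ1 : IsSol (rateField f (fun _ => lam) rc) univ (fun t => φ (rc⁻¹ * t)) :=
    hC.isSol.rescale rc
  obtain ⟨ε₁, hε₁, hconvA⟩ := hA.tendsto_of_stays_near S.contDiff S.lim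
  obtain ⟨ε₀, hε₀, hnear⟩ := hA.exists_stays_near S.contDiff S.lim S.rc_pos
  obtain ⟨ε', hε', T₀, hstay⟩ := hnear (min ε₀ ε₁) ⟨lt_min hε₀ hε₁, min_le_left _ _⟩
  -- The connection is followed from the exit limit `φ s₁` until it is within `ε' / 2` of `A`;
  -- shadowing costs another `ε' / 2`, and then stability of the attractor takes over.
  obtain ⟨s₂, hs₂, hs₂A⟩ := ((hC.forward.2.eventually (gt_mem_nhds (half_pos hε'))).and
    (eventually_ge_atTop s₁)).exists
  obtain ⟨e, he, T₂, hT₂⟩ := S.shadow (s₀ := rc * s₁) (a := rc * s₁) (b := rc * s₂)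
    (hφ1.mono (subset_univ _)) ⟨le_rfl, by have := S.rc_pos; gcongr⟩ (half_pos hε')
  have hrc1 : Tendsto (fun k => rk (ψ k)) atTop (𝓝 rc) :=
    hrψ.mono_right (hl.trans nhdsWithin_le_nhds)
  have hshift : 0 ≤ rc * s₂ - rc * s₁ := by
    have : 0 ≤ rc * (s₂ - s₁) := mul_nonneg S.rc_pos.le (by linarith)
    linarith
  obtain ⟨k, hk1, hk2, hk3, hk4, hk5⟩ := ((hrc1.eventually hT₂).and ((hrc1.eventually hstay).and
    ((htk.eventually (eventually_ge_atTop (max T₀ T₂))).and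
    (((Metric.tendsto_nhds.1 hp) e he).and (hrc1.eventually (lt_mem_nhds S.rc_pos)))))).exists
  have hmax := S.maximal _ hk5
  obtain ⟨h1, h2⟩ := hk1 (tk k) ((hexit k).2.1 ⟨(hexit k).1.le, le_rfl⟩)
    ((le_max_right _ _).trans hk3) (by
      rw [dist_comm, inv_mul_cancel_left₀ S.rc_pos.ne', hs₁]; exact hk4) (rc * s₂)
    ⟨by linarith, le_rfl⟩
  set τ := tk k + (rc * s₂ - rc * s₁) with hτ
  have hτT : T₀ ≤ τ := by linarith [(le_max_left T₀ T₂).trans hk3]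
  have hstart : Metric.infDist (x (rk (ψ k)) τ) A < ε' := by
    rw [inv_mul_cancel_left₀ S.rc_pos.ne', dist_comm] at h2
    linarith [Metric.infDist_le_infDist_add_dist (s := A) (x := x (rk (ψ k)) τ) (y := φ s₂)]
  have hst : ∀ t ∈ J (rk (ψ k)), τ ≤ t → Metric.infDist (x (rk (ψ k)) t) A < min ε₀ ε₁ :=
    fun t ht hτt => hk2 _ τ t hτT (hmax.isSol.mono (hmax.ordConnected.out h1 ht)) hstart t
      ⟨hτt, le_rfl⟩
  obtain ⟨M, hM⟩ := (isCompact_setOf_infDist_le hA.isCompact hA.nonempty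
    (min ε₀ ε₁)).isBounded.exists_norm_le
  have hIci : Ici τ ⊆ J (rk (ψ k)) := fun t ht =>
    hmax.Icc_subset_of_bounded S.contDiff S.continuous h1 (b := t) ht (R := M)
      (fun s hs => hM _ (hst s hs.1 hs.2.1).le) ⟨ht, le_rfl⟩
  exact hrk' (ψ k) ⟨⟨τ, fun t ht => hIci (show τ < t from ht).le⟩,
    hconvA _ hk5 _ τ (hmax.isSol.mono hIci) fun t ht =>
      (hst t (hIci ht) ht).le.trans (min_le_right _ _)⟩

end Tipping

/-! ### The two halves of the cone -/

section Cone

variable {E : Type*} [NormedAddCommGroup E] [InnerProductSpace ℝ E]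

/-- The half of the cone `{v | 0 < B v v}` to which `ν` points. -/
def posCone (B : E →L[ℝ] E →L[ℝ] ℝ) (ν : E) : Set E := {v | 0 < B v v ∧ 0 < inner ℝ v ν}

/-- The cone `{v | 0 < B v v}` consists of two halves separated by the hyperplane `νᗮ`, and contains
all vectors at an angle to this hyperplane that is not too small. -/
structure IsConeForm (B : E →L[ℝ] E →L[ℝ] ℝ) (ν : E) : Prop where
  norm_normal : ‖ν‖ = 1
  symm : ∀ v w, B v w = B w v
  nonpos : ∀ v, inner ℝ v ν = 0 → B v v ≤ 0
  pos : ∀ v, v ≠ 0 → ‖v‖ / 8 ≤ |inner ℝ v ν| → 0 < B v v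

variable {B : E →L[ℝ] E →L[ℝ] ℝ} {ν v w : E}

theorem IsConeForm.neg (h : IsConeForm B ν) : IsConeForm B (-ν) where
  norm_normal := by rw [norm_neg, h.norm_normal]
  symm := h.symm
  nonpos v hv := h.nonpos v (by rwa [inner_neg_right, neg_eq_zero] at hv)
  pos v hv hv' := h.pos v hv (by rwa [inner_neg_right, abs_neg] at hv')

theorem IsConeForm.mem_or_mem (h : IsConeForm B ν) (hv : 0 < B v v) :
    v ∈ posCone B ν ∨ v ∈ posCone B (-ν) := by
  rcases lt_trichotomy (inner ℝ v ν) 0 with h1 | h1 | h1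
  · exact Or.inr ⟨hv, by rw [inner_neg_right]; linarith⟩
  · exact absurd (h.nonpos v h1) (not_le.2 hv)
  · exact Or.inl ⟨hv, h1⟩

theorem IsConeForm.mem_posCone (h : IsConeForm B ν) (hv : 0 < inner ℝ v ν)
    (hv' : ‖v‖ / 8 ≤ inner ℝ v ν) : v ∈ posCone B ν :=
  ⟨h.pos v (fun h0 => by simp [h0] at hv) (hv'.trans (le_abs_self _)), hv⟩

theorem neg_mem_posCone : -v ∈ posCone B ν ↔ v ∈ posCone B (-ν) := by
  simp [posCone, inner_neg_right, inner_neg_left]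

theorem smul_mem_posCone {a : ℝ} (ha : 0 < a) (hv : v ∈ posCone B ν) : a • v ∈ posCone B ν := by
  obtain ⟨h1, h2⟩ := hv
  refine ⟨?_, ?_⟩
  · simp only [map_smul, _root_.smul_apply, smul_eq_mul]
    positivity
  · rw [real_inner_smul_left]
    positivity

theorem disjoint_posCone (B : E →L[ℝ] E →L[ℝ] ℝ) (ν : E) :
    Disjoint (posCone B ν) (posCone B (-ν)) :=
  disjoint_left.2 fun v hv hv' => by
    have := hv'.2
    rw [inner_neg_right] at this
    linarith [hv.2]

/-- Reversed Cauchy–Schwarz: for the multiple `a > 0` that makes `v - a w` orthogonal to `ν`, the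
form of `v - a w` is nonpositive, which forces `B v w > 0`. -/
theorem IsConeForm.add_mem (h : IsConeForm B ν) (hv : v ∈ posCone B ν) (hw : w ∈ posCone B ν) :
    v + w ∈ posCone B ν := by
  obtain ⟨hv1, hv2⟩ := hv
  obtain ⟨hw1, hw2⟩ := hw
  set a := inner ℝ v ν / inner ℝ w ν with ha
  have ha0 : 0 < a := div_pos hv2 hw2
  have h1 := h.nonpos (v - a • w) (by
    rw [inner_sub_left, real_inner_smul_left, ha]; field_simp; ring)
  simp only [map_sub, map_smul, _root_.sub_apply, _root_.smul_apply,
    smul_eq_mul] at h1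
  rw [h.symm w v] at h1
  have h2 : 0 < B v w := by
    by_contra! hle
    nlinarith [mul_nonneg ha0.le (neg_nonneg.2 hle), mul_pos (mul_pos ha0 ha0) hw1]
  refine ⟨?_, by rw [inner_add_left]; linarith⟩
  simp only [map_add, _root_.add_apply]
  rw [h.symm w v]
  linarith

theorem isOpen_posCone (B : E →L[ℝ] E →L[ℝ] ℝ) (ν : E) : IsOpen (posCone B ν) :=
  (isOpen_lt continuous_const (B.continuous.clm_apply continuous_id)).inter
    (isOpen_lt (f := fun _ => (0 : ℝ)) (g := fun v => inner ℝ v ν) continuous_const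
      (continuous_id.inner continuous_const))

variable {G : ℝ → E → E} {I : Set ℝ} {η : E} {c L R : ℝ} {u u' : ℝ → E}

/-- To change halves, a path would have to cross the hyperplane orthogonal to `ν`, where the form is
nonpositive. -/
theorem IsConeForm.mem_posCone_of_continuousOn (h : IsConeForm B ν) {a b : ℝ} (hab : a ≤ b)
    {z : ℝ → E} (hz : ContinuousOn z (Icc a b)) (hpos : ∀ t ∈ Icc a b, 0 < B (z t) (z t))
    (ha : z a ∈ posCone B ν) : z b ∈ posCone B ν := by
  refine ⟨hpos b ⟨hab, le_rfl⟩, ?_⟩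
  by_contra! hle
  have hc : ContinuousOn (fun t => inner ℝ (z t) ν) (Icc a b) := hz.inner continuousOn_const
  obtain ⟨t, ht, h0⟩ := intermediate_value_Icc' hab hc ⟨hle, ha.2.le⟩
  exact absurd (h.nonpos _ h0) (not_le.2 (hpos t ht))

/-- The cone is forward invariant for differences of solutions. -/
theorem IsExpanding.mem_posCone (hG : IsExpanding B c L G I η R) (h : IsConeForm B ν) (hc : 0 < c)
    {a b : ℝ} (hab : a ≤ b) (hI : Icc a b ⊆ I) (hu : IsSol G (Icc a b) u)
    (hw : IsSol G (Icc a b) u') (huR : ∀ t ∈ Icc a b, u t ∈ Metric.ball η R)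
    (hwR : ∀ t ∈ Icc a b, u' t ∈ Metric.ball η R) (ha : u a - u' a ∈ posCone B ν) :
    u b - u' b ∈ posCone B ν :=
  h.mem_posCone_of_continuousOn hab (hu.continuousOn.sub hw.continuousOn) (fun t ht => by
    have hs : Icc a t ⊆ Icc a b := Icc_subset_Icc_right ht.2
    exact ha.1.trans_le (hG.mono h.symm hc ht.1 (hs.trans hI) (hu.mono hs) (hw.mono hs)
      (fun s hs' => huR s (hs hs')) fun s hs' => hwR s (hs hs'))) ha

end Cone

/-! ### States that depart from the reference solution -/

section SaddleProcess

variable {E : Type*} [NormedAddCommGroup E] [InnerProductSpace ℝ E]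

/-- A process `Ψ` (`Ψ t τ y` being the state at time `t` of the solution from `(τ, y)`) that after
time `T` expands a cone near `η`, and a solution `ξ` that remains near `η`. -/
structure IsSaddleProcess (H : ℝ → E → E) (Ψ : ℝ → ℝ → E → E) (ξ : ℝ → E) (η ν : E)
    (B : E →L[ℝ] E →L[ℝ] ℝ) (c L R T : ℝ) (K : NNReal) : Prop where
  lipschitz : ∀ t, LipschitzWith K (H t)
  isSol : ∀ τ y, IsSol H univ (fun t => Ψ t τ y)
  apply_self : ∀ τ y, Ψ τ τ y = y
  isSol_ref : IsSol H (Ioi T) ξ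
  ref_mem : ∀ t > T, ξ t ∈ Metric.ball η R
  isConeForm : IsConeForm B ν
  c_pos : 0 < c
  L_nonneg : 0 ≤ L
  expanding : IsExpanding B c L H (Ioi T) η R

/-- The states in a ball around `η` whose solutions depart from `ξ` in the direction of `ν`. -/
def departureSet (Ψ : ℝ → ℝ → E → E) (ξ : ℝ → E) (η ν : E) (B : E →L[ℝ] E →L[ℝ] ℝ) (R ρ T : ℝ) :
    Set (ℝ × E) :=
  {p | T < p.1 ∧ p.2 ∈ Metric.ball η ρ ∧ ∃ s ≥ 0,
    (∀ θ ∈ Icc 0 s, Ψ (p.1 + θ) p.1 p.2 ∈ Metric.ball η R) ∧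
      Ψ (p.1 + s) p.1 p.2 - ξ (p.1 + s) ∈ posCone B ν}

variable {H : ℝ → E → E} {Ψ : ℝ → ℝ → E → E} {ξ : ℝ → E} {η ν : E}
  {B : E →L[ℝ] E →L[ℝ] ℝ} {c L R T ρ ε : ℝ} {K : NNReal}

theorem IsSaddleProcess.neg (h : IsSaddleProcess H Ψ ξ η ν B c L R T K) :
    IsSaddleProcess H Ψ ξ η (-ν) B c L R T K :=
  { h with isConeForm := h.isConeForm.neg }

/-- By Grönwall, the orbits through `(τ, y)` and `(τ₀, y₀)` remain close if they are close at the
common time `τ`. -/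
theorem IsSaddleProcess.continuous (h : IsSaddleProcess H Ψ ξ η ν B c L R T K) :
    Continuous fun p : ℝ × ℝ × E => Ψ p.1 p.2.1 p.2.2 := by
  refine continuous_iff_continuousAt.2 fun ⟨σ₀, τ₀, y₀⟩ => ?_
  rw [ContinuousAt, tendsto_iff_dist_tendsto_zero]
  have hcont : Continuous fun t => Ψ t τ₀ y₀ :=
    continuousOn_univ.1 (h.isSol τ₀ y₀).continuousOn
  set a := min σ₀ τ₀ - 1
  set b := max σ₀ τ₀ + 1
  set C := (1 + (b - a)) * Real.exp (K * (b - a))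
  have hlim : Tendsto (fun p : ℝ × ℝ × E => C * dist p.2.2 (Ψ p.2.1 τ₀ y₀) +
      dist (Ψ p.1 τ₀ y₀) (Ψ σ₀ τ₀ y₀)) (𝓝 (σ₀, τ₀, y₀)) (𝓝 0) := by
    have : Continuous fun p : ℝ × ℝ × E => C * dist p.2.2 (Ψ p.2.1 τ₀ y₀) +
      dist (Ψ p.1 τ₀ y₀) (Ψ σ₀ τ₀ y₀) := by fun_prop
    convert this.tendsto (σ₀, τ₀, y₀) using 2
    simp [h.apply_self]
  refine squeeze_zero' (Eventually.of_forall fun _ => dist_nonneg) ?_ hlim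
  have h1 : ∀ᶠ p : ℝ × ℝ × E in 𝓝 (σ₀, τ₀, y₀), p.1 ∈ Icc a b :=
    continuous_fst.continuousAt.eventually (Icc_mem_nhds
      (by linarith [min_le_left σ₀ τ₀] : min σ₀ τ₀ - 1 < σ₀)
      (by linarith [le_max_left σ₀ τ₀] : σ₀ < max σ₀ τ₀ + 1))
  have h2 : ∀ᶠ p : ℝ × ℝ × E in 𝓝 (σ₀, τ₀, y₀), p.2.1 ∈ Icc a b :=
    (continuous_fst.comp continuous_snd).continuousAt.eventually (Icc_mem_nhds
      (by simp only [Function.comp]; linarith [min_le_right σ₀ τ₀])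
      (by simp only [Function.comp]; linarith [le_max_right σ₀ τ₀]))
  filter_upwards [h1, h2] with p hp1 hp2
  refine (dist_triangle _ (Ψ p.1 τ₀ y₀) _).trans (add_le_add_left ?_ _)
  exact ((h.isSol p.2.1 p.2.2).mono (subset_univ _)).dist_le
    ((h.isSol τ₀ y₀).mono (subset_univ _)) h.lipschitz dist_nonneg
    (fun t _ => by rw [dist_self]; exact dist_nonneg) hp2 (by rw [h.apply_self]) le_rfl p.1 hp1

theorem IsSaddleProcess.isOpen_departureSet (h : IsSaddleProcess H Ψ ξ η ν B c L R T K) :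
    IsOpen (departureSet Ψ ξ η ν B R ρ T) := by
  refine isOpen_iff_mem_nhds.2 fun ⟨τ, y⟩ ⟨hτ, hy, s, hs, hstay, hP⟩ => ?_
  have hc := h.continuous
  have h1 : ∀ᶠ p : ℝ × E in 𝓝 (τ, y), ∀ θ ∈ Icc 0 s, Ψ (p.1 + θ) p.1 p.2 ∈ Metric.ball η R := by
    refine isCompact_Icc.eventually_forall_of_forall_eventually fun θ hθ => ?_
    have h2 : Continuous fun q : (ℝ × E) × ℝ => Ψ (q.1.1 + q.2) q.1.1 q.1.2 :=
      hc.comp (by fun_prop : Continuous fun q : (ℝ × E) × ℝ => (q.1.1 + q.2, q.1.1, q.1.2))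
    exact h2.continuousAt.eventually (Metric.isOpen_ball.mem_nhds (hstay θ hθ))
  have h3 : ContinuousAt (fun p : ℝ × E => Ψ (p.1 + s) p.1 p.2 - ξ (p.1 + s)) (τ, y) := by
    have h4 : Continuous fun p : ℝ × E => Ψ (p.1 + s) p.1 p.2 :=
      hc.comp (by fun_prop : Continuous fun p : ℝ × E => (p.1 + s, p.1, p.2))
    have h5 : ContinuousAt ξ (τ + s) := h.isSol_ref.continuousOn.continuousAt
      (Ioi_mem_nhds (show T < τ + s by change T < τ at hτ; linarith))
    exact h4.continuousAt.sub (ContinuousAt.comp (f := fun p : ℝ × E => p.1 + s) h5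
      (by fun_prop))
  filter_upwards [continuous_fst.continuousAt.eventually (Ioi_mem_nhds hτ),
    continuous_snd.continuousAt.eventually (Metric.isOpen_ball.mem_nhds hy), h1,
    h3.eventually ((isOpen_posCone B ν).mem_nhds hP)] with p p1 p2 p3 p4
  exact ⟨p1, p2, s, hs, p3, p4⟩

theorem IsSaddleProcess.mem_departureSet (h : IsSaddleProcess H Ψ ξ η ν B c L R T K) (hρR : ρ ≤ R)
    {τ : ℝ} {y : E} (hτ : T < τ) (hy : y ∈ Metric.ball η ρ) (hP : y - ξ τ ∈ posCone B ν) :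
    (τ, y) ∈ departureSet Ψ ξ η ν B R ρ T := by
  refine ⟨hτ, hy, 0, le_rfl, fun θ hθ => ?_, ?_⟩
  · obtain rfl : θ = 0 := le_antisymm hθ.2 hθ.1
    simpa [h.apply_self] using Metric.ball_subset_ball hρR hy
  · simpa [h.apply_self] using hP

theorem IsSaddleProcess.mem_posCone (h : IsSaddleProcess H Ψ ξ η ν B c L R T K) {a b : ℝ}
    (ha : T < a) (hab : a ≤ b) {u w : ℝ → E} (hu : IsSol H (Icc a b) u) (hw : IsSol H (Icc a b) w)
    (huR : ∀ t ∈ Icc a b, u t ∈ Metric.ball η R) (hwR : ∀ t ∈ Icc a b, w t ∈ Metric.ball η R)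
    (hP : u a - w a ∈ posCone B ν) : u b - w b ∈ posCone B ν :=
  h.expanding.mem_posCone h.isConeForm h.c_pos hab (fun _ ht => ha.trans_le ht.1) hu hw huR hwR hP

theorem IsSaddleProcess.isSol_ref_Icc (h : IsSaddleProcess H Ψ ξ η ν B c L R T K) {a b : ℝ}
    (ha : T < a) : IsSol H (Icc a b) ξ :=
  h.isSol_ref.mono fun _ ht => ha.trans_le ht.1

/-- Each half cone is forward invariant while the solution is in the ball of radius `R`, so the half
entered at the earlier of two departure times still contains the difference at the later one. -/
theorem IsSaddleProcess.disjoint_departureSet (h : IsSaddleProcess H Ψ ξ η ν B c L R T K) :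
    Disjoint (departureSet Ψ ξ η ν B R ρ T) (departureSet Ψ ξ η (-ν) B R ρ T) := by
  refine disjoint_left.2 fun ⟨τ, y⟩ ⟨hτ, _, s, hs, hstay, hP⟩ ⟨_, _, s', hs', hstay', hP'⟩ => ?_
  change T < τ at hτ
  simp only at hstay hP hstay' hP'
  have hmem : ∀ s, (∀ θ ∈ Icc 0 s, Ψ (τ + θ) τ y ∈ Metric.ball η R) →
      ∀ b, ∀ t ∈ Icc (τ + b) (τ + s), 0 ≤ b → Ψ t τ y ∈ Metric.ball η R := fun s hst b t ht hb => by
    have := hst (t - τ) ⟨by linarith [ht.1], by linarith [ht.2]⟩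
    rwa [add_sub_cancel] at this
  rcases le_total s s' with hle | hle
  · have := h.mem_posCone (a := τ + s) (b := τ + s') (by linarith) (by linarith)
      ((h.isSol τ y).mono (subset_univ _)) (h.isSol_ref_Icc (by linarith))
      (fun t ht => hmem _ hstay' _ t ht hs) (fun t ht => h.ref_mem t (by linarith [ht.1])) hP
    exact disjoint_left.1 (disjoint_posCone B ν) this hP'
  · have := h.neg.mem_posCone (a := τ + s') (b := τ + s) (by linarith) (by linarith)
      ((h.isSol τ y).mono (subset_univ _)) (h.isSol_ref_Icc (by linarith))
      (fun t ht => hmem _ hstay _ t ht hs') (fun t ht => h.ref_mem t (by linarith [ht.1])) hP'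
    exact disjoint_left.1 (disjoint_posCone B ν) hP this

/-- A solution that leaves a ball which is not too small has departed from `ξ`. -/
theorem IsSaddleProcess.form_pos_of_exit (h : IsSaddleProcess H Ψ ξ η ν B c L R T K)
    (hεR : ε < R) (hρε : (1 + 2 * L / c * ‖B‖) * (2 * ρ) ^ 2 < (ε / 2) ^ 2) (hρε' : ρ ≤ ε / 2)
    (hξ : ∀ t > T, ξ t ∈ Metric.ball η ρ) {τ s : ℝ} {y : E} (hτ : T < τ)
    (hy : y ∈ Metric.ball η ρ) (hs : 0 ≤ s) (hstay : ∀ θ ∈ Ico 0 s, Ψ (τ + θ) τ y ∈ Metric.ball η ε)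
    (hexit : Ψ (τ + s) τ y ∉ Metric.ball η ε) :
    (∀ θ ∈ Icc 0 s, Ψ (τ + θ) τ y ∈ Metric.ball η R) ∧
      0 < B (Ψ (τ + s) τ y - ξ (τ + s)) (Ψ (τ + s) τ y - ξ (τ + s)) := by
  have hρ0 : 0 < ρ := Metric.pos_of_mem_ball hy
  have hs0 : 0 < s := by
    refine hs.lt_of_ne fun h0 => hexit ?_
    rw [← h0, add_zero, h.apply_self]
    exact Metric.ball_subset_ball (by linarith) hy
  have hcont : ContinuousOn (fun θ => Ψ (τ + θ) τ y) (Icc 0 s) := by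
    have : Continuous fun t => Ψ t τ y := continuousOn_univ.1 (h.isSol τ y).continuousOn
    exact (this.comp (by fun_prop : Continuous fun θ => τ + θ)).continuousOn
  have hε := norm_sub_eq_of_first_exit hs0 hcont hexit hstay
  have hR : ∀ θ ∈ Icc 0 s, Ψ (τ + θ) τ y ∈ Metric.ball η R := fun θ hθ => by
    rcases hθ.2.lt_or_eq with hlt | rfl
    · exact Metric.ball_subset_ball hεR.le (hstay θ ⟨hθ.1, hlt⟩)
    · rw [mem_ball_iff_norm]; linarith
  refine ⟨hR, ?_⟩
  -- Outside the cone at the exit, the difference would be controlled by its initial size, at most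
  -- `2 ρ`; but it is at least `ε / 2`, contrary to `hρε`.
  by_contra! hneg
  have h1 := h.expanding.norm_sq_le h.isConeForm.symm h.c_pos h.L_nonneg
    (show τ ≤ τ + s by linarith) (fun t ht => hτ.trans_le ht.1)
    ((h.isSol τ y).mono (subset_univ _)) (h.isSol_ref_Icc hτ) (fun t ht => by
      have := hR (t - τ) ⟨by linarith [ht.1], by linarith [ht.2]⟩
      rwa [add_sub_cancel] at this) (fun t ht => h.ref_mem t (hτ.trans_le ht.1)) hneg
  rw [h.apply_self] at h1
  have h2 : ‖y - ξ τ‖ ≤ 2 * ρ := by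
    have h3 := mem_ball_iff_norm.1 hy
    have h4 := mem_ball_iff_norm'.1 (hξ τ hτ)
    linarith [norm_sub_le_norm_sub_add_norm_sub y η (ξ τ)]
  have h3 : ε / 2 ≤ ‖Ψ (τ + s) τ y - ξ (τ + s)‖ := by
    have h4 := mem_ball_iff_norm.1 (hξ (τ + s) (by linarith))
    linarith [norm_sub_le_norm_sub_add_norm_sub (Ψ (τ + s) τ y) (ξ (τ + s)) η]
  have h4 : 0 ≤ 1 + 2 * L / c * ‖B‖ := by
    have := h.c_pos; have := h.L_nonneg; positivity
  have h5 := mul_le_mul_of_nonneg_left (pow_le_pow_left₀ (norm_nonneg _) h2 2) h4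
  have h6 := pow_le_pow_left₀ (by linarith : 0 ≤ ε / 2) h3 2
  linarith

end SaddleProcess

/-! ### Connectedness of the sets of departing states -/

section Sides

variable {E : Type*} [NormedAddCommGroup E] [InnerProductSpace ℝ E]
  {H : ℝ → E → E} {Ψ : ℝ → ℝ → E → E} {ξ : ℝ → E} {η ν : E}
  {B : E →L[ℝ] E →L[ℝ] ℝ} {c L R T ρ ε : ℝ} {K : NNReal}

/-- The size of the ball in which the threshold is a graph over the hyperplane `νᗮ`, relative to the
size of the ball in which solutions are observed. -/
structure IsSmallRadius (B : E →L[ℝ] E →L[ℝ] ℝ) (c L R ε ρ : ℝ) : Prop where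
  pos : 0 < ρ
  lt : ε < R
  le : ρ ≤ ε / 2
  sq_lt : (1 + 2 * L / c * ‖B‖) * (2 * ρ) ^ 2 < (ε / 2) ^ 2

theorem IsSaddleProcess.continuous_shift (h : IsSaddleProcess H Ψ ξ η ν B c L R T K) (τ : ℝ)
    (y : E) : Continuous fun θ => Ψ (τ + θ) τ y :=
  (continuousOn_univ.1 (h.isSol τ y).continuousOn).comp (by fun_prop : Continuous fun θ => τ + θ)

theorem IsSaddleProcess.exists_exit (h : IsSaddleProcess H Ψ ξ η ν B c L R T K)
    (hρ : IsSmallRadius B c L R ε ρ) {τ s : ℝ} {y : E} (hy : y ∈ Metric.ball η ρ) (hs : 0 ≤ s)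
    (hexit : Ψ (τ + s) τ y ∉ Metric.ball η ε) : ∃ s' ∈ Ioc 0 s, Ψ (τ + s') τ y ∉ Metric.ball η ε ∧
      ∀ θ ∈ Ico 0 s', Ψ (τ + θ) τ y ∈ Metric.ball η ε :=
  exists_first_exit Metric.isOpen_ball hs (h.continuous_shift τ y).continuousOn
    (by rw [add_zero, h.apply_self]
        exact Metric.ball_subset_ball (by linarith [hρ.le, hρ.pos]) hy) hexit

/-- The set of departing states is invariant under translation by vectors of the cone. -/
theorem IsSaddleProcess.departureSet_of_sub_mem (h : IsSaddleProcess H Ψ ξ η ν B c L R T K)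
    (hρ : IsSmallRadius B c L R ε ρ) (hξ : ∀ t > T, ξ t ∈ Metric.ball η ρ) {τ : ℝ} {y z : E}
    (hy : (τ, y) ∈ departureSet Ψ ξ η ν B R ρ T) (hz : z ∈ Metric.ball η ρ)
    (hzy : z - y ∈ posCone B ν) : (τ, z) ∈ departureSet Ψ ξ η ν B R ρ T := by
  obtain ⟨hτ, hy, s, hs, hstay, hP⟩ := hy
  change T < τ at hτ
  simp only at hstay hP hy
  have hmem : ∀ w b s', (∀ θ ∈ Icc 0 s', Ψ (τ + θ) τ w ∈ Metric.ball η R) → 0 ≤ b →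
      ∀ t ∈ Icc (τ + b) (τ + s'), Ψ t τ w ∈ Metric.ball η R := fun w b s' hst hb t ht => by
    have := hst (t - τ) ⟨by linarith [ht.1], by linarith [ht.2]⟩
    rwa [add_sub_cancel] at this
  have hsub : ∀ s' ∈ Icc 0 s, (∀ θ ∈ Icc 0 s', Ψ (τ + θ) τ z ∈ Metric.ball η R) →
      Ψ (τ + s') τ z - Ψ (τ + s') τ y ∈ posCone B ν := fun s' hs' hst =>
    h.mem_posCone hτ (by linarith [hs'.1]) ((h.isSol τ z).mono (subset_univ _))
      ((h.isSol τ y).mono (subset_univ _)) (by simpa using hmem z 0 s' hst le_rfl)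
      (by simpa using hmem y 0 s' (fun θ hθ => hstay θ ⟨hθ.1, hθ.2.trans hs'.2⟩) le_rfl)
      (by rwa [h.apply_self, h.apply_self])
  -- If `z` stays in the ball until `y` has departed, convexity of the half cone suffices. Otherwise
  -- `z` departs at its own exit; departing in the opposite half would drag `y` along into that
  -- half, and `y` could not return.
  by_cases hz' : ∀ θ ∈ Icc 0 s, Ψ (τ + θ) τ z ∈ Metric.ball η ε
  · have hzR : ∀ θ ∈ Icc 0 s, Ψ (τ + θ) τ z ∈ Metric.ball η R := fun θ hθ =>
      Metric.ball_subset_ball hρ.lt.le (hz' θ hθ)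
    refine ⟨hτ, hz, s, hs, hzR, ?_⟩
    have := h.isConeForm.add_mem (hsub s ⟨hs, le_rfl⟩ hzR) hP
    rwa [sub_add_sub_cancel] at this
  · push Not at hz'
    obtain ⟨s₁, hs₁, hex⟩ := hz'
    obtain ⟨s', hs', hex', hin⟩ := h.exists_exit hρ hz hs₁.1 hex
    have hs's : s' ≤ s := hs'.2.trans hs₁.2
    obtain ⟨hzR, hpos⟩ := h.form_pos_of_exit hρ.lt hρ.sq_lt hρ.le hξ hτ hz hs'.1.le hin hex'
    rcases h.isConeForm.mem_or_mem hpos with h1 | h1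
    · exact ⟨hτ, hz, s', hs'.1.le, hzR, h1⟩
    · have h2 := hsub s' ⟨hs'.1.le, hs's⟩ hzR
      rw [← neg_mem_posCone, neg_sub] at h1
      have h3 := h.isConeForm.add_mem h1 h2
      rw [sub_add_sub_cancel, ← neg_sub, neg_mem_posCone] at h3
      have h4 := h.neg.mem_posCone (a := τ + s') (b := τ + s) (by linarith [hs'.1]) (by linarith)
        ((h.isSol τ y).mono (subset_univ _)) (h.isSol_ref_Icc (by linarith [hs'.1]))
        (hmem y s' s hstay hs'.1.le) (fun t ht => h.ref_mem t (by linarith [ht.1, hs'.1])) h3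
      exact absurd h4 (disjoint_left.1 (disjoint_posCone B ν) hP)

/-- Each state is joined by a segment to the point `q` at height `ρ / 2` above `η`, and the line of
all `(t, q)` belongs to the set. From heights of at least `ρ / 4` the segment stays high. From lower
states it moves along `q - y`, which lies in the half cone. The fractions `1/16`, `1/4`, `1/2` are
compatible with the aperture `1/8` of the cone. -/
theorem IsSaddleProcess.isConnected_departureSet (h : IsSaddleProcess H Ψ ξ η ν B c L R T K)
    (hρ : IsSmallRadius B c L R ε ρ) (hξ : ∀ t > T, ξ t ∈ Metric.ball η (ρ / 16)) :
    IsConnected (departureSet Ψ ξ η ν B R ρ T) := by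
  have hρ0 := hρ.pos
  have hρR : ρ ≤ R := by linarith [hρ.le, hρ.lt]
  have hν := h.isConeForm.norm_normal
  have hξ' : ∀ t > T, ξ t ∈ Metric.ball η ρ := fun t ht =>
    Metric.ball_subset_ball (by linarith) (hξ t ht)
  have hνν : inner ℝ ν ν = (1 : ℝ) := by rw [real_inner_self_eq_norm_sq, hν]; norm_num
  have hle : ∀ v : E, |inner ℝ v ν| ≤ ‖v‖ := fun v => by
    simpa [hν] using abs_real_inner_le_norm v ν
  set q := η + (ρ / 2) • ν with hq
  have hqη : ‖q - η‖ = ρ / 2 := by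
    rw [hq, add_sub_cancel_left, norm_smul, hν, mul_one, Real.norm_of_nonneg (by linarith)]
  have hqball : q ∈ Metric.ball η ρ := by rw [mem_ball_iff_norm, hqη]; linarith
  have hqu : inner ℝ (q - η) ν = ρ / 2 := by
    rw [hq, add_sub_cancel_left, real_inner_smul_left, hνν, mul_one]
  -- states well above the hyperplane belong to the set
  have hup : ∀ τ > T, ∀ z ∈ Metric.ball η ρ, ρ / 4 ≤ inner ℝ (z - η) ν →
      (τ, z) ∈ departureSet Ψ ξ η ν B R ρ T := fun τ hτ z hz hzu => by
    refine h.mem_departureSet hρR hτ hz (h.isConeForm.mem_posCone ?_ ?_)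
    all_goals
      have h1 := mem_ball_iff_norm'.1 (hξ τ hτ)
      have h2 : inner ℝ (z - ξ τ) ν = inner ℝ (z - η) ν + inner ℝ (η - ξ τ) ν := by
        rw [← inner_add_left, sub_add_sub_cancel]
      have h3 := (abs_le.1 (hle (η - ξ τ))).1
      have h4 := norm_sub_le_norm_sub_add_norm_sub z η (ξ τ)
      have h5 := mem_ball_iff_norm.1 hz
      linarith
  have hline : ∀ τ > T, (τ, q) ∈ departureSet Ψ ξ η ν B R ρ T := fun τ hτ =>
    hup τ hτ q hqball (by rw [hqu]; linarith)
  refine ⟨⟨(T + 1, q), hline _ (by linarith)⟩,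
    isPreconnected_of_forall (T + 1, q) fun ⟨τ, y⟩ hy => ?_⟩
  have hτ : T < τ := hy.1
  have hyball : y ∈ Metric.ball η ρ := hy.2.1
  refine ⟨Prod.mk τ '' segment ℝ y q ∪ (fun t => (t, q)) '' Ioi T, ?_, ?_, ?_, ?_⟩
  · rintro _ (⟨z, hz, rfl⟩ | ⟨t, ht, rfl⟩)
    · have hzball : z ∈ Metric.ball η ρ := (convex_ball η ρ).segment_subset hyball hqball hz
      obtain ⟨a, b, ha, hb, hab, rfl⟩ := hz
      by_cases hyu : ρ / 4 ≤ inner ℝ (y - η) ν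
      · refine hup τ hτ _ hzball ?_
        have h1 : a • y + b • q - η = a • (y - η) + b • (q - η) := by
          obtain rfl : b = 1 - a := by linarith
          module
        rw [h1, inner_add_left, real_inner_smul_left, real_inner_smul_left, hqu]
        obtain rfl : b = 1 - a := by linarith
        nlinarith
      · rcases hb.eq_or_lt with rfl | hb0
        · obtain rfl : a = 1 := by linarith
          simpa using hy
        · refine h.departureSet_of_sub_mem hρ hξ' hy hzball ?_
          have h1 : a • y + b • q - y = b • (q - y) := by
            obtain rfl : a = 1 - b := by linarith
            module
          rw [h1]
          refine smul_mem_posCone hb0 (h.isConeForm.mem_posCone ?_ ?_)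
          all_goals
            have h2 : inner ℝ (q - y) ν = inner ℝ (q - η) ν - inner ℝ (y - η) ν := by
              rw [← inner_sub_left, sub_sub_sub_cancel_right]
            have h4 := norm_sub_le_norm_sub_add_norm_sub q η y
            have h5 := mem_ball_iff_norm'.1 hyball
            linarith
    · exact hline t ht
  · exact Or.inr ⟨T + 1, by simp, rfl⟩
  · exact Or.inl ⟨y, left_mem_segment ℝ y q, rfl⟩
  · refine IsPreconnected.union (τ, q) ⟨q, right_mem_segment ℝ y q, rfl⟩ ⟨τ, hτ, rfl⟩ ?_ ?_
    · exact (convex_segment y q).isPreconnected.image _ (by fun_prop)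
    · exact isPreconnected_Ioi.image _ (by fun_prop)

/-- The states in the ball that do not depart from `ξ` are those whose solutions remain near `η`. -/
theorem IsSaddleProcess.departureSet_union (h : IsSaddleProcess H Ψ ξ η ν B c L R T K)
    (hρ : IsSmallRadius B c L R ε ρ) (hξ : ∀ t > T, ξ t ∈ Metric.ball η ρ) :
    departureSet Ψ ξ η ν B R ρ T ∪ departureSet Ψ ξ η (-ν) B R ρ T =
      (Ioi T ×ˢ Metric.ball η ρ) \ {p | ∀ t ≥ p.1, Ψ t p.1 p.2 ∈ Metric.ball η ε} := by
  have hkey : ∀ ν', IsSaddleProcess H Ψ ξ η ν' B c L R T K → departureSet Ψ ξ η ν' B R ρ T ⊆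
      (Ioi T ×ˢ Metric.ball η ρ) \ {p | ∀ t ≥ p.1, Ψ t p.1 p.2 ∈ Metric.ball η ε} := by
    rintro ν' h ⟨τ, y⟩ ⟨hτ, hy, s, hs, hstay, hP⟩
    refine ⟨⟨hτ, hy⟩, fun hst => ?_⟩
    simp only [mem_ofPred_eq] at hst
    change T < τ at hτ
    refine absurd (h.expanding.nonpos_of_Ici h.isConeForm.symm h.c_pos (a := τ + s)
      (fun t ht => mem_Ioi.2 (by linarith [mem_Ici.1 ht]) : Ici (τ + s) ⊆ Ioi T)
      ((h.isSol τ y).mono (subset_univ _))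
      (h.isSol_ref.mono fun t ht => mem_Ioi.2 (by linarith [mem_Ici.1 ht]))
      (fun t ht => Metric.ball_subset_ball hρ.lt.le (hst t (by linarith [mem_Ici.1 ht])))
      (fun t ht => h.ref_mem t (by linarith [mem_Ici.1 ht]))) (not_le.2 hP.1)
  refine Subset.antisymm (union_subset (hkey ν h) (hkey (-ν) h.neg)) ?_
  rintro ⟨τ, y⟩ ⟨⟨hτ, hy⟩, hst⟩
  simp only [mem_ofPred_eq, not_forall] at hst
  obtain ⟨t, ht, hex⟩ := hst
  change T < τ at hτ
  obtain ⟨s, hs, hex', hin⟩ := h.exists_exit hρ (s := t - τ) hy (by linarith)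
    (by rwa [add_sub_cancel])
  obtain ⟨hzR, hpos⟩ := h.form_pos_of_exit hρ.lt hρ.sq_lt hρ.le hξ hτ hy hs.1.le hin hex'
  rcases h.isConeForm.mem_or_mem hpos with h1 | h1
  · exact Or.inl ⟨hτ, hy, s, hs.1.le, hzR, h1⟩
  · exact Or.inr ⟨hτ, hy, s, hs.1.le, hzR, h1⟩

end Sides

/-! ### Identification of the sides of the threshold -/

section Threshold

variable {n d : ℕ}
  {f : EuclideanSpace ℝ (Fin n) → EuclideanSpace ℝ (Fin d) → EuclideanSpace ℝ (Fin n)}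
  {Λ : ℝ → EuclideanSpace ℝ (Fin d)} {lam : EuclideanSpace ℝ (Fin d)} {J : ℝ → Set ℝ}
  {x : ℝ → ℝ → EuclideanSpace ℝ (Fin n)} {η ν : EuclideanSpace ℝ (Fin n)} {rc : ℝ}
  {B : EuclideanSpace ℝ (Fin n) →L[ℝ] EuclideanSpace ℝ (Fin n) →L[ℝ] ℝ} {c L δ R : ℝ}

theorem IsTippingSetting.isConeForm (S : IsTippingSetting f Λ lam J x η rc ν B c L δ R) :
    IsConeForm B ν :=
  ⟨S.norm_normal, S.symm, S.nonpos, S.pos⟩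

/-- The two sides of the threshold contain the two halves of the cone around the solution `x rc`. -/
structure AreConeSides (Θ : ℝ → Set (EuclideanSpace ℝ (Fin n))) (ξ : ℝ → EuclideanSpace ℝ (Fin n))
    (η ν : EuclideanSpace ℝ (Fin n))
    (B : EuclideanSpace ℝ (Fin n) →L[ℝ] EuclideanSpace ℝ (Fin n) →L[ℝ] ℝ) (ρ T : ℝ)
    (S₁ S₂ : Set (ℝ × EuclideanSpace ℝ (Fin n))) : Prop where
  areSides : AreSides Θ η ρ T S₁ S₂
  mem_left : ∀ τ > T, ∀ y ∈ Metric.ball η ρ, y - ξ τ ∈ posCone B ν → (τ, y) ∈ S₁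
  mem_right : ∀ τ > T, ∀ y ∈ Metric.ball η ρ, y - ξ τ ∈ posCone B (-ν) → (τ, y) ∈ S₂

theorem AreConeSides.swap {Θ : ℝ → Set (EuclideanSpace ℝ (Fin n))}
    {ξ : ℝ → EuclideanSpace ℝ (Fin n)} {ρ T : ℝ} {S₁ S₂ : Set (ℝ × EuclideanSpace ℝ (Fin n))}
    (h : AreConeSides Θ ξ η ν B ρ T S₁ S₂) : AreConeSides Θ ξ η (-ν) B ρ T S₂ S₁ where
  areSides := ⟨h.areSides.isOpen_right, h.areSides.isOpen_left, h.areSides.isConnected_right,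
    h.areSides.isConnected_left, h.areSides.disjoint.symm, by
      rw [union_comm, h.areSides.union_eq]⟩
  mem_left := h.mem_right
  mem_right := by rw [neg_neg]; exact h.mem_left

/-- Anchoring says that near `η` the threshold consists of the states whose solutions stay in the
ball of radius `ε`; these are precisely the states that do not depart. A cut-off turns the equation
into a global process. -/
theorem IsTippingSetting.exists_areConeSides
    (S : IsTippingSetting f Λ lam J x η rc ν B c L δ R) {τ₀ : ℝ}
    {Θ : ℝ → Set (EuclideanSpace ℝ (Fin n))}
    (hΘ : IsRegularRTippingThreshold (rateField f Λ rc) η τ₀ Θ) :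
    ∃ ρ₁ > 0, ρ₁ ≤ R ∧ ∀ ρ ∈ Ioo 0 ρ₁, ∃ T₁, ∀ T ≥ T₁, ∃ S₁ S₂,
      AreConeSides Θ (x rc) η ν B ρ T S₁ S₂ := by
  have hrc := S.rc_pos
  have hR := S.R_pos
  obtain ⟨ε₀, hε₀, hanch⟩ := hΘ.anchored
  set ε := min ε₀ R / 2 with hε
  have hε0 : 0 < ε := half_pos (lt_min hε₀ hR)
  have hεε₀ : ε < ε₀ := by linarith [min_le_left ε₀ R]
  have hεR : ε < R := by linarith [min_le_right ε₀ R]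
  obtain ⟨κ, hκ, Tκ, hTκ, hΘκ⟩ := hanch ε ⟨hε0, hεε₀⟩
  set C := 1 + 2 * (rc⁻¹ * L) / (rc⁻¹ * c) * ‖B‖ with hC
  have hc0 : 0 < rc⁻¹ * c := mul_pos (inv_pos.2 hrc) S.c_pos
  have hL0 : 0 ≤ rc⁻¹ * L := mul_nonneg (inv_pos.2 hrc).le S.L_nonneg
  have hC1 : 1 ≤ C := by
    have : 0 ≤ 2 * (rc⁻¹ * L) / (rc⁻¹ * c) * ‖B‖ := by positivity
    linarith
  obtain ⟨fc, Lc, M, hfc⟩ := exists_isCutoff S.contDiff (‖η‖ + R + ‖lam‖ + 1)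
  choose Φ hΦ hΦ0 using hfc.exists_isSol S.continuous rc
  -- With `C ≥ 1`, the bound `4 C ρ < ε` gives `C (2 ρ)² < (ε / 2)²`, as required for exits to lie
  -- in the cone.
  refine ⟨min κ (ε / (4 * C)), lt_min hκ (by positivity), (min_le_right _ _).trans
    ((div_le_self hε0.le (by linarith)).trans hεR.le), fun ρ ⟨hρ0, hρ⟩ => ?_⟩
  have hρκ : ρ < κ := hρ.trans_le (min_le_left _ _)
  have hρC : ρ * (4 * C) < ε := (lt_div_iff₀ (by positivity)).1 (hρ.trans_le (min_le_right _ _))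
  have hsmall : IsSmallRadius B (rc⁻¹ * c) (rc⁻¹ * L) R ε ρ := by
    refine ⟨hρ0, hεR, by nlinarith, ?_⟩
    rw [← hC]
    have h1 : (ρ * (4 * C)) ^ 2 < ε ^ 2 := pow_lt_pow_left₀ hρC (by positivity) two_ne_zero
    have h2 : C * ρ ^ 2 ≤ C ^ 2 * ρ ^ 2 := by
      have : C ≤ C ^ 2 := by nlinarith
      gcongr
    nlinarith
  obtain ⟨a₀, ha₀, -⟩ := S.continuity
  have hev : ∀ᶠ τ in atTop, τ ∈ J rc ∧ Λ τ ∈ Metric.ball lam δ ∧ ‖Λ τ‖ ≤ ‖η‖ + R + ‖lam‖ + 1 ∧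
      x rc τ ∈ Metric.ball η (ρ / 16) := by
    filter_upwards [eventually_ge_atTop a₀, S.lim.eventually (Metric.ball_mem_nhds _ S.δ_pos),
      S.lim.norm.eventually (gt_mem_nhds (lt_add_one ‖lam‖)),
      S.tendsto.eventually (Metric.ball_mem_nhds _ (by positivity : 0 < ρ / 16))] with τ h1 h2 h3 h4
    exact ⟨ha₀ h1, h2, by linarith [norm_nonneg η], h4⟩
  obtain ⟨T₁, hT₁⟩ := eventually_atTop.1 hev
  refine ⟨max T₁ Tκ, fun T hT => ?_⟩
  have hT₁' : ∀ τ > T, τ ∈ J rc ∧ Λ τ ∈ Metric.ball lam δ ∧ ‖Λ τ‖ ≤ ‖η‖ + R + ‖lam‖ + 1 ∧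
      x rc τ ∈ Metric.ball η (ρ / 16) := fun τ hτ =>
    hT₁ τ ((le_max_left _ _).trans (hT.trans hτ.le))
  have heq : ∀ τ > T, ∀ y ∈ Metric.ball η R, rateField fc Λ rc τ y = rateField f Λ rc τ y :=
    fun τ hτ y hy => by
      refine hfc.rateField_eq ?_ (hT₁' τ hτ).2.2.1
      have h1 := mem_ball_iff_norm'.1 hy
      have h2 := norm_le_norm_add_norm_sub η y
      linarith [norm_nonneg lam]
  have hξ : ∀ τ > T, x rc τ ∈ Metric.ball η (ρ / 16) := fun τ hτ => (hT₁' τ hτ).2.2.2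
  have hξR : ∀ τ > T, x rc τ ∈ Metric.ball η R := fun τ hτ =>
    Metric.ball_subset_ball (by linarith [hsmall.le]) (hξ τ hτ)
  have hexp := S.expanding.isExpanding (Λ := Λ) hrc
  have hproc : IsSaddleProcess (rateField fc Λ rc) (fun t τ y => Φ τ y t) (x rc) η ν B (rc⁻¹ * c)
      (rc⁻¹ * L) R T (‖rc⁻¹‖₊ * Lc) :=
    { lipschitz := hfc.lipschitzWith_rateField le_rfl
      isSol := hΦ
      apply_self := hΦ0
      isSol_ref := ((S.maximal rc hrc).isSol.mono fun τ hτ => (hT₁' τ hτ).1).congr_field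
        fun τ hτ => (heq τ hτ _ (hξR τ hτ)).symm
      ref_mem := hξR
      isConeForm := S.isConeForm
      c_pos := hc0
      L_nonneg := hL0
      expanding := fun τ hτ y hy z hz => by
        rw [heq τ hτ y hy, heq τ hτ z hz]
        exact hexp τ (hT₁' τ hτ).2.1 y hy z hz }
  have hξρ : ∀ τ > T, x rc τ ∈ Metric.ball η ρ := fun τ hτ =>
    Metric.ball_subset_ball (by linarith) (hξ τ hτ)
  have hρR : ρ ≤ R := by linarith [hsmall.le]
  refine ⟨departureSet (fun t τ y => Φ τ y t) (x rc) η ν B R ρ T,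
    departureSet (fun t τ y => Φ τ y t) (x rc) η (-ν) B R ρ T,
    ⟨hproc.isOpen_departureSet, hproc.neg.isOpen_departureSet,
      hproc.isConnected_departureSet hsmall hξ, hproc.neg.isConnected_departureSet hsmall hξ,
      hproc.disjoint_departureSet, ?_⟩,
    fun τ hτ y hy h => hproc.mem_departureSet hρR hτ hy h,
    fun τ hτ y hy h => hproc.neg.mem_departureSet hρR hτ hy h⟩
  rw [hproc.departureSet_union hsmall hξρ]
  ext ⟨τ, y⟩
  refine and_congr_right fun ⟨hτ, hy⟩ => not_congr ?_
  change T < τ at hτ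
  change (∀ t ≥ τ, Φ τ y t ∈ Metric.ball η ε) ↔ y ∈ Θ τ
  rw [hΘκ τ (((le_max_right _ _).trans hT).trans_lt hτ) y (Metric.ball_subset_ball hρκ.le hy)]
  constructor
  · exact fun h => ⟨Φ τ y, ((hΦ τ y).mono (subset_univ _)).congr_field fun t ht =>
      heq t (hτ.trans_le ht) _ (Metric.ball_subset_ball hεR.le (h t ht)), hΦ0 τ y, h⟩
  · rintro ⟨u, hu, hu0, h⟩ t ht
    have h1 : IsSol (rateField fc Λ rc) (Ici τ) u := hu.congr_field fun t ht =>
      (heq t (hτ.trans_le ht) _ (Metric.ball_subset_ball hεR.le (h t ht))).symm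
    have h2 := ((hΦ τ y).mono (subset_univ (Ici τ))).eqOn_of_lipschitz h1
      (hfc.lipschitzWith_rateField le_rfl) ordConnected_Ici self_mem_Ici (by rw [hΦ0, hu0])
    rw [h2 ht]
    exact h t ht

end Threshold

/-! ### Backward solutions in the edge tails -/

section TailSolution

variable {n d : ℕ}
  {f : EuclideanSpace ℝ (Fin n) → EuclideanSpace ℝ (Fin d) → EuclideanSpace ℝ (Fin n)}
  {Λ : ℝ → EuclideanSpace ℝ (Fin d)} {lam : EuclideanSpace ℝ (Fin d)} {J : ℝ → Set ℝ}
  {x : ℝ → ℝ → EuclideanSpace ℝ (Fin n)} {η ν : EuclideanSpace ℝ (Fin n)} {rc : ℝ}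
  {B : EuclideanSpace ℝ (Fin n) →L[ℝ] EuclideanSpace ℝ (Fin n) →L[ℝ] ℝ} {c L δ R ρ T : ℝ}
  {v : ℝ → EuclideanSpace ℝ (Fin n)}

/-- Limit points of exit points are end points of backward solutions near `η`. -/
theorem IsTippingSetting.exists_backward_tail (S : IsTippingSetting f Λ lam J x η rc ν B c L δ R)
    {l : Filter ℝ} [l.IsCountablyGenerated] [l.NeBot] (hl : l ≤ 𝓝[≠] rc) (hρ : 0 < ρ)
    (hρR : ρ < R) : ∃ v, IsSol (rateField f (fun _ => lam) rc) (Iic 0) v ∧ ‖v 0 - η‖ = ρ ∧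
      (∀ t ∈ Iic (0 : ℝ), v t ∈ Metric.closedBall η ρ) ∧ IsTailPoint J x l (v 0) := by
  obtain ⟨T, hT⟩ := S.exists_exit_limit hl hρ hρR
  obtain ⟨rk, hrk⟩ := exists_seq_tendsto l
  obtain ⟨ψ, tk, p, hψ, htk, hp, hpρ, hexit⟩ := hT T le_rfl rk hrk
  have hrψ : Tendsto (fun k => rk (ψ k)) atTop l := hrk.comp hψ.tendsto_atTop
  have hrc1 : Tendsto (fun k => rk (ψ k)) atTop (𝓝 rc) :=
    hrψ.mono_right (hl.trans nhdsWithin_le_nhds)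
  have htail : IsTailPoint J x l p := isTailPoint_of_tendsto hrψ htk
    (Eventually.of_forall fun k => (hexit k).2.1 ⟨(hexit k).1.le, le_rfl⟩) hp
  obtain ⟨v, hv, hv0, hvK⟩ := exists_limit_solution S.contDiff S.lim S.rc_pos hrc1 htk hp
    (isCompact_closedBall η ρ) (J := Iic 0) (fun s hs => by
      filter_upwards [htk.eventually (eventually_ge_atTop (T - s)),
        hrc1.eventually (lt_mem_nhds S.rc_pos)] with k hk hk0
      have hsub : uIcc (tk k) (tk k + s) ⊆ Icc T (tk k) := by
        rw [uIcc_of_ge (by linarith [mem_Iic.1 hs])]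
        exact Icc_subset_Icc_left (by linarith)
      refine ⟨(S.maximal _ hk0).isSol.mono (hsub.trans (hexit k).2.1), fun t ht => ?_⟩
      rcases (hsub ht).2.lt_or_eq with hlt | rfl
      · exact Metric.ball_subset_closedBall ((hexit k).2.2.2 t ⟨(hsub ht).1, hlt⟩)
      · have hcont := (S.maximal _ hk0).isSol.continuousOn.mono (hexit k).2.1
        exact mem_closedBall_iff_norm.2 (norm_sub_eq_of_first_exit (hexit k).1 hcont
          (hexit k).2.2.1 (hexit k).2.2.2).le)
  exact ⟨v, hv, by rw [hv0, hpρ], hvK, by rwa [hv0]⟩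

/-- A backward solution near `η` lies in the cone. -/
theorem IsTippingSetting.form_pos (S : IsTippingSetting f Λ lam J x η rc ν B c L δ R) {b : ℝ}
    (hv : IsSol (rateField f (fun _ => lam) rc) (Iic b) v)
    (hvR : ∀ t ∈ Iic b, v t ∈ Metric.ball η R) (hne : v b ≠ η) :
    0 < B (v b - η) (v b - η) :=
  (S.expanding.isExpanding_limit S.δ_pos S.rc_pos).pos_of_Iic S.symm
    (mul_pos (inv_pos.2 S.rc_pos) S.c_pos) (subset_univ _) hv (isSol_const_limit S.eq_zero _) hvR
    (fun _ _ => Metric.mem_ball_self S.R_pos) hne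

theorem IsTippingSetting.ne_of_ne (S : IsTippingSetting f Λ lam J x η rc ν B c L δ R) {I : Set ℝ}
    (hI : I.OrdConnected) (hv : IsSol (rateField f (fun _ => lam) rc) I v) {a b : ℝ} (ha : a ∈ I)
    (hb : b ∈ I) (hne : v b ≠ η) : v a ≠ η := fun h =>
  hne (hv.eqOn_rateField S.contDiff continuous_const (isSol_const_limit S.eq_zero I) hI ha h hb)

theorem IsTippingSetting.mem_posCone_of_le (S : IsTippingSetting f Λ lam J x η rc ν B c L δ R)
    {a b : ℝ} (hab : a ≤ b) (hv : IsSol (rateField f (fun _ => lam) rc) (Icc a b) v)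
    (hvR : ∀ t ∈ Icc a b, v t ∈ Metric.ball η R) (ha : v a - η ∈ posCone B ν) :
    v b - η ∈ posCone B ν :=
  (S.expanding.isExpanding_limit S.δ_pos S.rc_pos).mem_posCone S.isConeForm
    (mul_pos (inv_pos.2 S.rc_pos) S.c_pos) hab (subset_univ _) hv (isSol_const_limit S.eq_zero _)
    hvR (fun _ _ => Metric.mem_ball_self S.R_pos) ha

theorem IsTippingSetting.neg (S : IsTippingSetting f Λ lam J x η rc ν B c L δ R) :
    IsTippingSetting f Λ lam J x η rc (-ν) B c L δ R :=
  { S with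
    norm_normal := S.isConeForm.neg.norm_normal
    nonpos := S.isConeForm.neg.nonpos
    pos := S.isConeForm.neg.pos }

/-- A backward solution near `η` remains in one half of the cone. -/
theorem IsTippingSetting.mem_posCone_backward
    (S : IsTippingSetting f Λ lam J x η rc ν B c L δ R) {b : ℝ}
    (hv : IsSol (rateField f (fun _ => lam) rc) (Iic b) v)
    (hvR : ∀ t ∈ Iic b, v t ∈ Metric.ball η R) (hb : v b - η ∈ posCone B ν) :
    ∀ t ≤ b, v t - η ∈ posCone B ν := fun t ht => by
  have hne : v b ≠ η := fun h => by simp [h, posCone] at hb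
  have hpos := S.form_pos (hv.mono (Iic_subset_Iic.2 ht))
    (fun s hs => hvR s ((mem_Iic.1 hs).trans ht))
    (S.ne_of_ne ordConnected_Iic hv (mem_Iic.2 ht) self_mem_Iic hne)
  refine (S.isConeForm.mem_or_mem hpos).resolve_right fun h => ?_
  exact disjoint_left.1 (disjoint_posCone B ν) hb
    (S.neg.mem_posCone_of_le ht (hv.mono Icc_subset_Iic_self) (fun s hs => hvR s hs.2) h)

/-- A backward solution near `η` enters the ball through its end point. -/
theorem IsTippingSetting.exists_norm_lt (S : IsTippingSetting f Λ lam J x η rc ν B c L δ R)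
    (hv : IsSol (rateField f (fun _ => lam) rc) (Iic 0) v)
    (hvR : ∀ t ∈ Iic (0 : ℝ), v t ∈ Metric.ball η R) (hne : v 0 ≠ η) (hρ : 0 < ρ) :
    ∃ t ≤ 0, ‖v t - η‖ < ρ := by
  by_contra! hge
  set c' := rc⁻¹ * c
  have hc' : 0 < c' := mul_pos (inv_pos.2 S.rc_pos) S.c_pos
  set V := B (v 0 - η) (v 0 - η)
  have hV : 0 < V := S.form_pos hv hvR hne
  -- Staying at distance at least `ρ` from `η` since time `a` would make the form gain all of `V`,
  -- so that it could not be positive at `a`.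
  set a := -(V / (c' * ρ ^ 2)) with ha
  have ha0 : a ≤ 0 := by rw [ha]; exact neg_nonpos.2 (by positivity)
  have hne' := S.ne_of_ne ordConnected_Iic hv (mem_Iic.2 ha0) self_mem_Iic hne
  have h1 := S.form_pos (hv.mono (Iic_subset_Iic.2 ha0))
    (fun s hs => hvR s ((mem_Iic.1 hs).trans ha0)) hne'
  have h2 := (S.expanding.isExpanding_limit S.δ_pos S.rc_pos).add_le S.symm hc' (m := ρ ^ 2) ha0
    (subset_univ _) (hv.mono Icc_subset_Iic_self) (isSol_const_limit S.eq_zero _)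
    (fun t ht => hvR t ht.2) (fun _ _ => Metric.mem_ball_self S.R_pos)
    fun t ht => pow_le_pow_left₀ hρ.le (hge t ht.2) 2
  have h3 : c' * ρ ^ 2 * (0 - a) = V := by rw [ha]; field_simp; ring
  change _ + c' * ρ ^ 2 * (0 - a) ≤ V at h2
  linarith

/-- A backward solution in the cone can be continued until it leaves a larger ball. -/
theorem IsTippingSetting.exists_extension (S : IsTippingSetting f Λ lam J x η rc ν B c L δ R)
    (hρR : ρ < R) (hv : IsSol (rateField f (fun _ => lam) rc) (Iic 0) v)
    (hvR : ∀ t ∈ Iic (0 : ℝ), v t ∈ Metric.closedBall η ρ) (hP : v 0 - η ∈ posCone B ν) :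
    ∃ w, ∃ b > 0, EqOn w v (Iic 0) ∧ IsSol (rateField f (fun _ => lam) rc) (Iic b) w ∧
      (∀ t ∈ Iic b, w t ∈ Metric.ball η R ∧ w t - η ∈ posCone B ν) ∧ ρ < ‖w b - η‖ := by
  obtain ⟨fc, Lc, M, hfc⟩ := exists_isCutoff S.contDiff (‖η‖ + R + ‖lam‖)
  obtain ⟨w, hw, hw0⟩ := hfc.exists_isSol (Λ := fun _ => lam) continuous_const rc 0 (v 0)
  have heq : ∀ τ, ∀ y ∈ Metric.ball η R,
      rateField fc (fun _ => lam) rc τ y = rateField f (fun _ => lam) rc τ y := fun τ y hy => by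
    refine hfc.rateField_eq ?_ (by linarith [norm_nonneg η, S.R_pos])
    have h1 := mem_ball_iff_norm'.1 hy
    have h2 := norm_le_norm_add_norm_sub η y
    linarith [norm_nonneg lam]
  have hsub : Metric.closedBall η ρ ⊆ Metric.ball η R := Metric.closedBall_subset_ball hρR
  have hwv : EqOn w v (Iic 0) := (hw.mono (subset_univ _)).eqOn_of_lipschitz
    (hv.congr_field fun t ht => (heq t _ (hsub (hvR t ht))).symm)
    (hfc.lipschitzWith_rateField le_rfl) ordConnected_Iic self_mem_Iic hw0
  -- Being in the cone at time `0`, the solution cannot stay near `η`; it is followed up to a sphere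
  -- strictly between radii `ρ` and `R`, so as to cross the sphere of radius `ρ` on the way.
  set ρ' := (ρ + R) / 2 with hρ'
  have hρρ' : ρ < ρ' := by linarith
  have hρ'R : ρ' < R := by linarith
  have h0 : w 0 ∈ Metric.ball η ρ' := by
    rw [hw0]
    exact Metric.closedBall_subset_ball hρρ' (hvR 0 self_mem_Iic)
  obtain ⟨b₀, hb₀, hexit⟩ : ∃ b₀ ≥ 0, w b₀ ∉ Metric.ball η ρ' := by
    by_contra! hstay
    have hstay' : ∀ t ∈ Ici (0 : ℝ), w t ∈ Metric.ball η R := fun t ht =>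
      Metric.ball_subset_ball hρ'R.le (hstay t ht)
    refine absurd ((S.expanding.isExpanding_limit S.δ_pos S.rc_pos).nonpos_of_Ici S.symm
      (mul_pos (inv_pos.2 S.rc_pos) S.c_pos) (subset_univ (Ici 0))
      ((hw.mono (subset_univ _)).congr_field fun t ht => heq t _ (hstay' t ht))
      (isSol_const_limit S.eq_zero _) hstay' fun _ _ => Metric.mem_ball_self S.R_pos) ?_
    rw [hw0]
    exact not_le.2 hP.1
  obtain ⟨b, hb, hbe, hin⟩ := exists_first_exit Metric.isOpen_ball hb₀
    (hw.continuousOn.mono (subset_univ _)) h0 hexit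
  have hbρ := norm_sub_eq_of_first_exit hb.1 (hw.continuousOn.mono (subset_univ _)) hbe hin
  have hwR : ∀ t ∈ Iic b, w t ∈ Metric.ball η R := fun t ht => by
    rcases le_total t 0 with h | h
    · rw [hwv (mem_Iic.2 h)]
      exact hsub (hvR t h)
    · rcases (mem_Iic.1 ht).lt_or_eq with h' | rfl
      · exact Metric.ball_subset_ball hρ'R.le (hin t ⟨h, h'⟩)
      · rw [mem_ball_iff_norm, hbρ]; exact hρ'R
  have hwf : IsSol (rateField f (fun _ => lam) rc) (Iic b) w :=
    (hw.mono (subset_univ _)).congr_field fun t ht => heq t _ (hwR t ht)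
  refine ⟨w, b, hb.1, hwv, hwf, fun t ht => ⟨hwR t ht, ?_⟩, by rw [hbρ]; exact hρρ'⟩
  refine S.mem_posCone_backward hwf hwR ?_ t ht
  exact S.mem_posCone_of_le hb.1.le (hwf.mono Icc_subset_Iic_self) (fun t ht => hwR t ht.2)
    (by rwa [hw0])

/-- If an edge tail contains the end point of a backward solution near `η` in one half of the cone,
then some solutions leave the ball on the corresponding side. -/
theorem IsTippingSetting.inter_nonempty (S : IsTippingSetting f Λ lam J x η rc ν B c L δ R)
    (hρR : ρ < R) (hv : IsSol (rateField f (fun _ => lam) rc) (Iic 0) v) (hv0 : ‖v 0 - η‖ = ρ)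
    (hvR : ∀ t ∈ Iic (0 : ℝ), v t ∈ Metric.closedBall η ρ) (hP : v 0 - η ∈ posCone B ν)
    {l : Filter ℝ} (hl : l ≤ 𝓝 rc) (htail : IsTailPoint J x l (v 0))
    {Θ : ℝ → Set (EuclideanSpace ℝ (Fin n))} {S₁ S₂ S' : Set (ℝ × EuclideanSpace ℝ (Fin n))}
    (hS : AreConeSides Θ (x rc) η ν B ρ T S₁ S₂)
    (hleave : ∀ᶠ r in l, ∀ t, IsExitTime (J r) (x r) (Metric.ball η ρ) T t →
      ∀ᶠ σ in 𝓝[<] t, (σ, x r σ) ∈ S') : (S₁ ∩ S').Nonempty := by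
  have hne : v 0 ≠ η := fun h => by simp [h, posCone] at hP
  have hρ : 0 < ρ := by rw [← hv0]; exact norm_pos_iff.2 (sub_ne_zero.2 hne)
  obtain ⟨a, ha, hav⟩ := S.exists_norm_lt hv
    (fun t ht => Metric.closedBall_subset_ball hρR (hvR t ht)) hne hρ
  obtain ⟨w, b, hb, hwv, hw, hwP, hbρ⟩ := S.exists_extension hρR hv hvR hP
  have hw' : IsSol (rateField f (fun _ => lam) rc) (Icc a b) w := hw.mono Icc_subset_Iic_self
  have hK : IsCompact ((fun t => w t - η) '' Icc a b) :=
    isCompact_Icc.image_of_continuousOn (hw'.continuousOn.sub continuousOn_const)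
  obtain ⟨e, he, hthick⟩ := hK.exists_thickening_subset_open (isOpen_posCone B ν) (by
    rintro _ ⟨t, ht, rfl⟩
    exact (hwP t ht.2).2)
  rw [← hwv (mem_Iic.2 ha)] at hav
  -- With this accuracy a shadowing solution is inside the ball at `a` and outside it at `b`. Half
  -- of `e` is left for the distance from `x rc` to `η`, so that the difference from `x rc` remains
  -- in the half cone at the exit in between.
  set e' := min (e / 2) (min (ρ - ‖w a - η‖) (‖w b - η‖ - ρ)) with he'
  have he'0 : 0 < e' := lt_min (half_pos he) (lt_min (by linarith) (by linarith))
  have he'1 : e' ≤ e / 2 := min_le_left _ _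
  have he'2 : e' ≤ ρ - ‖w a - η‖ := (min_le_right _ _).trans (min_le_left _ _)
  have he'3 : e' ≤ ‖w b - η‖ - ρ := (min_le_right _ _).trans (min_le_right _ _)
  obtain ⟨ε', hε', T₂, hT₂⟩ := S.shadow hw' (s₀ := 0) ⟨ha, hb.le⟩ he'0
  obtain ⟨T₃, hT₃⟩ := eventually_atTop.1 ((Metric.tendsto_nhds.1 S.tendsto) (e / 2) (half_pos he))
  obtain ⟨r, ⟨τ, hτ, hTτ, hd⟩, h1, h2, hr⟩ := ((htail (max T₂ (max T T₃ - a)) ε' hε').and_eventually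
    ((hT₂.filter_mono hl).and (hleave.and
      ((lt_mem_nhds S.rc_pos : ∀ᶠ r in 𝓝 rc, 0 < r).filter_mono hl)))).exists
  have hTT : max T T₃ < τ + a := by linarith [(le_max_right T₂ (max T T₃ - a)).trans_lt hTτ]
  have hmax := S.maximal r hr
  have hsh : ∀ s ∈ Icc a b, τ + s ∈ J r ∧ dist (w s) (x r (τ + s)) < e' := by
    simpa using h1 τ hτ ((le_max_left _ _).trans hTτ.le) (by rwa [hwv self_mem_Iic])
  have hab : a ≤ b := ha.trans hb.le
  have hsubJ : Icc (τ + a) (τ + b) ⊆ J r :=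
    hmax.ordConnected.out (hsh a ⟨le_rfl, hab⟩).1 (hsh b ⟨hab, le_rfl⟩).1
  obtain ⟨t, ht, hout, hin⟩ := exists_first_exit (B := Metric.ball η ρ) Metric.isOpen_ball
    (show τ + a ≤ τ + b by linarith) (hmax.isSol.continuousOn.mono hsubJ)
    (by
      have h3 := (hsh a ⟨le_rfl, hab⟩).2
      rw [dist_eq_norm'] at h3
      rw [mem_ball_iff_norm]
      linarith [norm_sub_le_norm_sub_add_norm_sub (x r (τ + a)) (w a) η])
    (by
      have h3 := (hsh b ⟨hab, le_rfl⟩).2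
      rw [dist_eq_norm] at h3
      rw [mem_ball_iff_norm, not_lt]
      linarith [norm_sub_le_norm_sub_add_norm_sub (w b) (x r (τ + b)) η])
  have hmem : ∀ᶠ σ in 𝓝[<] t, σ ∈ Ico (τ + a) t :=
    Ico_mem_nhdsLT ht.1
  have hTt : T < t := ((le_max_left T T₃).trans_lt hTT).trans ht.1
  have hexit : IsExitTime (J r) (x r) (Metric.ball η ρ) T t :=
    ⟨hsubJ ⟨ht.1.le, ht.2⟩, hTt, hout, hmem.mono hin⟩
  obtain ⟨σ, hσ, hσS⟩ := (hmem.and (h2 t hexit)).exists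
  refine ⟨(σ, x r σ), hS.mem_left σ ?_ _ (hin σ hσ) (hthick ?_), hσS⟩
  · exact ((le_max_left T T₃).trans_lt hTT).trans_le hσ.1
  · have hs : σ - τ ∈ Icc a b := ⟨by linarith [hσ.1], by linarith [hσ.2, ht.2]⟩
    have h3 := (hsh _ hs).2
    have h4 := hT₃ σ ((le_max_right T T₃).trans (hTT.le.trans hσ.1))
    rw [add_sub_cancel, dist_eq_norm'] at h3
    rw [dist_eq_norm'] at h4
    refine Metric.mem_thickening_iff.2 ⟨_, ⟨_, hs, rfl⟩, ?_⟩
    rw [dist_eq_norm, show x r σ - x rc σ - (w (σ - τ) - η) =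
      (x r σ - w (σ - τ)) + (η - x rc σ) by abel]
    linarith [norm_add_le (x r σ - w (σ - τ)) (η - x rc σ)]

end TailSolution

/-! ### Unstable branches and the side on which a connection departs -/

section Connection

variable {n d : ℕ}
  {f : EuclideanSpace ℝ (Fin n) → EuclideanSpace ℝ (Fin d) → EuclideanSpace ℝ (Fin n)}
  {Λ : ℝ → EuclideanSpace ℝ (Fin d)} {lam : EuclideanSpace ℝ (Fin d)} {J : ℝ → Set ℝ}
  {x : ℝ → ℝ → EuclideanSpace ℝ (Fin n)} {η ν : EuclideanSpace ℝ (Fin n)} {rc : ℝ}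
  {B : EuclideanSpace ℝ (Fin n) →L[ℝ] EuclideanSpace ℝ (Fin n) →L[ℝ] ℝ} {c L δ R : ℝ}
  {A : Set (EuclideanSpace ℝ (Fin n))} {ψ ψ' φ : ℝ → EuclideanSpace ℝ (Fin n)} {l : Filter ℝ}

/-- Until time `s`, the solution `ψ` is near `η` in one half of the cone. -/
def DepartsAlong (ψ : ℝ → EuclideanSpace ℝ (Fin n)) (η ν : EuclideanSpace ℝ (Fin n))
    (B : EuclideanSpace ℝ (Fin n) →L[ℝ] EuclideanSpace ℝ (Fin n) →L[ℝ] ℝ) (R s : ℝ) : Prop :=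
  ∀ t ≤ s, ψ t ∈ Metric.ball η R ∧ ψ t - η ∈ posCone B ν

theorem IsTippingSetting.exists_departsAlong (S : IsTippingSetting f Λ lam J x η rc ν B c L δ R)
    (hψ : IsSol (rateField f (fun _ => lam) rc) univ ψ) (hb : Tendsto ψ atBot (𝓝 η)) {t₀ : ℝ}
    (hne : ψ t₀ ≠ η) :
    ∃ s, DepartsAlong ψ η ν B R s ∨ DepartsAlong ψ η (-ν) B R s := by
  obtain ⟨s, hs⟩ := eventually_atBot.1 (hb.eventually (Metric.ball_mem_nhds η S.R_pos))
  have hpos := S.form_pos (hψ.mono (subset_univ (Iic s))) hs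
    (S.ne_of_ne ordConnected_univ hψ (mem_univ s) (mem_univ t₀) hne)
  refine ⟨s, (S.isConeForm.mem_or_mem hpos).imp (fun h t ht => ⟨hs t ht, ?_⟩)
    fun h t ht => ⟨hs t ht, ?_⟩⟩
  · exact S.mem_posCone_backward (hψ.mono (subset_univ _)) hs h t ht
  · exact S.neg.mem_posCone_backward (hψ.mono (subset_univ _)) hs h t ht

/-- The unstable set of `η` has only one branch in each half of the cone. -/
theorem IsTippingSetting.range_eq_of_le (S : IsTippingSetting f Λ lam J x η rc ν B c L δ R)
    (hψ : IsSol (rateField f (fun _ => lam) rc) univ ψ)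
    (hψ' : IsSol (rateField f (fun _ => lam) rc) univ ψ') (hb : Tendsto ψ' atBot (𝓝 η)) {s s' : ℝ}
    (hs : DepartsAlong ψ η ν B R s) (hs' : DepartsAlong ψ' η ν B R s')
    (hle : inner ℝ (ψ s - η) ν ≤ inner ℝ (ψ' s' - η) ν) : range ψ = range ψ' := by
  have hlim : Tendsto (fun t => inner ℝ (ψ' t - η) ν) atBot (𝓝 0) := by
    have h : Continuous fun y : EuclideanSpace ℝ (Fin n) => inner ℝ (y - η) ν := by fun_prop
    simpa [Function.comp_def] using (h.tendsto η).comp hb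
  obtain ⟨a, ha, has⟩ := ((hlim.eventually (gt_mem_nhds (hs s le_rfl).2.2)).and
    (eventually_le_atBot s')).exists
  -- At `t` both branches have the same component along `ν`. Their difference is orthogonal to `ν`,
  -- where the form is nonpositive, whereas distinct backward solutions would have a positive form.
  obtain ⟨t, ht, heq⟩ := intermediate_value_Icc has
    ((hψ'.continuousOn.mono (subset_univ _)).sub continuousOn_const |>.inner continuousOn_const)
    ⟨ha.le, hle⟩
  change inner ℝ (ψ' t - η) ν = _ at heq
  have hv : IsSol (rateField f (fun _ => lam) rc) univ (fun b => ψ (b + s)) := hψ.shift s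
  have hw : IsSol (rateField f (fun _ => lam) rc) univ (fun b => ψ' (b + t)) := hψ'.shift t
  have hst : ψ s = ψ' t := by
    by_contra hne
    have hpos := (S.expanding.isExpanding_limit S.δ_pos S.rc_pos).pos_of_Iic S.symm
      (mul_pos (inv_pos.2 S.rc_pos) S.c_pos) (b := 0) (subset_univ _)
      (hv.mono (subset_univ _)) (hw.mono (subset_univ _))
      (fun b hb => (hs (b + s) (by linarith [mem_Iic.1 hb])).1)
      (fun b hb => (hs' (b + t) (by linarith [mem_Iic.1 hb, ht.2])).1) (by simpa using hne)
    simp only [zero_add] at hpos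
    refine absurd (S.nonpos _ ?_) (not_le.2 hpos)
    rw [← sub_sub_sub_cancel_right _ _ η, inner_sub_left, heq, sub_self]
  have hall := hv.eqOn_rateField S.contDiff continuous_const hw ordConnected_univ (mem_univ 0)
    (by simpa using hst)
  refine Subset.antisymm ?_ ?_
  · rintro _ ⟨b, rfl⟩
    have := hall (mem_univ (b - s))
    simp only [sub_add_cancel] at this
    exact ⟨_, this.symm⟩
  · rintro _ ⟨b, rfl⟩
    have := hall (mem_univ (b - t))
    simp only [sub_add_cancel] at this
    exact ⟨_, this⟩

theorem IsTippingSetting.range_eq (S : IsTippingSetting f Λ lam J x η rc ν B c L δ R)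
    (hψ : IsSol (rateField f (fun _ => lam) rc) univ ψ)
    (hψ' : IsSol (rateField f (fun _ => lam) rc) univ ψ') (hb : Tendsto ψ atBot (𝓝 η))
    (hb' : Tendsto ψ' atBot (𝓝 η)) {s s' : ℝ}
    (hs : DepartsAlong ψ η ν B R s) (hs' : DepartsAlong ψ' η ν B R s') : range ψ = range ψ' := by
  rcases le_total (inner ℝ (ψ s - η) ν) (inner ℝ (ψ' s' - η) ν) with hle | hle
  · exact S.range_eq_of_le hψ hψ' hb' hs hs' hle
  · exact (S.range_eq_of_le hψ' hψ hb hs' hs hle).symm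

/-- This rules out that a connection returns close to `η` after its departure: it is eventually near
`A`, and the time before that is compact. -/
theorem exists_le_norm_sub_of_convergesTo (hA : IsCompact A) (hAne : A.Nonempty) (hηA : η ∉ A)
    (hψ : Continuous ψ) (hne : ∀ t, ψ t ≠ η)
    (hlim : Tendsto (fun t => Metric.infDist (ψ t) A) atTop (𝓝 0)) (s : ℝ) :
    ∃ m > 0, ∀ t ≥ s, m ≤ ‖ψ t - η‖ := by
  have hpos : 0 < Metric.infDist η A := (hA.isClosed.notMem_iff_infDist_pos hAne).1 hηA
  obtain ⟨b, hb⟩ := eventually_atTop.1 (hlim.eventually (gt_mem_nhds (half_pos hpos)))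
  obtain ⟨t₁, -, hmin⟩ := isCompact_Icc.exists_isMinOn (nonempty_Icc.2 (le_max_left s b))
    ((hψ.sub continuous_const).norm.continuousOn (s := Icc s (max s b)))
  refine ⟨min (Metric.infDist η A / 2) ‖ψ t₁ - η‖,
    lt_min (half_pos hpos) (norm_pos_iff.2 (sub_ne_zero.2 (hne t₁))), fun t ht => ?_⟩
  rcases le_total t (max s b) with h | h
  · exact (min_le_right _ _).trans (hmin ⟨ht, h⟩)
  · refine (min_le_left _ _).trans ?_
    have h1 := hb t ((le_max_right _ _).trans h)
    have h2 := Metric.infDist_le_infDist_add_dist (s := A) (x := η) (y := ψ t)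
    rw [dist_eq_norm'] at h2
    linarith

theorem IsConnection.isSol_rateField {C : Set (EuclideanSpace ℝ (Fin n))}
    (hC : IsConnection (fun y => f y lam) η A φ C) (rc : ℝ) :
    IsSol (rateField f (fun _ => lam) rc) univ (fun t => φ (rc⁻¹ * t)) :=
  hC.isSol.rescale rc

/-- If an edge tail is a connection that departs along one half of the cone, then the solutions
leave small balls on the corresponding side. -/
theorem IsTippingSetting.exists_leavesOnSide
    (S : IsTippingSetting f Λ lam J x η rc ν B c L δ R) [l.IsCountablyGenerated]
    (hl : l ≤ 𝓝[≠] rc) (hA : IsCompact A) (hAne : A.Nonempty)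
    (hηA : η ∉ A) (hψ : IsSol (rateField f (fun _ => lam) rc) univ ψ)
    (hlim : Tendsto (fun t => Metric.infDist (ψ t) A) atTop (𝓝 0))
    (htail : {p | IsTailPoint J x l p} ⊆ {η} ∪ range ψ ∪ A) {s : ℝ}
    (hs : DepartsAlong ψ η ν B R s) (Θ : ℝ → Set (EuclideanSpace ℝ (Fin n))) :
    ∃ ρ₂ > 0, ∀ ρ ∈ Ioo 0 ρ₂, ∃ T₂, ∀ T ≥ T₂, ∀ S₁ S₂, AreConeSides Θ (x rc) η ν B ρ T S₁ S₂ →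
      ∀ᶠ r in l, LeavesOnSide (J r) (x r) (Metric.ball η ρ) T S₁ := by
  have hl' : l ≤ 𝓝 rc := hl.trans nhdsWithin_le_nhds
  have hne : ∀ t, ψ t ≠ η := fun t => S.ne_of_ne ordConnected_univ hψ (mem_univ t) (mem_univ s)
    fun h => by
      have := (hs s le_rfl).2
      simp [h, posCone] at this
  obtain ⟨m, hm, hψm⟩ := exists_le_norm_sub_of_convergesTo hA hAne hηA
    (continuousOn_univ.1 hψ.continuousOn) hne hlim s
  have hpos : 0 < Metric.infDist η A := (hA.isClosed.notMem_iff_infDist_pos hAne).1 hηA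
  refine ⟨min R (min m (Metric.infDist η A)), lt_min S.R_pos (lt_min hm hpos),
    fun ρ ⟨hρ, hρlt⟩ => ?_⟩
  have hρR : ρ < R := hρlt.trans_le (min_le_left _ _)
  have hρm : ρ < m := hρlt.trans_le ((min_le_right _ _).trans (min_le_left _ _))
  have hρA : ρ < Metric.infDist η A := hρlt.trans_le ((min_le_right _ _).trans (min_le_right _ _))
  obtain ⟨T₁, hT₁⟩ := S.exists_near hρ
  obtain ⟨T₂, hT₂⟩ := S.exists_exit hρ hρR
  obtain ⟨a₀, ha₀, -⟩ := S.continuity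
  refine ⟨max T₁ (max T₂ a₀), fun T hT S₁ S₂ hS => ?_⟩
  have hTT₁ : T₁ ≤ T := (le_max_left _ _).trans hT
  have hTT₂ : T₂ ≤ T := (le_max_left _ _).trans ((le_max_right _ _).trans hT)
  have hTa₀ : a₀ ≤ T := (le_max_right _ _).trans ((le_max_right _ _).trans hT)
  refine ((hT₂ T hTT₂).filter_mono hl).and ?_ |>.mono fun r ⟨⟨t, hTt, hJ, hout, hin⟩, h⟩ =>
    ⟨⟨t, hJ ⟨hTt.le, le_rfl⟩, hTt, hout, mem_of_superset (Ico_mem_nhdsLT hTt) hin⟩, h⟩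
  have hrpos : ∀ᶠ r in l, 0 < r := (lt_mem_nhds S.rc_pos : ∀ᶠ r in 𝓝 rc, 0 < r).filter_mono hl'
  by_contra hcon
  rw [not_eventually] at hcon
  -- The exits considered need not be the first ones. Any sequence of exits on the wrong side has
  -- times tending to infinity, hence a limit point on the sphere that belongs to the tail.
  obtain ⟨rk, hrk, hrk'⟩ := exists_seq_forall_of_frequently (hcon.and_eventually hrpos)
  simp only [not_forall] at hrk'
  choose hbad hr0 using hrk'
  choose tk htk hnot using hbad
  have hcont : ∀ k, ContinuousAt (x (rk k)) (tk k) := fun k =>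
    (S.maximal _ (hr0 k)).isSol.continuousOn.continuousAt
      ((S.maximal _ (hr0 k)).isOpen.mem_nhds (htk k).1)
  have hsph : ∀ k, x (rk k) (tk k) ∈ Metric.sphere η ρ := fun k => by
    have h1 : x (rk k) (tk k) ∈ Metric.closedBall η ρ := Metric.isClosed_closedBall.mem_of_tendsto
      ((hcont k).tendsto.mono_left nhdsWithin_le_nhds)
      ((htk k).2.2.2.mono fun σ hσ => Metric.ball_subset_closedBall hσ)
    exact le_antisymm (Metric.mem_closedBall.1 h1) (not_lt.1 (htk k).2.2.1)
  have htinf : Tendsto tk atTop atTop := by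
    refine tendsto_atTop.2 fun b => ?_
    filter_upwards [(hrk.mono_right hl').eventually (hT₁ b)] with k hk
    by_contra! hlt
    exact (htk k).2.2.1 (hk.2 (tk k) ⟨hTT₁.trans (htk k).2.1.le, hlt.le⟩)
  obtain ⟨p, hp, φ, hφ, hplim⟩ := (isCompact_sphere η ρ).tendsto_subseq hsph
  have hpt : IsTailPoint J x l p := isTailPoint_of_tendsto (hrk.comp hφ.tendsto_atTop)
    (htinf.comp hφ.tendsto_atTop) (Eventually.of_forall fun k => (htk (φ k)).1) hplim
  have hpρ : dist p η = ρ := hp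
  -- The radius is below the distance of `η` from `A` and from `ψ` after time `s`, so `p` can only
  -- lie on the departing piece of `ψ`.
  have hpcone : p - η ∈ posCone B ν := by
    rcases htail hpt with (h | ⟨t, rfl⟩) | h
    · rw [mem_singleton_iff.1 h, dist_self] at hpρ
      exact absurd hpρ hρ.ne
    · refine (hs t ?_).2
      by_contra! hlt
      rw [dist_eq_norm] at hpρ
      linarith [hψm t hlt.le]
    · rw [dist_comm] at hpρ
      linarith [Metric.infDist_le_dist_of_mem (x := η) h]
  have hdiff : Tendsto (fun k => x (rk (φ k)) (tk (φ k)) - x rc (tk (φ k))) atTop (𝓝 (p - η)) :=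
    hplim.sub (S.tendsto.comp (htinf.comp hφ.tendsto_atTop))
  obtain ⟨k, hk⟩ := (hdiff.eventually ((isOpen_posCone B ν).mem_nhds hpcone)).exists
  have hrcJ : tk (φ k) ∈ J rc := ha₀ (hTa₀.trans (htk (φ k)).2.1.le)
  have hrccont : ContinuousAt (x rc) (tk (φ k)) :=
    (S.maximal _ S.rc_pos).isSol.continuousOn.continuousAt
      ((S.maximal _ S.rc_pos).isOpen.mem_nhds hrcJ)
  refine hnot (φ k) ?_
  filter_upwards [(htk (φ k)).2.2.2, nhdsWithin_le_nhds (Ioi_mem_nhds (htk (φ k)).2.1),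
    nhdsWithin_le_nhds (((hcont (φ k)).sub hrccont).eventually
      ((isOpen_posCone B ν).mem_nhds hk))] with σ h1 h2 h3
  exact hS.mem_left σ h2 _ h1 h3

end Connection

/-! ### Proof of the three statements -/

section Main

variable {n d : ℕ}
  {f : EuclideanSpace ℝ (Fin n) → EuclideanSpace ℝ (Fin d) → EuclideanSpace ℝ (Fin n)}
  {Λ : ℝ → EuclideanSpace ℝ (Fin d)} {lam : EuclideanSpace ℝ (Fin d)} {J : ℝ → Set ℝ}
  {x : ℝ → ℝ → EuclideanSpace ℝ (Fin n)} {η ν : EuclideanSpace ℝ (Fin n)} {rc : ℝ}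
  {B : EuclideanSpace ℝ (Fin n) →L[ℝ] EuclideanSpace ℝ (Fin n) →L[ℝ] ℝ} {c L δ R : ℝ}

theorem upperEdgeTail_eq : upperEdgeTail J x rc = {p | IsTailPoint J x (𝓝[>] rc) p} :=
  ext mem_upperEdgeTail_iff

theorem lowerEdgeTail_eq : lowerEdgeTail J x rc = {p | IsTailPoint J x (𝓝[<] rc) p} :=
  ext mem_lowerEdgeTail_iff

theorem exists_forall_Ioo_of_eventually_gt {p : ℝ → Prop} (h : ∀ᶠ r in 𝓝[>] rc, p r) :
    ∃ δ > 0, ∀ δ' ≤ δ, ∀ r ∈ Ioo rc (rc + δ'), p r := by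
  obtain ⟨b, hb, hp⟩ := (nhdsGT_basis rc).eventually_iff.1 h
  exact ⟨b - rc, sub_pos.2 hb, fun δ' hδ' r hr => hp ⟨hr.1, by linarith [hr.2]⟩⟩

theorem exists_forall_Ioo_of_eventually_lt {p : ℝ → Prop} (h : ∀ᶠ r in 𝓝[<] rc, p r) :
    ∃ δ > 0, ∀ δ' ≤ δ, ∀ r ∈ Ioo (rc - δ') rc, p r := by
  obtain ⟨b, hb, hp⟩ := (nhdsLT_basis rc).eventually_iff.1 h
  exact ⟨rc - b, sub_pos.2 hb, fun δ' hδ' r hr => hp ⟨by linarith [hr.1], hr.2⟩⟩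

theorem exists_forall_Ioo_and_Ioo {p q : ℝ → Prop} (hp : ∀ᶠ r in 𝓝[<] rc, p r)
    (hq : ∀ᶠ r in 𝓝[>] rc, q r) :
    ∃ δ > 0, (∀ r ∈ Ioo (rc - δ) rc, p r) ∧ ∀ r ∈ Ioo rc (rc + δ), q r := by
  obtain ⟨δ₁, h₁, hp⟩ := exists_forall_Ioo_of_eventually_lt hp
  obtain ⟨δ₂, h₂, hq⟩ := exists_forall_Ioo_of_eventually_gt hq
  exact ⟨min δ₁ δ₂, lt_min h₁ h₂, hp _ (min_le_left _ _), hq _ (min_le_right _ _)⟩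

/-- Solutions leaving on different sides have different edge tails. -/
theorem IsTippingSetting.upperEdgeTail_ne (S : IsTippingSetting f Λ lam J x η rc ν B c L δ R)
    {τ₀ : ℝ} {Θ : ℝ → Set (EuclideanSpace ℝ (Fin n))}
    (hΘ : IsRegularRTippingThreshold (rateField f Λ rc) η τ₀ Θ)
    (hsides : LieOnDifferentSides J x Θ η rc) : upperEdgeTail J x rc ≠ lowerEdgeTail J x rc := by
  intro heq
  obtain ⟨ρ₀, hρ₀, hsides⟩ := hsides
  obtain ⟨ρ₁, hρ₁, hρ₁R, hcone⟩ := S.exists_areConeSides hΘ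
  set ρ := min ρ₀ ρ₁ / 2
  have hm : 0 < min ρ₀ ρ₁ := lt_min hρ₀ hρ₁
  have hρ : 0 < ρ := half_pos hm
  have hρ0 : ρ < ρ₀ := (half_lt_self hm).trans_le (min_le_left _ _)
  have hρ1 : ρ < ρ₁ := (half_lt_self hm).trans_le (min_le_right _ _)
  have hρR : ρ < R := hρ1.trans_le hρ₁R
  obtain ⟨T, S₁, S₂, hS, δ', hδ', hlow, hup⟩ := hsides ρ ⟨hρ, hρ0⟩
  obtain ⟨T₁, hcone⟩ := hcone ρ ⟨hρ, hρ1⟩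
  obtain ⟨P, N, hPN⟩ := hcone (max T T₁) (le_max_right _ _)
  -- The end point of `v` lies in the upper tail and, the tails being equal, also in the lower one.
  obtain ⟨v, hv, hv0, hvR, htail⟩ := S.exists_backward_tail (l := 𝓝[>] rc)
    (nhdsWithin_mono _ fun r hr => ne_of_gt hr) hρ hρR
  have htail' : IsTailPoint J x (𝓝[<] rc) (v 0) := by
    rw [← mem_lowerEdgeTail_iff, ← heq]
    exact (mem_upperEdgeTail_iff _).2 htail
  have hpos := S.form_pos hv (fun t ht => Metric.closedBall_subset_ball hρR (hvR t ht))
    (fun h => by rw [h, sub_self, norm_zero] at hv0; exact hρ.ne hv0)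
  have hleave : ∀ {r S'}, LeavesOnSide (J r) (x r) (Metric.ball η ρ) T S' → ∀ t,
      IsExitTime (J r) (x r) (Metric.ball η ρ) (max T T₁) t → ∀ᶠ σ in 𝓝[<] t, (σ, x r σ) ∈ S' :=
    fun h t ht => h.2 t ⟨ht.1, (le_max_left _ _).trans_lt ht.2.1, ht.2.2⟩
  have hlow' : ∀ᶠ r in 𝓝[<] rc, ∀ t, IsExitTime (J r) (x r) (Metric.ball η ρ) (max T T₁) t →
      ∀ᶠ σ in 𝓝[<] t, (σ, x r σ) ∈ S₁ := by
    filter_upwards [Ioo_mem_nhdsLT (show rc - δ' < rc by linarith)] with r hr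
    exact hleave (hlow r hr)
  have hup' : ∀ᶠ r in 𝓝[>] rc, ∀ t, IsExitTime (J r) (x r) (Metric.ball η ρ) (max T T₁) t →
      ∀ᶠ σ in 𝓝[<] t, (σ, x r σ) ∈ S₂ := by
    filter_upwards [Ioo_mem_nhdsGT (show rc < rc + δ' by linarith)] with r hr
    exact hleave (hup r hr)
  have key : ∀ {ν' P' N'}, IsTippingSetting f Λ lam J x η rc ν' B c L δ R →
      AreConeSides Θ (x rc) η ν' B ρ (max T T₁) P' N' → v 0 - η ∈ posCone B ν' → False := by
    intro ν' P' N' S hP' hv'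
    have h1 := S.inter_nonempty hρR hv hv0 hvR hv' nhdsWithin_le_nhds htail' hP' hlow'
    have h2 := S.inter_nonempty hρR hv hv0 hvR hv' nhdsWithin_le_nhds htail hP' hup'
    -- The given sides need not be the cone sides, but a cone side at later times is a connected
    -- part of `S₁ ∪ S₂`. Meeting `S₁`, it lies in `S₁`, and so it cannot meet `S₂` as well.
    have hsub : P' ⊆ S₁ ∪ S₂ := by
      rw [hS.union_eq]
      refine subset_union_left.trans (hP'.areSides.union_eq.subset.trans ?_)
      exact sdiff_subset_sdiff_left (prod_mono (Ioi_subset_Ioi (le_max_left _ _)) Subset.rfl)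
    have h3 := hP'.areSides.isConnected_left.isPreconnected.subset_left_of_subset_union
      hS.isOpen_left hS.isOpen_right hS.disjoint hsub h1
    obtain ⟨q, hq, hq'⟩ := h2
    exact disjoint_left.1 hS.disjoint (h3 hq) hq'
  rcases S.isConeForm.mem_or_mem hpos with h | h
  · exact key S hPN h
  · exact key S.neg hPN.swap h

/-- Different connections are left on different sides. -/
theorem IsTippingSetting.lieOnDifferentSides (S : IsTippingSetting f Λ lam J x η rc ν B c L δ R)
    {τ₀ : ℝ} {Θ : ℝ → Set (EuclideanSpace ℝ (Fin n))}
    (hΘ : IsRegularRTippingThreshold (rateField f Λ rc) η τ₀ Θ)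
    {Aup Alow : Set (EuclideanSpace ℝ (Fin n))} {φup φlow : ℝ → EuclideanSpace ℝ (Fin n)}
    (hAup : IsAttractor (fun y => f y lam) Aup) (hAlow : IsAttractor (fun y => f y lam) Alow)
    (hup : IsConnection (fun y => f y lam) η Aup φup (upperEdgeTail J x rc))
    (hlow : IsConnection (fun y => f y lam) η Alow φlow (lowerEdgeTail J x rc))
    (hne : range φup ≠ range φlow) : LieOnDifferentSides J x Θ η rc := by
  have hrc : 0 < rc⁻¹ := inv_pos.2 S.rc_pos
  have hprop : ∀ {A φ C}, IsAttractor (fun y => f y lam) A →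
      IsConnection (fun y => f y lam) η A φ C →
      (range fun t => φ (rc⁻¹ * t)) = range φ ∧ Tendsto (fun t => φ (rc⁻¹ * t)) atBot (𝓝 η) ∧
        Tendsto (fun t => Metric.infDist (φ (rc⁻¹ * t)) A) atTop (𝓝 0) ∧
        ∃ t, φ (rc⁻¹ * t) ≠ η := fun {A φ C} hA h => by
    have hlim : Tendsto (fun t => Metric.infDist (φ (rc⁻¹ * t)) A) atTop (𝓝 0) :=
      h.forward.2.comp (tendsto_id.const_mul_atTop hrc)
    refine ⟨(mul_left_surjective₀ hrc.ne').range_comp φ,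
      h.backward.comp (tendsto_id.const_mul_atBot hrc), hlim, ?_⟩
    have hpos : 0 < Metric.infDist η A :=
      (hA.isCompact.isClosed.notMem_iff_infDist_pos hA.nonempty).1 h.notMem
    obtain ⟨t, ht⟩ := (hlim.eventually (gt_mem_nhds hpos)).exists
    exact ⟨t, fun h0 => by rw [h0] at ht; exact lt_irrefl _ ht⟩
  obtain ⟨hr1, hb1, hl1, t₁, hne1⟩ := hprop hAup hup
  obtain ⟨hr2, hb2, hl2, t₂, hne2⟩ := hprop hAlow hlow
  have hs1 := hup.isSol_rateField rc
  have hs2 := hlow.isSol_rateField rc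
  -- After a choice of orientation the lower connection departs along `ν'`. The upper one must then
  -- depart along `-ν'`, since each half cone contains only one unstable branch.
  have key : ∀ {ν'}, IsTippingSetting f Λ lam J x η rc ν' B c L δ R →
      ∀ s', DepartsAlong (fun t => φlow (rc⁻¹ * t)) η ν' B R s' →
      LieOnDifferentSides J x Θ η rc := by
    intro ν' S s' hs'
    obtain ⟨s, hs | hs⟩ := S.exists_departsAlong hs1 hb1 hne1
    · exact absurd (by rw [← hr1, ← hr2, S.range_eq hs1 hs2 hb1 hb2 hs hs']) hne
    obtain ⟨ρ₁, hρ₁, -, h1⟩ := S.exists_areConeSides hΘ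
    obtain ⟨ρ₂, hρ₂, h2⟩ := S.exists_leavesOnSide (l := 𝓝[<] rc)
      (nhdsWithin_mono _ fun r hr => ne_of_lt hr) hAlow.isCompact hAlow.nonempty hlow.notMem hs2 hl2
      (by rw [hr2, ← lowerEdgeTail_eq]; exact hlow.subset) hs' Θ
    obtain ⟨ρ₃, hρ₃, h3⟩ := S.neg.exists_leavesOnSide (l := 𝓝[>] rc)
      (nhdsWithin_mono _ fun r hr => ne_of_gt hr) hAup.isCompact hAup.nonempty hup.notMem hs1 hl1
      (by rw [hr1, ← upperEdgeTail_eq]; exact hup.subset) hs Θ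
    refine ⟨min ρ₁ (min ρ₂ ρ₃), lt_min hρ₁ (lt_min hρ₂ hρ₃), fun ρ ⟨hρ, hρlt⟩ => ?_⟩
    obtain ⟨hρ1, hρ2, hρ3⟩ := by simpa only [lt_min_iff] using hρlt
    obtain ⟨T₁, h1⟩ := h1 ρ ⟨hρ, hρ1⟩
    obtain ⟨T₂, h2⟩ := h2 ρ ⟨hρ, hρ2⟩
    obtain ⟨T₃, h3⟩ := h3 ρ ⟨hρ, hρ3⟩
    obtain ⟨S₁, S₂, hS⟩ := h1 (max T₁ (max T₂ T₃)) (le_max_left _ _)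
    exact ⟨_, S₁, S₂, hS.areSides, exists_forall_Ioo_and_Ioo
      (h2 _ ((le_max_left _ _).trans (le_max_right _ _)) S₁ S₂ hS)
      (h3 _ ((le_max_right _ _).trans (le_max_right _ _)) S₂ S₁ hS.swap)⟩
  obtain ⟨s', hs' | hs'⟩ := S.exists_departsAlong hs2 hb2 hne2
  · exact key S s' hs'
  · exact key S.neg s' hs'

theorem IsTippingSetting.convergesTo_up (S : IsTippingSetting f Λ lam J x η rc ν B c L δ R)
    {A : Set (EuclideanSpace ℝ (Fin n))} {φ : ℝ → EuclideanSpace ℝ (Fin n)}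
    (hA : IsAttractor (fun y => f y lam) A)
    (hC : IsConnection (fun y => f y lam) η A φ (upperEdgeTail J x rc)) :
    ∀ᶠ r in 𝓝[>] rc, ConvergesTo (J r) (x r) A :=
  S.eventually_convergesTo (l := 𝓝[>] rc) (nhdsWithin_mono _ fun r hr => ne_of_gt hr) hA
    (by rwa [upperEdgeTail_eq] at hC)

theorem IsTippingSetting.convergesTo_low (S : IsTippingSetting f Λ lam J x η rc ν B c L δ R)
    {A : Set (EuclideanSpace ℝ (Fin n))} {φ : ℝ → EuclideanSpace ℝ (Fin n)}
    (hA : IsAttractor (fun y => f y lam) A)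
    (hC : IsConnection (fun y => f y lam) η A φ (lowerEdgeTail J x rc)) :
    ∀ᶠ r in 𝓝[<] rc, ConvergesTo (J r) (x r) A :=
  S.eventually_convergesTo (l := 𝓝[<] rc) (nhdsWithin_mono _ fun r hr => ne_of_lt hr) hA
    (by rwa [lowerEdgeTail_eq] at hC)

end Main

theorem mainTheorem6 {n d : ℕ}
    (f : EuclideanSpace ℝ (Fin n) → EuclideanSpace ℝ (Fin d) → EuclideanSpace ℝ (Fin n))
    (hf : ContDiff ℝ 1 (fun p : EuclideanSpace ℝ (Fin n) × EuclideanSpace ℝ (Fin d) => f p.1 p.2))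
    (Λ : ℝ → EuclideanSpace ℝ (Fin d)) (hΛ : ContDiff ℝ 1 Λ)
    (lamPlus : EuclideanSpace ℝ (Fin d)) (hlim : Tendsto Λ atTop (𝓝 lamPlus))
    (J : ℝ → Set ℝ) (x : ℝ → ℝ → EuclideanSpace ℝ (Fin n)) (hx : IsSolutionFamily f Λ J x)
    (η : EuclideanSpace ℝ (Fin n))
    (hη : IsEquilibriumRegularEdgeState (fun y => f y lamPlus) η)
    (rc : ℝ) (hrc : IsCriticalRate J x η rc)
    (τ₀ : ℝ) (Θ : ℝ → Set (EuclideanSpace ℝ (Fin n)))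
    (hΘ : IsRegularRTippingThreshold (rateField f Λ rc) η τ₀ Θ) :
    (LieOnDifferentSides J x Θ η rc → upperEdgeTail J x rc ≠ lowerEdgeTail J x rc) ∧
    ((∃ A φ, IsAttractor (fun y => f y lamPlus) A ∧
        IsConnection (fun y => f y lamPlus) η A φ (upperEdgeTail J x rc)) →
      (∃ A φ, IsAttractor (fun y => f y lamPlus) A ∧
        IsConnection (fun y => f y lamPlus) η A φ (lowerEdgeTail J x rc)) →
      ∃ δ > 0, ∀ r, 0 < |r - rc| → |r - rc| < δ →
        ∃ A, IsAttractor (fun y => f y lamPlus) A ∧ ConvergesTo (J r) (x r) A) ∧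
    (∀ (Aup Alow : Set (EuclideanSpace ℝ (Fin n))) (φup φlow : ℝ → EuclideanSpace ℝ (Fin n)),
      IsAttractor (fun y => f y lamPlus) Aup → IsAttractor (fun y => f y lamPlus) Alow →
      IsConnection (fun y => f y lamPlus) η Aup φup (upperEdgeTail J x rc) →
      IsConnection (fun y => f y lamPlus) η Alow φlow (lowerEdgeTail J x rc) →
      range φup ≠ range φlow →
      LieOnDifferentSides J x Θ η rc ∧
      ∃ δ > 0, (∀ r ∈ Ioo (rc - δ) rc, ConvergesTo (J r) (x r) Alow) ∧
        (∀ r ∈ Ioo rc (rc + δ), ConvergesTo (J r) (x r) Aup)) := by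
  obtain ⟨ν, B, c, L, δ, R, S⟩ := exists_isTippingSetting hf hΛ.continuous hlim hx hη hrc
  refine ⟨S.upperEdgeTail_ne hΘ, ?_, ?_⟩
  · rintro ⟨Aup, φup, hAup, hup⟩ ⟨Alow, φlow, hAlow, hlow⟩
    obtain ⟨δ', hδ', h1, h2⟩ := exists_forall_Ioo_and_Ioo (S.convergesTo_low hAlow hlow)
      (S.convergesTo_up hAup hup)
    refine ⟨δ', hδ', fun r hr hr' => ?_⟩
    rw [abs_lt] at hr'
    rcases lt_or_gt_of_ne (sub_ne_zero.1 (abs_pos.1 hr)) with h | h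
    · exact ⟨Alow, hAlow, h1 r ⟨by linarith, h⟩⟩
    · exact ⟨Aup, hAup, h2 r ⟨h, by linarith⟩⟩
  · intro Aup Alow φup φlow hAup hAlow hup hlow hne
    exact ⟨S.lieOnDifferentSides hΘ hAup hAlow hup hlow hne,
      exists_forall_Ioo_and_Ioo (S.convergesTo_low hAlow hlow) (S.convergesTo_up hAup hup)⟩
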